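/- **Setting.** Let $(\Omega,\mathcal H,\mathbb P)$ be a probability space with a filtration $(\mathcal F_t)_{t\ge 0}$, let $1<\alpha\le 2$, $d\ge 1$, and let $L$ be a $d$-dimensional $\alpha$-stable Lévy process with respect to this filtration (for example, the filtration generated by $L$): $t^{-1/\alpha}L_t\overset{d}{=}L_1$; for $\alpha<2$ its Lévy measure is $B\mapsto\int_0^\infty\int_{\mathbb S^d}\mathbf 1_B(wv)\,\frac{c}{w^{\alpha+1}}\,\tilde\sigma(\mathrm dv)\,\mathrm dw$ with $c>0$ and a probability measure $\tilde\sigma$ on the unit sphere $\mathbb S^d$ of $\mathbb R^d$; for $\alpha=2$ it is a Brownian motion whose components are standard and have a positive definite correlation matrix. Let $0=t_0<t_1<\dots<t_N=T$, $r\in\mathbb R$, $M>0$, let $\mu:[0,T]\to\mathbb R^d$ and $\sigma:[0,T]\to\mathbb R^{d\times d}$ be continuous with $\sigma_t$ symmetric positive definite, and let one of the following hold: (A) $L$ is symmetric ($L\overset d=-L$), and $K:=[-M,M]^d$; or (B) $d=1$, and $K:=[0,M]$ (no short selling). A *strategy* is $u=(u_0,\dots,u_{N-1})$ where $u_n$ is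 a $K$-valued $\mathcal F_{t_n}$-measurable random variable, the amounts of money held in the $d$ risky assets during $(t_n,t_{n+1}]$; it is *deterministic* if all $u_n$ are constants. For $x\in\mathbb R$, $X=X^{n,x,u}$ is the wealth process started at time $t_n$ from $x$, $$\mathrm dX_t=\Big(rX_t+\sum_i u^i_t(\mu^i_t-r)\Big)\mathrm dt+\sum_{i,j}u^i_t\sigma^{ij}_t\,\mathrm dL^j_t,\qquad X_{t_n}=x,$$ with $u_t:=u_k$ for $t\in(t_k,t_{k+1}]$, and $G^{u}_{n,x}:=X_T-xe^{r(T-t_n)}$ is the gain. A *risk measure* $\rho$ is a map with values in $\mathbb R\cup\{+\infty\}$, on a set of random variables stable under multiplication by constants $\beta\ge0$ and addition of constants, that is law-invariant, positively homogeneous ($\rho(\beta Y)=\beta\rho(Y)$ for $\beta\ge 0$) and either cash-invariant ($\rho(Y+m)=\rho(Y)-m$ for all $m\in\mathbb R$) or shift-invariant ($\rho(Y+m)=\rho(Y)$ for all $m\in\mathbb R$); $\rho_t(Y)$ is $\rho$ evaluated at the conditional law of $Y$ given $\mathcal F_t$. Let $\mathcal T\in C^1(\mathbb R)$ be non-decreasing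 and concave, $F\in C^1(\mathbb R)$ non-decreasing and convex, $\lambda:[0,T]\to(0,\infty)$ continuous, and assume $\mathbb E|\mathcal T(a+\langle b,L_t\rangle)|<\infty$ for all $a\in\mathbb R$, $b\in\mathbb R^d$, $t\in(0,T]$, and that $\langle a,L_1\rangle$ is in the domain of $\rho$ with $\rho(\langle a,L_1\rangle)<\infty$ for all $a\in K$. Put $$J_n(x,u):=\mathbb E\big[\mathcal T(G^u_{n,x})\,\big|\,\mathcal F_{t_n}\big]-\lambda_{t_n}F\big(\rho_{t_n}(G^u_{n,x})\big).$$ A strategy $\hat u$ is *time-consistently optimal* (a perfect subgame Nash equilibrium, i.e. it attains the recursively defined supremum $\sup_u J_n(x,u)$ over the strategies $u$ that coincide with $\hat u$ in all later periods) if for all $n<N$, all $x\in\mathbb R$ and every $K$-valued $\mathcal F_{t_n}$-measurable $\xi$, almost surely $J_n(x,u)\le J_n(x,\hat u)$, where $u$ is $\hat u$ with $\hat u_n$ replaced by $\xi$. **Theorem 4.1.** 1. There is a deterministic time-consistently optimal strategy $\hat v$, and its value $J_n(x,\hat v)$ is almost surely a constant $V_n$ that does not depend on $x$. 2. The supremum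 may be taken over deterministic strategies only: a deterministic strategy $v$ with, for all $n$, $x$ and all constants $\xi=c\in K$, $J_n(x,u)\le J_n(x,v)$ a.s. (where $u$ is $v$ with $v_n$ replaced by $c$) is time-consistently optimal among all strategies. 3. Whenever a deterministic strategy is changed in one period $n$ into a $K$-valued $\mathcal F_{t_n}$-measurable $\xi$, the wealth process exists, the reward of the gain is integrable, and $\rho_{t_n}$ of the gain is defined and finite almost surely; so all the functionals compared in 1 and 2 are well defined. 4. Assume that $L$ is non-degenerate, i.e. $\langle a,L_1\rangle$ is not a.s. zero for any $a\in\mathbb R^d\setminus\{0\}$ (automatic for $\alpha=2$ and for $d=1$). The time-consistently optimal strategy is almost surely unique among all strategies if either (a) $\mathcal T$ is strictly concave and $\rho(\langle a,L_1\rangle)\ge 0$ for all $a\in K$; or (b) $-F$ is strictly concave, $\mathcal T$ is not constant, and $\rho(\langle a,L_1\rangle)>0$ for all $a\in K\setminus\{0\}$. -/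

import Mathlib

open MeasureTheory ProbabilityTheory Filter Topology Set
open scoped Matrix

noncomputable section

/-- `f` is càdlàg on `s`: right-continuous with left limits at every point of `s`
(both relative to `s`). -/
def CadlagOn {E : Type*} [TopologicalSpace E] (f : ℝ → E) (s : Set ℝ) : Prop :=
  ∀ t ∈ s, ContinuousWithinAt f (s ∩ Ici t) t ∧ ∃ l : E, Tendsto f (𝓝[s ∩ Iio t] t) (𝓝 l)

/-! ### Stable Lévy processes -/

/-- `L` is a Lévy process on `[0, ∞)` with respect to the filtration `𝓕`: it is adapted, starts
at `0`, has a.s. càdlàg paths, its increments are independent of the past and stationary.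
Only the values at nonnegative times matter. -/
structure IsLevy {Ω : Type*} {mΩ : MeasurableSpace Ω} {d : ℕ} (P : Measure Ω)
    (𝓕 : Filtration ℝ mΩ) (L : ℝ → Ω → EuclideanSpace ℝ (Fin d)) : Prop where
  adapted : ∀ t, 0 ≤ t → Measurable[𝓕 t] (L t)
  zero : ∀ᵐ ω ∂P, L 0 ω = 0
  cadlag : ∀ᵐ ω ∂P, CadlagOn (fun t => L t ω) (Ici 0)
  indep : ∀ s t, 0 ≤ s → s ≤ t →
    Indep (MeasurableSpace.comap (fun ω => L t ω - L s ω) inferInstance) (𝓕 s) P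
  stationary : ∀ s t, 0 ≤ s → s ≤ t → P.map (fun ω => L t ω - L s ω) = P.map (L (t - s))

/-- The Lévy measure `B ↦ ∫_{w > 0} ∫_{S} 1_B (w v) c / w ^ (α + 1) σ(dv) dw` with `σ` a measure
on the unit sphere `S` of `ℝ^d`. -/
def stableLevyMeasure {d : ℕ} (α c : ℝ)
    (sph : Measure (Metric.sphere (0 : EuclideanSpace ℝ (Fin d)) 1)) :
    Measure (EuclideanSpace ℝ (Fin d)) :=
  ((((volume : Measure ℝ).restrict (Ioi 0)).withDensity
      (fun w => ENNReal.ofReal (c / w ^ (α + 1)))).prod sph).map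
    (fun p => p.1 • (p.2 : EuclideanSpace ℝ (Fin d)))

/-- `L` is an `α`-stable Lévy process, `1 < α ≤ 2`: it is self-similar, and
* for `α < 2` its law at time `1` has the Lévy–Khintchine exponent
  `∫ (e^{i⟨x, ξ⟩} - 1 - i⟨x, ξ⟩) ν(dx)` for a Lévy measure `ν` of the polar form above
  (there is no Gaussian part, and no drift because of the self-similarity with `α > 1`);
* for `α = 2` it is a `d`-dimensional Brownian motion whose components are standard and have a
  positive definite correlation matrix. -/
structure IsStableLevy {Ω : Type*} {mΩ : MeasurableSpace Ω} {d : ℕ} (P : Measure Ω)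
    (𝓕 : Filtration ℝ mΩ) (α : ℝ) (L : ℝ → Ω → EuclideanSpace ℝ (Fin d)) : Prop
    extends IsLevy P 𝓕 L where
  one_lt : 1 < α
  le_two : α ≤ 2
  self_similar : ∀ t, 0 < t → P.map (fun ω => (t ^ (-(1 / α)) : ℝ) • L t ω) = P.map (L 1)
  law_of_lt_two : α < 2 →
    ∃ (c : ℝ) (sph : Measure (Metric.sphere (0 : EuclideanSpace ℝ (Fin d)) 1)),
      0 < c ∧ IsProbabilityMeasure sph ∧
      ∀ ξ : EuclideanSpace ℝ (Fin d), charFun (P.map (L 1)) ξ =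
        Complex.exp (∫ x, (Complex.exp ((inner ℝ x ξ : ℝ) * Complex.I) - 1
          - (inner ℝ x ξ : ℝ) * Complex.I) ∂(stableLevyMeasure α c sph))
  law_of_eq_two : α = 2 →
    ∃ R : Matrix (Fin d) (Fin d) ℝ, R.PosDef ∧ (∀ i, R i i = 1) ∧
      P.map (L 1) = multivariateGaussian 0 R

/-! ### Risk measures -/

/-- A risk measure: a law-invariant, positively homogeneous functional with values in
`ℝ ∪ {+∞}` that is cash-invariant or shift-invariant. Its domain is any set of random variables
on which these axioms make sense, i.e. one that is stable under scaling and shifts. -/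
structure RiskMeasure {Ω : Type*} [MeasurableSpace Ω] (P : Measure Ω) where
  domain : Set (Ω → ℝ)
  aemeasurable : ∀ Y ∈ domain, AEMeasurable Y P
  smul_mem : ∀ Y ∈ domain, ∀ β : ℝ, 0 ≤ β → (fun ω => β * Y ω) ∈ domain
  shift_mem : ∀ Y ∈ domain, ∀ m : ℝ, (fun ω => Y ω + m) ∈ domain
  toFun : (Ω → ℝ) → EReal
  ne_bot : ∀ Y ∈ domain, toFun Y ≠ ⊥
  law_invariant : ∀ Y ∈ domain, ∀ Z ∈ domain, P.map Y = P.map Z → toFun Y = toFun Z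
  pos_homogeneous : ∀ Y ∈ domain, ∀ β : ℝ, 0 ≤ β → toFun (fun ω => β * Y ω) = β * toFun Y
  cash_or_shift :
    (∀ Y ∈ domain, ∀ m : ℝ, toFun (fun ω => Y ω + m) = toFun Y - (m : EReal)) ∨
    (∀ Y ∈ domain, ∀ m : ℝ, toFun (fun ω => Y ω + m) = toFun Y)

open scoped Classical in
/-- The risk measure as a function `ρ'` of the law (`⊤` if the law is not the law of a random
variable in the domain). -/
def RiskMeasure.ofLaw {Ω : Type*} [MeasurableSpace Ω] {P : Measure Ω} (ρ : RiskMeasure P)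
    (ν : Measure ℝ) : EReal :=
  if h : ∃ Y ∈ ρ.domain, P.map Y = ν then ρ.toFun h.choose else ⊤

/-- The (regular) conditional law of the real random variable `Y` given the σ-algebra `m`. -/
def condLaw {Ω : Type*} (m : MeasurableSpace Ω) {mΩ : MeasurableSpace Ω} (P : Measure Ω)
    [IsFiniteMeasure P] (Y : Ω → ℝ) (ω : Ω) : Measure ℝ :=
  @Kernel.toFun Ω ℝ m _ (@condDistrib Ω Ω ℝ _ _ _ mΩ m Y (fun ω' => ω') P _) ω

/-- The dynamic version of the risk measure: `ρ'` applied to the conditional law. -/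
def RiskMeasure.cond {Ω : Type*} (m : MeasurableSpace Ω) {mΩ : MeasurableSpace Ω}
    {P : Measure Ω} [IsFiniteMeasure P] (ρ : RiskMeasure P) (Y : Ω → ℝ) (ω : Ω) : EReal :=
  ρ.ofLaw (condLaw m P Y ω)

/-! ### Stochastic integrals -/

/-- The Riemann sum `∑ₖ ⟨H_{sₖ}, L_{sₖ₊₁} - L_{sₖ}⟩` over the equidistant partition
`sₖ = a + k (b - a) / m` of `[a, b]`. -/
def riemannSum {Ω : Type*} {d : ℕ} (H L : ℝ → Ω → EuclideanSpace ℝ (Fin d)) (a b : ℝ) (m : ℕ)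
    (ω : Ω) : ℝ :=
  ∑ k ∈ Finset.range m,
    inner ℝ (H (a + k * ((b - a) / m)) ω)
      (L (a + (k + 1) * ((b - a) / m)) ω - L (a + k * ((b - a) / m)) ω)

/-- `I` is the stochastic integral process `I_t = ∑ⱼ ∫_{a+}^t Hʲ_s dLʲ_s`, `t ∈ [a, b]`, of the
adapted càglàd process `H`: the càdlàg process whose values are the limits in probability of the
Riemann sums. -/
def IsStochIntegral {Ω : Type*} [MeasurableSpace Ω] {d : ℕ} (P : Measure Ω)
    (H L : ℝ → Ω → EuclideanSpace ℝ (Fin d)) (a b : ℝ) (I : ℝ → Ω → ℝ) : Prop :=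
  (∀ᵐ ω ∂P, CadlagOn (fun t => I t ω) (Icc a b)) ∧
  ∀ t ∈ Icc a b, TendstoInMeasure P (fun m => riemannSum H L a t m) atTop (I t)

/-! ### The control problem -/

/-- The data of the mean-risk problem with `d` risky assets and `N` trading periods. -/
structure MeanRiskProblem {Ω : Type*} [mΩ : MeasurableSpace Ω] (P : Measure Ω) (d N : ℕ) where
  /-- information -/
  𝓕 : Filtration ℝ mΩ
  /-- driving noise -/
  L : ℝ → Ω → EuclideanSpace ℝ (Fin d)
  /-- short rate -/
  r : ℝ
  /-- drift of the risky assets -/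
  μ : ℝ → Fin d → ℝ
  /-- volatility matrix -/
  σ : ℝ → Matrix (Fin d) (Fin d) ℝ
  /-- grid points `t_0 < t_1 < ... < t_N` -/
  grid : Fin (N + 1) → ℝ
  /-- the admissible positions -/
  K : Set (EuclideanSpace ℝ (Fin d))
  /-- reward function of gains and losses -/
  reward : ℝ → ℝ
  /-- penalty function applied to the risk -/
  F : ℝ → ℝ
  /-- risk aversion -/
  lam : ℝ → ℝ
  /-- risk measure -/
  ρ : RiskMeasure P

namespace MeanRiskProblem

variable {Ω : Type*} [mΩ : MeasurableSpace Ω] {P : Measure Ω} {d N : ℕ}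

/-- The time horizon. -/
def horizon (D : MeanRiskProblem P d N) : ℝ := D.grid (Fin.last N)

/-- The beginning `t_n` of the `n`-th period `(t_n, t_{n+1}]`. -/
def start (D : MeanRiskProblem P d N) (n : Fin N) : ℝ := D.grid n.castSucc

/-- `ξ` is an admissible position for the period `(t_n, t_{n+1}]`: it takes values in `K` and is
known at time `t_n`. -/
def AdmissiblePosition (D : MeanRiskProblem P d N) (n : Fin N)
    (ξ : Ω → EuclideanSpace ℝ (Fin d)) : Prop :=
  Measurable[D.𝓕 (D.start n)] ξ ∧ ∀ ω, ξ ω ∈ D.K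

/-- The left-continuous, piecewise constant control process that equals `u k` on
`(t_k, t_{k+1}]`. -/
def path (D : MeanRiskProblem P d N) (u : Fin N → Ω → EuclideanSpace ℝ (Fin d)) (s : ℝ) (ω : Ω) :
    EuclideanSpace ℝ (Fin d) :=
  ∑ k : Fin N, (Ioc (D.grid k.castSucc) (D.grid k.succ)).indicator (fun _ => u k ω) s

/-- `X` is the wealth process under the strategy `u` that is started at time `t_n` with wealth
`x`, i.e. on `[t_n, T]` it solves
`dX_t = (r X_t + ∑ᵢ uⁱ_t (μⁱ_t - r)) dt + ∑ᵢⱼ uⁱ_t σⁱʲ_t dLʲ_t`, `X_{t_n} = x`. -/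
def IsWealth (D : MeanRiskProblem P d N) (n : Fin N) (x : ℝ)
    (u : Fin N → Ω → EuclideanSpace ℝ (Fin d)) (X : ℝ → Ω → ℝ) : Prop :=
  (∀ t ∈ Icc (D.start n) D.horizon, AEMeasurable (X t) P) ∧
  (∀ᵐ ω ∂P, CadlagOn (fun t => X t ω) (Icc (D.start n) D.horizon)) ∧
  ∃ I : ℝ → Ω → ℝ,
    IsStochIntegral P (fun s ω => WithLp.toLp 2 ((D.path u s ω).ofLp ᵥ* D.σ s)) D.L
      (D.start n) D.horizon I ∧
    ∀ᵐ ω ∂P, ∀ t ∈ Icc (D.start n) D.horizon,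
      X t ω = x + (∫ s in (D.start n)..t,
        (D.r * X s ω + ∑ i, D.path u s ω i * (D.μ s i - D.r))) + I t ω

open scoped Classical in
/-- The wealth process; the defining equation determines it up to indistinguishability. -/
def wealth (D : MeanRiskProblem P d N) (n : Fin N) (x : ℝ)
    (u : Fin N → Ω → EuclideanSpace ℝ (Fin d)) : ℝ → Ω → ℝ :=
  if h : ∃ X, D.IsWealth n x u X then h.choose else 0

/-- The gain `X_T - x e^{r (T - t_n)}` over the remaining time, from wealth `x` at time `t_n`. -/
def gain (D : MeanRiskProblem P d N) (n : Fin N) (x : ℝ)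
    (u : Fin N → Ω → EuclideanSpace ℝ (Fin d)) (ω : Ω) : ℝ :=
  D.wealth n x u D.horizon ω - x * Real.exp (D.r * (D.horizon - D.start n))

/-- The mean-risk functional at time `t_n` with wealth `x`: the conditional expected reward of the
gain minus `λ_{t_n} F(conditional risk of the gain)`, given the information at time `t_n`. -/
def J [IsProbabilityMeasure P] (D : MeanRiskProblem P d N) (n : Fin N) (x : ℝ)
    (u : Fin N → Ω → EuclideanSpace ℝ (Fin d)) (ω : Ω) : ℝ :=
  (P[fun ω' => D.reward (D.gain n x u ω') | D.𝓕 (D.start n)]) ω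
    - D.lam (D.start n) * D.F (RiskMeasure.cond (D.𝓕 (D.start n)) D.ρ (D.gain n x u) ω).toReal

/-- All the terms of `J n x u` are meaningful: the wealth process exists, the reward is integrable
and a.s. the conditional law of the gain is one to which the risk measure applies, with finite
risk. -/
def WellPosed [IsProbabilityMeasure P] (D : MeanRiskProblem P d N) (n : Fin N) (x : ℝ)
    (u : Fin N → Ω → EuclideanSpace ℝ (Fin d)) : Prop :=
  (∃ X, D.IsWealth n x u X) ∧
  Integrable (fun ω => D.reward (D.gain n x u ω)) P ∧
  ∀ᵐ ω ∂P, ∃ Y ∈ D.ρ.domain,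
    P.map Y = condLaw (D.𝓕 (D.start n)) P (D.gain n x u) ω ∧ D.ρ.toFun Y < ⊤

/-- `u` is a time-consistent optimal strategy (perfect subgame Nash equilibrium): at each time
`t_n`, from each wealth `x`, given that `u` is followed in all later periods, the position `u n` is
optimal among all the positions that are admissible for the period `(t_n, t_{n+1}]`. -/
def IsEquilibrium [IsProbabilityMeasure P] (D : MeanRiskProblem P d N)
    (u : Fin N → Ω → EuclideanSpace ℝ (Fin d)) : Prop :=
  (∀ n, D.AdmissiblePosition n (u n)) ∧
  ∀ (n : Fin N) (x : ℝ) (ξ : Ω → EuclideanSpace ℝ (Fin d)), D.AdmissiblePosition n ξ →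
    ∀ᵐ ω ∂P, D.J n x (Function.update u n ξ) ω ≤ D.J n x u ω

/-- The deterministic strategy with position `v k` in the `k`-th period. -/
def det (v : Fin N → EuclideanSpace ℝ (Fin d)) : Fin N → Ω → EuclideanSpace ℝ (Fin d) :=
  fun k _ => v k

/-- Optimality of the deterministic strategy `v` among deterministic strategies only. -/
def IsDetEquilibrium [IsProbabilityMeasure P] (D : MeanRiskProblem P d N)
    (v : Fin N → EuclideanSpace ℝ (Fin d)) : Prop :=
  (∀ n, v n ∈ D.K) ∧
  ∀ (n : Fin N) (x : ℝ), ∀ c ∈ D.K,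
    ∀ᵐ ω ∂P, D.J n x (det (Function.update v n c)) ω ≤ D.J n x (det v) ω

end MeanRiskProblem

end

open MeasureTheory ProbabilityTheory Filter Topology Set
open scoped Matrix ENNReal

set_option linter.unusedSectionVars false

/-! The wealth equation is linear, so the gain from time `t_n` on is `∑ k, ⟨u k, A k + m k⟩`: the
wealth `x` cancels, `A k` is the compounded noise of period `k`, `m k` is deterministic, and periods
before `n` contribute nothing. If the later positions are constants, the gain is `⟨u n, Z₁⟩ + Z₂`
with `Z = (Z₁, Z₂)` independent of the information at time `t_n`. Conditional reward and conditional
risk are therefore obtained by freezing the current position.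

The law of the frozen gain is found from stability. The characteristic function `φ` of `L 1`
satisfies `φ(s^(1/α) ξ) φ(t^(1/α) ξ) = φ((s+t)^(1/α) ξ)`. The centred gain is a limit in probability
of sums of `⟨e, L t - L s⟩` over consecutive intervals. In both cases (A) and (B) the vectors `e`
stay in a set on which every `⟨e, L 1⟩` is a nonnegative multiple, in law, of one `X = ⟨a₀, L 1⟩`.
Independent sums and limits preserve this (`IsStepSum.exists_scale`, `StepLim.exists_scale`), so for
`c ∈ K` the frozen gain is distributed as `s(c) X + m(c)` with `m` affine and `s ≥ 0` continuous
(`exists_scaled`).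

By the axioms of the risk measure the functional is then `j(u n)`, where `j(c) = E T(m + s X) - λ
F(s ρ(X) - δ m)` is deterministic and continuous on the compact set `K`, with `δ = 1` under
cash-invariance and `δ = 0` under shift-invariance (`exists_objective`). Maximising `j` period by
period, backwards in time, gives the deterministic equilibrium. A random competitor only inserts
another point of `K` into `j` for each scenario, so it gains nothing.

Uniqueness compares two maximisers with their midpoint (`maximiser_unique`). Since `s(c) E|X| =
E|Y_c - m(c)|` for the frozen gain `Y_c`, the scale `s` is convex; hence `j` is midpoint concave and
all intermediate inequalities are equalities. Strict concavity of `T` then makes the two gains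
equal. If instead `F` is strictly convex, the risks are equal. Equal scales force the centred gains
to coincide by a strictly convex test function; different scales are possible only under
cash-invariance, and then they force `T` to be affine, hence the means to be equal, a contradiction.

The stochastic integrals are constructed by hand: a maximal inequality of Ottaviani type, derived
from bounds on characteristic functions, gives uniform convergence of step integrals and thus càdlàg
paths. -/

section

/-! ### Characteristic functions of stable Lévy processes -/

namespace IsStableLevy

variable {Ω : Type*} {mΩ : MeasurableSpace Ω} {P : Measure Ω} [IsProbabilityMeasure P] {d : ℕ}
  {𝓕 : Filtration ℝ mΩ} {α : ℝ} {L : ℝ → Ω → EuclideanSpace ℝ (Fin d)}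

lemma measurable_at (hL : IsStableLevy P 𝓕 α L) {t : ℝ} (ht : 0 ≤ t) : Measurable (L t) :=
  (hL.adapted t ht).mono (𝓕.le t) le_rfl

lemma alpha_pos (hL : IsStableLevy P 𝓕 α L) : 0 < α := lt_trans one_pos hL.one_lt

lemma isProbabilityMeasure_map (hL : IsStableLevy P 𝓕 α L) {t : ℝ} (ht : 0 ≤ t) :
    IsProbabilityMeasure (P.map (L t)) :=
  Measure.isProbabilityMeasure_map (hL.measurable_at ht).aemeasurable

/-- Self-similarity in Fourier form. The case `t = 0` fits because `0 ^ (1 / α) = 0`, so empty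
intervals need no special treatment later. -/
lemma charFun_map (hL : IsStableLevy P 𝓕 α L) {t : ℝ} (ht : 0 ≤ t)
    (ξ : EuclideanSpace ℝ (Fin d)) :
    charFun (P.map (L t)) ξ = charFun (P.map (L 1)) ((t ^ (1 / α)) • ξ) := by
  have hα := hL.alpha_pos
  rcases ht.eq_or_lt with rfl | ht'
  · rw [Real.zero_rpow (by positivity), zero_smul, charFun_zero]
    have := hL.isProbabilityMeasure_map (t := 1) zero_le_one
    rw [charFun_apply, integral_map (hL.measurable_at le_rfl).aemeasurable (by fun_prop)]
    have : (fun ω => Complex.exp ((inner ℝ (L 0 ω) ξ : ℝ) * Complex.I)) =ᵐ[P] fun _ => 1 := by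
      filter_upwards [hL.zero] with ω h
      simp [h]
    rw [integral_congr_ae this]
    simp
  · rw [← hL.self_similar t ht',
      charFun_map_smul_comp (hL.measurable_at ht).aemeasurable, smul_smul,
      ← Real.rpow_add ht']
    simp

lemma charFun_increment (hL : IsStableLevy P 𝓕 α L) {s t : ℝ} (hs : 0 ≤ s) (hst : s ≤ t)
    (ξ : EuclideanSpace ℝ (Fin d)) :
    ∫ ω, Complex.exp ((inner ℝ ξ (L t ω - L s ω) : ℝ) * Complex.I) ∂P =
      charFun (P.map (L 1)) (((t - s) ^ (1 / α)) • ξ) := by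
  have hm : Measurable fun ω => L t ω - L s ω :=
    (hL.measurable_at (hs.trans hst)).sub (hL.measurable_at hs)
  rw [← hL.charFun_map (sub_nonneg.2 hst), ← hL.stationary s t hs hst, charFun_apply,
    integral_map hm.aemeasurable (by fun_prop)]
  simp_rw [real_inner_comm ξ]

/-- Independence of the past in Fourier form. The test variable `G` carries everything known at time
`s`, which lets sums of increments be factorised one increment at a time. The exponential has
modulus one, so no integrability of `G` is needed. -/
lemma integral_mul_exp_increment (hL : IsStableLevy P 𝓕 α L) {s t : ℝ} (hs : 0 ≤ s)
    (hst : s ≤ t) (ξ : EuclideanSpace ℝ (Fin d)) {G : Ω → ℂ} (hG : Measurable[𝓕 s] G) :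
    ∫ ω, G ω * Complex.exp ((inner ℝ ξ (L t ω - L s ω) : ℝ) * Complex.I) ∂P =
      (∫ ω, G ω ∂P) * charFun (P.map (L 1)) (((t - s) ^ (1 / α)) • ξ) := by
  rw [← hL.charFun_increment hs hst]
  have hm : Measurable fun ω => L t ω - L s ω :=
    (hL.measurable_at (hs.trans hst)).sub (hL.measurable_at hs)
  refine IndepFun.integral_fun_mul_eq_mul_integral (X := G)
    (Y := fun ω => Complex.exp ((inner ℝ ξ (L t ω - L s ω) : ℝ) * Complex.I)) ?_
    (hG.mono (𝓕.le s) le_rfl).aestronglyMeasurable ?_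
  swap
  · exact Measurable.aestronglyMeasurable (by fun_prop)
  refine (indep_of_indep_of_le_left (indep_of_indep_of_le_right (hL.indep s t hs hst)
    hG.comap_le) ?_).symm
  have : Measurable fun x : EuclideanSpace ℝ (Fin d) =>
    Complex.exp ((inner ℝ ξ x : ℝ) * Complex.I) := by fun_prop
  exact (this.comp (comap_measurable fun ω => L t ω - L s ω)).comap_le

/-- Strict stability: split `L (s + t)` into `L s` and an independent increment. This functional
equation drives all later computations with scales. -/
lemma charFun_mul (hL : IsStableLevy P 𝓕 α L) {s t : ℝ} (hs : 0 ≤ s) (ht : 0 ≤ t)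
    (ξ : EuclideanSpace ℝ (Fin d)) :
    charFun (P.map (L 1)) ((s ^ (1 / α)) • ξ) * charFun (P.map (L 1)) ((t ^ (1 / α)) • ξ) =
      charFun (P.map (L 1)) (((s + t) ^ (1 / α)) • ξ) := by
  have hG : Measurable[𝓕 s] fun ω => Complex.exp ((inner ℝ ξ (L s ω) : ℝ) * Complex.I) := by
    have : Measurable fun x : EuclideanSpace ℝ (Fin d) =>
      Complex.exp ((inner ℝ ξ x : ℝ) * Complex.I) := by fun_prop
    exact this.comp (hL.adapted s hs)
  have h := hL.integral_mul_exp_increment hs (le_add_of_nonneg_right ht) ξ hG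
  rw [add_sub_cancel_left] at h
  rw [← hL.charFun_map hs, ← hL.charFun_map (add_nonneg hs ht), charFun_apply,
    charFun_apply (ξ), integral_map (hL.measurable_at hs).aemeasurable (by fun_prop),
    integral_map (hL.measurable_at (add_nonneg hs ht)).aemeasurable (by fun_prop)]
  simp_rw [real_inner_comm ξ]
  rw [← h]
  congr 1
  ext ω
  rw [← Complex.exp_add, ← add_mul, inner_sub_right]
  push_cast
  ring_nf

lemma charFun_pow (hL : IsStableLevy P 𝓕 α L) {s : ℝ} (hs : 0 ≤ s)
    (ξ : EuclideanSpace ℝ (Fin d)) (n : ℕ) :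
    charFun (P.map (L 1)) ((s ^ (1 / α)) • ξ) ^ n =
      charFun (P.map (L 1)) (((n * s) ^ (1 / α)) • ξ) := by
  have := hL.isProbabilityMeasure_map (t := 1) zero_le_one
  induction n with
  | zero =>
    have := hL.alpha_pos
    simp [Real.zero_rpow (show α⁻¹ ≠ 0 by positivity)]
  | succ n ih =>
    rw [pow_succ, ih, hL.charFun_mul (by positivity) hs]
    push_cast
    ring_nf

lemma continuous_charFun (hL : IsStableLevy P 𝓕 α L) : Continuous (charFun (P.map (L 1))) := by
  have := hL.isProbabilityMeasure_map (t := 1) zero_le_one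
  exact MeasureTheory.continuous_charFun

/-- A zero at `ξ` would, by taking roots, give zeros at points shrinking to the origin, where the
function tends to `1`. -/
lemma charFun_ne_zero (hL : IsStableLevy P 𝓕 α L) (ξ : EuclideanSpace ℝ (Fin d)) :
    charFun (P.map (L 1)) ξ ≠ 0 := by
  have := hL.isProbabilityMeasure_map (t := 1) zero_le_one
  have hα := hL.alpha_pos
  intro h0
  have h1 : ∀ n : ℕ, charFun (P.map (L 1)) (((1 / ((n : ℝ) + 1)) ^ (1 / α)) • ξ) = 0 := by
    intro n
    have h := hL.charFun_pow (s := 1 / ((n : ℝ) + 1)) (by positivity) ξ (n + 1)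
    rw [show ((n + 1 : ℕ) : ℝ) * (1 / ((n : ℝ) + 1)) = 1 by push_cast; field_simp,
      Real.one_rpow, one_smul, h0] at h
    exact pow_eq_zero_iff (by omega) |>.1 h
  have h2 : Tendsto (fun n : ℕ => charFun (P.map (L 1)) (((1 / ((n : ℝ) + 1)) ^ (1 / α)) • ξ))
      atTop (𝓝 (charFun (P.map (L 1)) (((0 : ℝ) ^ (1 / α)) • ξ))) := by
    refine (hL.continuous_charFun.tendsto _).comp (Tendsto.smul_const ?_ ξ)
    exact ((Real.continuous_rpow_const (by positivity)).tendsto 0).comp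
      tendsto_one_div_add_atTop_nhds_zero_nat
  simp_rw [h1] at h2
  rw [Real.zero_rpow (by positivity), zero_smul, charFun_zero, probReal_univ] at h2
  exact zero_ne_one (α := ℂ) (by exact_mod_cast tendsto_nhds_unique tendsto_const_nhds h2)

/-- A multiplicative Cauchy equation: rational `t` follow from integer powers and roots, all `t` by
continuity. Taking moduli avoids choosing a branch of the complex logarithm. -/
lemma norm_charFun_rpow (hL : IsStableLevy P 𝓕 α L) {t : ℝ} (ht : 0 ≤ t)
    (ξ : EuclideanSpace ℝ (Fin d)) :
    ‖charFun (P.map (L 1)) ((t ^ (1 / α)) • ξ)‖ = ‖charFun (P.map (L 1)) ξ‖ ^ t := by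
  have hα := hL.alpha_pos
  have hpos : 0 < ‖charFun (P.map (L 1)) ξ‖ := norm_pos_iff.2 (hL.charFun_ne_zero ξ)
  -- The absolute value makes both sides continuous on the whole line, where the rationals are
  -- dense.
  have key : (fun x : ℝ => ‖charFun (P.map (L 1)) ((|x| ^ (1 / α)) • ξ)‖) =
      fun x => ‖charFun (P.map (L 1)) ξ‖ ^ |x| := by
    refine Continuous.ext_on Rat.denseRange_cast ?_ ?_ ?_
    · have h1 : Continuous fun x : ℝ => |x| ^ (1 / α) :=
        continuous_abs.rpow_const fun _ => Or.inr (by positivity)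
      exact (hL.continuous_charFun.comp (h1.smul continuous_const)).norm
    · exact continuous_const.rpow continuous_abs fun _ => Or.inl hpos.ne'
    · rintro _ ⟨q, rfl⟩
      have hq : |(q : ℝ)| = (q.num.natAbs : ℝ) * (1 / (q.den : ℝ)) := by
        conv_lhs => rw [Rat.cast_def, abs_div]
        simp [Nat.cast_natAbs, div_eq_mul_inv]
      have hden : (0 : ℝ) < q.den := by exact_mod_cast q.den_pos
      have h1 : ‖charFun (P.map (L 1)) (((1 / (q.den : ℝ)) ^ (1 / α)) • ξ)‖ =
          ‖charFun (P.map (L 1)) ξ‖ ^ (1 / (q.den : ℝ)) := by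
        have h := congrArg norm (hL.charFun_pow (s := 1 / (q.den : ℝ)) (by positivity) ξ q.den)
        rw [mul_one_div_cancel hden.ne', Real.one_rpow, one_smul, norm_pow] at h
        rw [← h, one_div, Real.pow_rpow_inv_natCast (norm_nonneg _) q.den_nz]
      have h2 := congrArg norm
        (hL.charFun_pow (s := 1 / (q.den : ℝ)) (by positivity) ξ q.num.natAbs)
      rw [← hq, norm_pow, h1] at h2
      simp only
      rw [← h2, hq, mul_comm, Real.rpow_mul (norm_nonneg _), Real.rpow_natCast]
  have := congrFun key t
  simpa [abs_of_nonneg ht] using this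

lemma norm_charFun_smul (hL : IsStableLevy P 𝓕 α L) {s : ℝ} (hs : 0 ≤ s)
    (ξ : EuclideanSpace ℝ (Fin d)) :
    ‖charFun (P.map (L 1)) (s • ξ)‖ = ‖charFun (P.map (L 1)) ξ‖ ^ (s ^ α) := by
  have hα := hL.alpha_pos
  rw [← hL.norm_charFun_rpow (by positivity), ← Real.rpow_mul hs, mul_one_div_cancel hα.ne',
    Real.rpow_one]

/-- A characteristic function of a strictly stable law is trivial on every line on which its
modulus attains the value `1` away from the origin: the law is degenerate in this direction. -/
lemma charFun_eq_one_of_norm_eq_one (hL : IsStableLevy P 𝓕 α L)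
    {ξ : EuclideanSpace ℝ (Fin d)} (h : ‖charFun (P.map (L 1)) ξ‖ = 1) (θ : ℝ) :
    charFun (P.map (L 1)) (θ • ξ) = 1 := by
  have hpr := hL.isProbabilityMeasure_map (t := 1) zero_le_one
  have hα := hL.alpha_pos
  have h1 : ∀ θ : ℝ, ‖charFun (P.map (L 1)) (θ • ξ)‖ = 1 := by
    intro θ
    rcases le_total 0 θ with hθ | hθ
    · rw [hL.norm_charFun_smul hθ, h, Real.one_rpow]
    · rw [← neg_neg (θ • ξ), charFun_neg, ← neg_smul, RCLike.norm_conj,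
        hL.norm_charFun_smul (neg_nonneg.2 hθ), h, Real.one_rpow]
  -- Equality in `|E W| ≤ E |W|` for a variable of modulus one forces `W` to be constant, equal to
  -- its mean. Hence `θ ↦ φ(θ ξ)` is multiplicative (`h3`).
  have h2 : ∀ θ : ℝ, (fun x => Complex.exp ((inner ℝ x (θ • ξ) : ℝ) * Complex.I))
      =ᵐ[P.map (L 1)] fun _ => charFun (P.map (L 1)) (θ • ξ) := by
    intro θ
    rcases ae_eq_const_or_norm_integral_lt_of_norm_le_const (μ := P.map (L 1)) (C := 1)
      (f := fun x => Complex.exp ((inner ℝ x (θ • ξ) : ℝ) * Complex.I))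
      (ae_of_all _ fun x => by rw [Complex.norm_exp_ofReal_mul_I]) with h' | h'
    · simpa [average_eq, charFun_apply, Function.const_def] using h'
    · rw [← charFun_apply, h1] at h'
      simp at h'
  have h3 : ∀ x y : ℝ, charFun (P.map (L 1)) ((x + y) • ξ) =
      charFun (P.map (L 1)) (x • ξ) * charFun (P.map (L 1)) (y • ξ) := by
    intro x y
    have : (fun z => Complex.exp ((inner ℝ z ((x + y) • ξ) : ℝ) * Complex.I))
      =ᵐ[P.map (L 1)] fun _ => charFun (P.map (L 1)) (x • ξ) * charFun (P.map (L 1)) (y • ξ) := by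
      filter_upwards [h2 x, h2 y] with z hx hy
      rw [← hx, ← hy, ← Complex.exp_add, add_smul, inner_add_right]
      push_cast
      ring_nf
    conv_lhs => rw [charFun_apply]
    rw [integral_congr_ae this]
    simp
  have hne : (2 : ℝ) - 2 ^ (1 / α) ≠ 0 := by
    have : (2 : ℝ) ^ (1 / α) < 2 ^ (1 : ℝ) :=
      Real.rpow_lt_rpow_of_exponent_lt (by norm_num) ((div_lt_one hα).2 hL.one_lt)
    rw [Real.rpow_one] at this
    linarith
  -- Chosen so that `2 y - 2^(1/α) y = θ`. Stability gives `φ(2 y ξ) = φ(2^(1/α) y ξ)`, and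
  -- multiplicativity then leaves `φ(θ ξ) = 1`. This needs `2^(1/α) ≠ 2`, which holds as `α > 1`.
  set y : ℝ := θ / (2 - 2 ^ (1 / α)) with hy
  have h4 : charFun (P.map (L 1)) ((2 * y) • ξ) =
      charFun (P.map (L 1)) ((2 ^ (1 / α) * y) • ξ) := by
    have := hL.charFun_mul zero_le_one zero_le_one (y • ξ)
    rw [Real.one_rpow, one_smul, one_add_one_eq_two, ← h3, ← two_mul, smul_smul] at this
    exact this
  have h5 := h3 (2 ^ (1 / α) * y) θ
  rw [show 2 ^ (1 / α) * y + θ = 2 * y by rw [hy]; field_simp; ring, h4] at h5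
  exact (mul_eq_left₀ (hL.charFun_ne_zero _)).1 h5.symm

/-- If the powers `z, …, z ^ n` stay within distance `1 / 2` of `1`, then `z` is within distance
`1 / n` of `1`. -/
lemma norm_one_sub_le_of_pow {z : ℂ} {n : ℕ} (hn : 0 < n)
    (h : ∀ j ≤ n, ‖1 - z ^ j‖ ≤ 1 / 2) : ‖1 - z‖ ≤ 1 / n := by
  have h1 : (n : ℝ) / 2 ≤ ‖∑ j ∈ Finset.range n, z ^ j‖ := by
    calc (n : ℝ) / 2 = ∑ j ∈ Finset.range n, (1 / 2 : ℝ) := by simp; ring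
      _ ≤ ∑ j ∈ Finset.range n, (z ^ j).re := by
        refine Finset.sum_le_sum fun j hj => ?_
        have h2 := (Complex.re_le_norm (1 - z ^ j)).trans (h j (Finset.mem_range.1 hj).le)
        simp only [Complex.sub_re, Complex.one_re] at h2
        linarith
      _ = (∑ j ∈ Finset.range n, z ^ j).re := by simp
      _ ≤ _ := Complex.re_le_norm _
  have h2 : ‖1 - z‖ * ‖∑ j ∈ Finset.range n, z ^ j‖ ≤ 1 / 2 := by
    rw [← norm_mul, mul_neg_geom_sum]
    exact h n le_rfl
  have hn' : (0 : ℝ) < n := by exact_mod_cast hn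
  rw [le_div_iff₀ hn']
  nlinarith [norm_nonneg (1 - z)]

/-- For small `ξ` about `‖ξ‖ ^ (-α)` consecutive powers of `φ(ξ)` are values of `φ` near the origin,
hence close to `1`; so `φ(ξ)` itself lies within order `‖ξ‖ ^ α` of `1`. The bound turns the energy
of a step sum into a tail estimate. -/
lemma exists_norm_one_sub_charFun_le (hL : IsStableLevy P 𝓕 α L) :
    ∃ C : ℝ, 0 ≤ C ∧ ∀ ξ, ‖1 - charFun (P.map (L 1)) ξ‖ ≤ C * ‖ξ‖ ^ α := by
  have := hL.isProbabilityMeasure_map (t := 1) zero_le_one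
  have hα := hL.alpha_pos
  obtain ⟨η, hη, hball⟩ : ∃ η > 0, ∀ ξ, ‖ξ‖ ≤ η → ‖1 - charFun (P.map (L 1)) ξ‖ ≤ 1 / 2 := by
    have h := (hL.continuous_charFun.tendsto 0)
    rw [charFun_zero, probReal_univ, Metric.tendsto_nhds_nhds] at h
    obtain ⟨δ, hδ, h⟩ := h (1 / 2) (by norm_num)
    refine ⟨δ / 2, by positivity, fun ξ hξ => ?_⟩
    have := h (x := ξ) (by rw [dist_zero_right]; linarith)
    rw [dist_comm, dist_eq_norm] at this
    simpa using this.le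
  refine ⟨2 / η ^ α, by positivity, fun ξ => ?_⟩
  rcases le_or_gt η ‖ξ‖ with h | h
  · refine norm_one_sub_charFun_le_two.trans ?_
    rw [div_mul_eq_mul_div, le_div_iff₀ (by positivity)]
    gcongr
  · rcases eq_or_ne ξ 0 with rfl | hξ
    · simp only [charFun_zero, probReal_univ, norm_zero]
      simp [Real.zero_rpow hα.ne']
    have hξ' : 0 < ‖ξ‖ := norm_pos_iff.2 hξ
    -- With `ζ` the multiple of `ξ` of length `η` one has `ξ = s^(1/α) ζ`, so the `j`-th power of
    -- `φ(ξ)` is `φ((j s)^(1/α) ζ)`, which is within `1/2` of `1` as long as `j ≤ 1/s`.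
    set s : ℝ := (‖ξ‖ / η) ^ α with hs
    have hs0 : 0 < s := by positivity
    have hs1 : s < 1 := Real.rpow_lt_one (by positivity) ((div_lt_one hη).2 h) hα
    set ζ : EuclideanSpace ℝ (Fin d) := (η / ‖ξ‖) • ξ with hζ
    have hζn : ‖ζ‖ = η := by
      rw [hζ, norm_smul, Real.norm_of_nonneg (by positivity)]
      field_simp
    have hξs : ξ = (s ^ (1 / α)) • ζ := by
      rw [hs, ← Real.rpow_mul (by positivity), mul_one_div_cancel hα.ne', Real.rpow_one, hζ,
        smul_smul]
      field_simp
      simp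
    have hn : 0 < ⌊1 / s⌋₊ := Nat.floor_pos.2 ((one_le_div hs0).2 hs1.le)
    have hfl : (⌊1 / s⌋₊ : ℝ) ≤ 1 / s := Nat.floor_le (by positivity)
    have hfl2 : 1 / s < ⌊1 / s⌋₊ + 1 := Nat.lt_floor_add_one _
    have h1 : ‖1 - charFun (P.map (L 1)) ξ‖ ≤ 1 / (⌊1 / s⌋₊ : ℝ) := by
      refine norm_one_sub_le_of_pow hn fun j hj => ?_
      rw [hξs, hL.charFun_pow hs0.le]
      refine hball _ ?_
      rw [norm_smul, hζn, Real.norm_of_nonneg (by positivity)]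
      refine mul_le_of_le_one_left hη.le (Real.rpow_le_one (by positivity) ?_ (by positivity))
      calc (j : ℝ) * s ≤ 1 / s * s := by
            gcongr
            exact le_trans (by exact_mod_cast hj) hfl
        _ = 1 := by field_simp
    refine h1.trans ?_
    have hn1 : (1 : ℝ) ≤ (⌊1 / s⌋₊ : ℝ) := by exact_mod_cast hn
    have : 2 / η ^ α * ‖ξ‖ ^ α = 2 * s := by
      rw [hs, Real.div_rpow hξ'.le hη.le]; ring
    rw [this, div_le_iff₀ (by linarith)]
    rw [div_lt_iff₀ hs0] at hfl2
    nlinarith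

end IsStableLevy

end

section

/-! ### Integrals of deterministic step functions and their limits in probability -/

/-- `Y = ∑ᵢ ⟨eᵢ, L_{sᵢ₊₁} - L_{sᵢ}⟩` for some grid `a = s₀ ≤ s₁ ≤ ⋯ ≤ sₘ = b` and vectors
`eᵢ ∈ Q`, with `κ = ∑ᵢ ‖eᵢ‖ ^ α (sᵢ₊₁ - sᵢ)`. -/
inductive IsStepSum {Ω : Type*} {d : ℕ} (L : ℝ → Ω → EuclideanSpace ℝ (Fin d)) (α : ℝ)
    (Q : Set (EuclideanSpace ℝ (Fin d))) (a : ℝ) : ℝ → ℝ≥0∞ → (Ω → ℝ) → Prop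
  | nil : IsStepSum L α Q a a 0 (fun _ => 0)
  | snoc {s t : ℝ} {κ : ℝ≥0∞} {Y : Ω → ℝ} {e : EuclideanSpace ℝ (Fin d)} :
      IsStepSum L α Q a s κ Y → s ≤ t → e ∈ Q →
      IsStepSum L α Q a t (κ + ENNReal.ofReal (‖e‖ ^ α * (t - s)))
        (fun ω => Y ω + inner ℝ e (L t ω - L s ω))

/-- `X` is a limit in probability of step sums over `[a, b]` with coefficients in `Q` and energy
at most `κ`. -/
def StepLim {Ω : Type*} [MeasurableSpace Ω] {d : ℕ} (P : Measure Ω)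
    (L : ℝ → Ω → EuclideanSpace ℝ (Fin d)) (α : ℝ)
    (Q : Set (EuclideanSpace ℝ (Fin d))) (a b : ℝ) (κ : ℝ≥0∞) (X : Ω → ℝ) : Prop :=
  AEMeasurable X P ∧ ∀ ε : ℝ, 0 < ε → ∃ (κ' : ℝ≥0∞) (Y : Ω → ℝ), κ' ≤ κ ∧
    IsStepSum L α Q a b κ' Y ∧ P {ω | ε ≤ |X ω - Y ω|} ≤ ENNReal.ofReal ε

variable {Ω : Type*} {mΩ : MeasurableSpace Ω} {P : Measure Ω} [IsProbabilityMeasure P] {d : ℕ}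
  {𝓕 : Filtration ℝ mΩ} {α : ℝ} {L : ℝ → Ω → EuclideanSpace ℝ (Fin d)}
  {Q : Set (EuclideanSpace ℝ (Fin d))} {a b c : ℝ} {κ κ' : ℝ≥0∞} {X Y Y' : Ω → ℝ}

namespace IsStepSum

lemma le (h : IsStepSum L α Q a b κ Y) : a ≤ b := by
  induction h with
  | nil => exact le_rfl
  | snoc _ hst _ ih => exact ih.trans hst

lemma measurable (hL : IsStableLevy P 𝓕 α L) (ha : 0 ≤ a) (h : IsStepSum L α Q a b κ Y) :
    Measurable[𝓕 b] Y := by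
  induction h with
  | nil => exact @measurable_const _ _ _ (_) _
  | @snoc s t κ Y e hY hst he ih =>
    have hs : 0 ≤ s := ha.trans hY.le
    have h1 : Measurable[𝓕 t] (L s) := (hL.adapted s hs).mono (𝓕.mono hst) le_rfl
    have h2 : Measurable[𝓕 t] (L t) := hL.adapted t (hs.trans hst)
    have h3 : Measurable[𝓕 t] Y := ih.mono (𝓕.mono hst) le_rfl
    have h4 : Measurable fun x : EuclideanSpace ℝ (Fin d) => (inner ℝ e x : ℝ) := by fun_prop
    exact h3.add (h4.comp (h2.sub h1))

lemma measurable' (hL : IsStableLevy P 𝓕 α L) (ha : 0 ≤ a) (h : IsStepSum L α Q a b κ Y) :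
    Measurable Y := (h.measurable hL ha).mono (𝓕.le b) le_rfl

lemma trans (h : IsStepSum L α Q a b κ Y) (h' : IsStepSum L α Q b c κ' Y') :
    IsStepSum L α Q a c (κ + κ') (fun ω => Y ω + Y' ω) := by
  induction h' with
  | nil => simpa using h
  | snoc _ hst he ih => simpa only [add_assoc] using ih.snoc hst he

/-- Degenerate cells contribute neither to the sum nor to the energy and are skipped, so their
coefficients need not lie in `Q`. -/
lemma of_monotone {τ : ℕ → ℝ} (hτ : Monotone τ)
    (e : ℕ → EuclideanSpace ℝ (Fin d)) (n : ℕ)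
    (he : ∀ k < n, τ k < τ (k + 1) → e k ∈ Q) :
    IsStepSum L α Q (τ 0) (τ n)
      (∑ k ∈ Finset.range n, ENNReal.ofReal (‖e k‖ ^ α * (τ (k + 1) - τ k)))
      (fun ω => ∑ k ∈ Finset.range n, inner ℝ (e k) (L (τ (k + 1)) ω - L (τ k) ω)) := by
  induction n with
  | zero => simpa using IsStepSum.nil
  | succ n ih =>
    have ih := ih fun k hk => he k (by omega)
    simp_rw [Finset.sum_range_succ]
    rcases (hτ n.le_succ).eq_or_lt with h | h
    · simp only [Nat.succ_eq_add_one] at h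
      rw [← h]
      simpa using ih
    · exact ih.snoc h.le (he n (by omega) h)

lemma mono_set {Q' : Set (EuclideanSpace ℝ (Fin d))} (h : IsStepSum L α Q a b κ Y)
    (hQ : Q ⊆ Q') : IsStepSum L α Q' a b κ Y := by
  induction h with
  | nil => exact .nil
  | snoc _ hst he ih => exact ih.snoc hst (hQ he)

lemma integral_mul_exp_snoc (hL : IsStableLevy P 𝓕 α L) (ha : 0 ≤ a) {s t : ℝ}
    (h : IsStepSum L α Q a s κ Y) (hst : s ≤ t) (e : EuclideanSpace ℝ (Fin d)) {G : Ω → ℂ}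
    (hG : Measurable[𝓕 a] G) (θ : ℝ) :
    ∫ ω, G ω * Complex.exp ((θ * (Y ω + inner ℝ e (L t ω - L s ω)) : ℝ) * Complex.I) ∂P =
      (∫ ω, G ω * Complex.exp ((θ * Y ω : ℝ) * Complex.I) ∂P) *
        charFun (P.map (L 1)) ((θ * (t - s) ^ (1 / α)) • e) := by
  have hG' : Measurable[𝓕 s] fun ω => G ω * Complex.exp ((θ * Y ω : ℝ) * Complex.I) := by
    have h1 : Measurable fun x : ℝ => Complex.exp ((θ * x : ℝ) * Complex.I) := by fun_prop
    exact (hG.mono (𝓕.mono h.le) le_rfl).mul (h1.comp (h.measurable hL ha))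
  have := hL.integral_mul_exp_increment (ha.trans h.le) hst (θ • e) hG'
  rw [smul_smul, mul_comm _ θ] at this
  rw [← this]
  congr 1
  ext ω
  rw [mul_assoc, ← Complex.exp_add, real_inner_smul_left]
  push_cast
  ring_nf

lemma integral_mul_exp (hL : IsStableLevy P 𝓕 α L) (ha : 0 ≤ a)
    (h : IsStepSum L α Q a b κ Y) {G : Ω → ℂ} (hG : Measurable[𝓕 a] G) (θ : ℝ) :
    ∫ ω, G ω * Complex.exp ((θ * Y ω : ℝ) * Complex.I) ∂P =
      (∫ ω, G ω ∂P) * ∫ ω, Complex.exp ((θ * Y ω : ℝ) * Complex.I) ∂P := by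
  induction h with
  | nil => simp
  | @snoc s t κ Y e hY hst he ih =>
    have h1 := hY.integral_mul_exp_snoc hL ha hst e (G := fun _ => 1)
      (@measurable_const _ _ _ (_) _) θ
    simp only [one_mul] at h1
    rw [hY.integral_mul_exp_snoc hL ha hst e hG, ih, h1, mul_assoc]

lemma integral_exp_snoc (hL : IsStableLevy P 𝓕 α L) (ha : 0 ≤ a) {s t : ℝ}
    (h : IsStepSum L α Q a s κ Y) (hst : s ≤ t) (e : EuclideanSpace ℝ (Fin d)) (θ : ℝ) :
    ∫ ω, Complex.exp ((θ * (Y ω + inner ℝ e (L t ω - L s ω)) : ℝ) * Complex.I) ∂P =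
      (∫ ω, Complex.exp ((θ * Y ω : ℝ) * Complex.I) ∂P) *
        charFun (P.map (L 1)) ((θ * (t - s) ^ (1 / α)) • e) := by
  have h1 := h.integral_mul_exp_snoc hL ha hst e (G := fun _ => 1)
    (@measurable_const _ _ _ (_) _) θ
  simpa only [one_mul] using h1

end IsStepSum

lemma norm_integral_exp_le_one (X : Ω → ℝ) (θ : ℝ) :
    ‖∫ ω, Complex.exp ((θ * X ω : ℝ) * Complex.I) ∂P‖ ≤ 1 := by
  refine (norm_integral_le_integral_norm _).trans ?_
  simp_rw [Complex.norm_exp_ofReal_mul_I]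
  simp

namespace IsStepSum

/-- Over independent increments the distances to `1` add up, because `|1 - z w| ≤ |1 - z| + |z| |1 -
w|` and `|z| ≤ 1`; the homogeneous bound `C ‖ξ‖ ^ α` turns their total into the energy. -/
lemma norm_one_sub_le (hL : IsStableLevy P 𝓕 α L) (ha : 0 ≤ a) {C : ℝ}
    (hC : ∀ ξ, ‖1 - charFun (P.map (L 1)) ξ‖ ≤ C * ‖ξ‖ ^ α)
    (h : IsStepSum L α Q a b κ Y) (θ : ℝ) :
    κ ≠ ⊤ ∧ ‖1 - ∫ ω, Complex.exp ((θ * Y ω : ℝ) * Complex.I) ∂P‖ ≤ C * |θ| ^ α * κ.toReal := by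
  have hα := hL.alpha_pos
  induction h with
  | nil => simp
  | @snoc s t κ Y e hY hst he ih =>
    refine ⟨by simp [ih.1], ?_⟩
    rw [hY.integral_exp_snoc hL ha hst e θ, ENNReal.toReal_add ih.1 (by simp),
      ENNReal.toReal_ofReal (mul_nonneg (by positivity) (sub_nonneg.2 hst)), mul_add]
    set z := ∫ ω, Complex.exp ((θ * Y ω : ℝ) * Complex.I) ∂P with hz
    set w := charFun (P.map (L 1)) ((θ * (t - s) ^ (1 / α)) • e) with hw
    have h1 : ‖z‖ ≤ 1 := norm_integral_exp_le_one Y θ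
    have h2 : ‖1 - w‖ ≤ C * |θ| ^ α * (‖e‖ ^ α * (t - s)) := by
      refine (hC _).trans_eq ?_
      have hts : 0 ≤ t - s := sub_nonneg.2 hst
      rw [norm_smul, Real.norm_eq_abs, abs_mul, abs_of_nonneg (a := (t - s) ^ (1 / α))
        (by positivity), Real.mul_rpow (by positivity) (by positivity),
        Real.mul_rpow (by positivity) (by positivity), ← Real.rpow_mul hts,
        one_div_mul_cancel hα.ne', Real.rpow_one]
      ring
    calc ‖1 - z * w‖ = ‖(1 - z) + z * (1 - w)‖ := by ring_nf
      _ ≤ ‖1 - z‖ + ‖z‖ * ‖1 - w‖ := (norm_add_le _ _).trans (by rw [norm_mul])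
      _ ≤ _ := add_le_add ih.2 ((mul_le_of_le_one_left (norm_nonneg _) h1).trans h2)

/-- Scales of independent summands combine through their `α`-th powers, an increment over `[s, t]`
being weighted by `t - s`. -/
lemma exists_scale (hL : IsStableLevy P 𝓕 α L) (ha : 0 ≤ a) {a₀ : EuclideanSpace ℝ (Fin d)}
    (hQ : ∀ e ∈ Q, ∃ s : ℝ, 0 ≤ s ∧ ∀ θ : ℝ,
      charFun (P.map (L 1)) (θ • e) = charFun (P.map (L 1)) ((θ * s) • a₀))
    (h : IsStepSum L α Q a b κ Y) :
    ∃ s : ℝ, 0 ≤ s ∧ ∀ θ : ℝ, ∫ ω, Complex.exp ((θ * Y ω : ℝ) * Complex.I) ∂P =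
      charFun (P.map (L 1)) ((θ * s) • a₀) := by
  have hα := hL.alpha_pos
  have := hL.isProbabilityMeasure_map (t := 1) zero_le_one
  induction h with
  | nil => exact ⟨0, le_rfl, by simp⟩
  | @snoc s t κ Y e hY hst he ih =>
    obtain ⟨s₁, hs₁, h₁⟩ := ih
    obtain ⟨s₂, hs₂, h₂⟩ := hQ e he
    have hts : 0 ≤ t - s := sub_nonneg.2 hst
    refine ⟨(s₁ ^ α + (t - s) * s₂ ^ α) ^ (1 / α), by positivity, fun θ => ?_⟩
    rw [hY.integral_exp_snoc hL ha hst e θ, h₁, h₂]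
    have := hL.charFun_mul (s := s₁ ^ α) (t := (t - s) * s₂ ^ α) (by positivity)
      (by positivity) (θ • a₀)
    rw [← Real.rpow_mul hs₁, mul_one_div_cancel hα.ne', Real.rpow_one, smul_smul,
      Real.mul_rpow hts (by positivity), ← Real.rpow_mul hs₂, mul_one_div_cancel hα.ne',
      Real.rpow_one, smul_smul, smul_smul] at this
    rw [show θ * s₁ = s₁ * θ by ring,
      show θ * (t - s) ^ (1 / α) * s₂ = (t - s) ^ (1 / α) * s₂ * θ by ring, this, mul_comm θ]

/-- The moduli `‖φ(e)‖ ^ (t - s)` of the increments multiply. This bound later shows that the noise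
is not degenerate. -/
lemma norm_integral_exp_le (hL : IsStableLevy P 𝓕 α L) (ha : 0 ≤ a) {q : ℝ} (hq : 0 < q)
    (hQ : ∀ e ∈ Q, ‖charFun (P.map (L 1)) e‖ ≤ q) (h : IsStepSum L α Q a b κ Y) :
    ‖∫ ω, Complex.exp (((1 : ℝ) * Y ω : ℝ) * Complex.I) ∂P‖ ≤ q ^ (b - a) := by
  induction h with
  | nil => simp
  | @snoc s t κ Y e hY hst he ih =>
    have hts : 0 ≤ t - s := sub_nonneg.2 hst
    rw [hY.integral_exp_snoc hL ha hst e 1, norm_mul, one_mul, hL.norm_charFun_rpow hts,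
      show t - a = (s - a) + (t - s) by ring, Real.rpow_add hq]
    exact mul_le_mul ih (Real.rpow_le_rpow (norm_nonneg _) (hQ e he) hts) (by positivity)
      (by positivity)

end IsStepSum

namespace StepLim

lemma of_isStepSum (hL : IsStableLevy P 𝓕 α L) (ha : 0 ≤ a) (h : IsStepSum L α Q a b κ Y) :
    StepLim P L α Q a b κ Y := by
  refine ⟨(h.measurable' hL ha).aemeasurable, fun ε hε => ⟨κ, Y, le_rfl, h, ?_⟩⟩
  simp [not_le.2 hε]

lemma mono (h : StepLim P L α Q a b κ X) (hκ : κ ≤ κ') {Q' : Set (EuclideanSpace ℝ (Fin d))}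
    (hQ : Q ⊆ Q') : StepLim P L α Q' a b κ' X := by
  refine ⟨h.1, fun ε hε => ?_⟩
  obtain ⟨κ₁, Y, h1, h2, h3⟩ := h.2 ε hε
  exact ⟨κ₁, Y, h1.trans hκ, h2.mono_set hQ, h3⟩

lemma congr (h : StepLim P L α Q a b κ X) {X' : Ω → ℝ} (hX : X =ᵐ[P] X') :
    StepLim P L α Q a b κ X' := by
  refine ⟨h.1.congr hX, fun ε hε => ?_⟩
  obtain ⟨κ₁, Y, h1, h2, h3⟩ := h.2 ε hε
  refine ⟨κ₁, Y, h1, h2, le_of_eq_of_le (measure_congr ?_) h3⟩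
  filter_upwards [hX] with ω hω
  change (ε ≤ |X' ω - Y ω|) = (ε ≤ |X ω - Y ω|)
  rw [hω]

lemma trans {X' : Ω → ℝ} (h : StepLim P L α Q a b κ X) (h' : StepLim P L α Q b c κ' X') :
    StepLim P L α Q a c (κ + κ') (fun ω => X ω + X' ω) := by
  refine ⟨h.1.add h'.1, fun ε hε => ?_⟩
  obtain ⟨κ₁, Y, h1, h2, h3⟩ := h.2 (ε / 2) (by positivity)
  obtain ⟨κ₂, Y', h1', h2', h3'⟩ := h'.2 (ε / 2) (by positivity)
  refine ⟨κ₁ + κ₂, _, add_le_add h1 h1', h2.trans h2', ?_⟩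
  calc P {ω | ε ≤ |X ω + X' ω - (Y ω + Y' ω)|}
      ≤ P ({ω | ε / 2 ≤ |X ω - Y ω|} ∪ {ω | ε / 2 ≤ |X' ω - Y' ω|}) := by
        refine measure_mono fun ω hω => ?_
        simp only [mem_ofPred_eq, mem_union] at hω ⊢
        by_contra! hcon
        have := abs_add_le (X ω - Y ω) (X' ω - Y' ω)
        rw [show X ω - Y ω + (X' ω - Y' ω) = X ω + X' ω - (Y ω + Y' ω) by ring] at this
        linarith
    _ ≤ ENNReal.ofReal (ε / 2) + ENNReal.ofReal (ε / 2) :=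
        (measure_union_le _ _).trans (add_le_add h3 h3')
    _ = ENNReal.ofReal ε := by
        rw [← ENNReal.ofReal_add (by positivity) (by positivity), add_halves]

/-- Step limits are closed under convergence in probability, so integrals of integrals remain in the
class. -/
lemma of_tendstoInMeasure {X' : ℕ → Ω → ℝ} (h : ∀ᶠ n in atTop, StepLim P L α Q a b κ (X' n))
    (hX : AEMeasurable X P) (hlim : TendstoInMeasure P X' atTop X) :
    StepLim P L α Q a b κ X := by
  refine ⟨hX, fun ε hε => ?_⟩
  rw [tendstoInMeasure_iff_norm] at hlim
  have h1 := hlim (ε / 2) (by positivity)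
  rw [ENNReal.tendsto_nhds_zero] at h1
  obtain ⟨n, hn1, hn2⟩ := ((h1 (ENNReal.ofReal (ε / 2)) (by simp [hε])).and h).exists
  obtain ⟨κ₁, Y, h1, h2, h3⟩ := hn2.2 (ε / 2) (by positivity)
  refine ⟨κ₁, Y, h1, h2, ?_⟩
  calc P {ω | ε ≤ |X ω - Y ω|}
      ≤ P ({ω | ε / 2 ≤ ‖X' n ω - X ω‖} ∪ {ω | ε / 2 ≤ |X' n ω - Y ω|}) := by
        refine measure_mono fun ω hω => ?_
        simp only [mem_ofPred_eq, mem_union, Real.norm_eq_abs] at hω ⊢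
        by_contra! hcon
        have := abs_sub_le (X ω) (X' n ω) (Y ω)
        rw [abs_sub_comm (X ω) (X' n ω)] at this
        linarith
    _ ≤ ENNReal.ofReal (ε / 2) + ENNReal.ofReal (ε / 2) :=
        (measure_union_le _ _).trans (add_le_add hn1 h3)
    _ = ENNReal.ofReal ε := by
        rw [← ENNReal.ofReal_add (by positivity) (by positivity), add_halves]

lemma exists_seq (h : StepLim P L α Q a b κ X) :
    ∃ (κ' : ℕ → ℝ≥0∞) (Y : ℕ → Ω → ℝ),
      (∀ n, κ' n ≤ κ ∧ IsStepSum L α Q a b (κ' n) (Y n)) ∧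
      ∀ᵐ ω ∂P, Tendsto (fun n => Y n ω) atTop (𝓝 (X ω)) := by
  have hpos : ∀ n : ℕ, 0 < 1 / ((n : ℝ) + 1) := fun n => by positivity
  choose κ' Y h1 h2 h3 using fun n : ℕ => h.2 (1 / ((n : ℝ) + 1)) (hpos n)
  have hlim : TendstoInMeasure P Y atTop X := by
    rw [tendstoInMeasure_iff_norm]
    intro ε hε
    have h0 : Tendsto (fun n : ℕ => ENNReal.ofReal (1 / ((n : ℝ) + 1))) atTop (𝓝 0) := by
      have := ENNReal.tendsto_ofReal (tendsto_one_div_add_atTop_nhds_zero_nat (𝕜 := ℝ))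
      simpa using this
    refine tendsto_of_tendsto_of_tendsto_of_le_of_le' tendsto_const_nhds h0
      (Eventually.of_forall fun _ => zero_le) ?_
    have hev : ∀ᶠ n : ℕ in atTop, 1 / ((n : ℝ) + 1) < ε :=
      tendsto_one_div_add_atTop_nhds_zero_nat.eventually (gt_mem_nhds hε)
    filter_upwards [hev] with n hn
    refine (measure_mono fun ω hω => ?_).trans (h3 n)
    simp only [mem_ofPred_eq, Real.norm_eq_abs] at hω ⊢
    rw [abs_sub_comm]
    linarith
  obtain ⟨ns, -, hns⟩ := hlim.exists_seq_tendsto_ae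
  exact ⟨fun n => κ' (ns n), fun n => Y (ns n), fun n => ⟨h1 _, h2 _⟩, hns⟩

end StepLim

lemma tendsto_integral_mul_exp {Y : ℕ → Ω → ℝ} {G : Ω → ℂ} (hG : AEStronglyMeasurable G P)
    {K : ℝ} (hK : ∀ ω, ‖G ω‖ ≤ K) (hY : ∀ n, AEMeasurable (Y n) P)
    (hlim : ∀ᵐ ω ∂P, Tendsto (fun n => Y n ω) atTop (𝓝 (X ω))) (θ : ℝ) :
    Tendsto (fun n => ∫ ω, G ω * Complex.exp ((θ * Y n ω : ℝ) * Complex.I) ∂P) atTop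
      (𝓝 (∫ ω, G ω * Complex.exp ((θ * X ω : ℝ) * Complex.I) ∂P)) := by
  refine tendsto_integral_of_dominated_convergence (fun _ => K) (fun n => ?_)
    (integrable_const K) (fun n => ae_of_all _ fun ω => ?_) ?_
  · have h1 : Measurable fun x : ℝ => Complex.exp ((θ * x : ℝ) * Complex.I) := by fun_prop
    exact hG.mul (h1.comp_aemeasurable (hY n)).aestronglyMeasurable
  · rw [norm_mul, Complex.norm_exp_ofReal_mul_I, mul_one]
    exact hK ω
  · filter_upwards [hlim] with ω hω
    have h1 : Continuous fun x : ℝ => Complex.exp ((θ * x : ℝ) * Complex.I) := by fun_prop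
    exact ((h1.tendsto _).comp hω).const_mul _

lemma tendsto_integral_exp {Y : ℕ → Ω → ℝ} (hY : ∀ n, AEMeasurable (Y n) P)
    (hlim : ∀ᵐ ω ∂P, Tendsto (fun n => Y n ω) atTop (𝓝 (X ω))) (θ : ℝ) :
    Tendsto (fun n => ∫ ω, Complex.exp ((θ * Y n ω : ℝ) * Complex.I) ∂P) atTop
      (𝓝 (∫ ω, Complex.exp ((θ * X ω : ℝ) * Complex.I) ∂P)) := by
  have := tendsto_integral_mul_exp (P := P) (G := fun _ => 1) (K := 1) (by fun_prop) (by simp)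
    hY hlim θ
  simpa only [one_mul] using this

/-- The truncation inequality: the tail beyond `r` is controlled by the mean of `1 - φ` over `[-2/r,
2/r]`. -/
lemma measureReal_lt_abs_le (hX : AEMeasurable X P) {C : ℝ} (hα : 0 < α)
    (h : ∀ θ : ℝ, ‖1 - ∫ ω, Complex.exp ((θ * X ω : ℝ) * Complex.I) ∂P‖ ≤ C * |θ| ^ α)
    {r : ℝ} (hr : 0 < r) : P.real {ω | r < |X ω|} ≤ 2 * (2 / r) ^ α * C := by
  have hC : 0 ≤ C := by simpa using (norm_nonneg _).trans (h 1)
  have := Measure.isProbabilityMeasure_map hX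
  have h1 := measureReal_abs_gt_le_integral_charFun (μ := P.map X) hr
  rw [map_measureReal_apply_of_aemeasurable hX (by measurability)] at h1
  refine h1.trans ?_
  have h2 : ‖∫ t in (-2 * r⁻¹)..(2 * r⁻¹), 1 - charFun (P.map X) t‖ ≤
      (C * (2 / r) ^ α) * |2 * r⁻¹ - -2 * r⁻¹| := by
    refine intervalIntegral.norm_integral_le_of_norm_le_const fun t ht => ?_
    have h3 : charFun (P.map X) t = ∫ ω, Complex.exp ((t * X ω : ℝ) * Complex.I) ∂P := by
      rw [charFun_apply_real, integral_map hX (by fun_prop)]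
      push_cast
      rfl
    rw [h3]
    refine (h t).trans ?_
    have h4 : |t| ≤ 2 / r := by
      rw [uIoc_of_le (by have := inv_pos.2 hr; nlinarith)] at ht
      rw [abs_le]
      constructor
      · have := ht.1.le; rw [div_eq_mul_inv]; linarith
      · have := ht.2; rwa [div_eq_mul_inv]
    gcongr
  calc 2⁻¹ * r * ‖∫ t in (-2 * r⁻¹)..(2 * r⁻¹), 1 - charFun (P.map X) t‖
      ≤ 2⁻¹ * r * ((C * (2 / r) ^ α) * |2 * r⁻¹ - -2 * r⁻¹|) := by gcongr
    _ = 2 * (2 / r) ^ α * C := by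
      rw [show 2 * r⁻¹ - -2 * r⁻¹ = 4 * r⁻¹ by ring, abs_of_nonneg (by positivity)]
      field_simp
      ring

namespace StepLim

lemma integral_mul_exp (hL : IsStableLevy P 𝓕 α L) (ha : 0 ≤ a) (h : StepLim P L α Q a b κ X)
    {G : Ω → ℂ} (hG : Measurable[𝓕 a] G) {K : ℝ} (hK : ∀ ω, ‖G ω‖ ≤ K) (θ : ℝ) :
    ∫ ω, G ω * Complex.exp ((θ * X ω : ℝ) * Complex.I) ∂P =
      (∫ ω, G ω ∂P) * ∫ ω, Complex.exp ((θ * X ω : ℝ) * Complex.I) ∂P := by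
  obtain ⟨κ', Y, hY, hlim⟩ := h.exists_seq
  have hYm : ∀ n, AEMeasurable (Y n) P := fun n => ((hY n).2.measurable' hL ha).aemeasurable
  have h1 := tendsto_integral_mul_exp (hG.mono (𝓕.le a) le_rfl).aestronglyMeasurable hK hYm hlim θ
  have h2 := (tendsto_integral_exp hYm hlim θ).const_mul (∫ ω, G ω ∂P)
  simp_rw [fun n => (hY n).2.integral_mul_exp hL ha hG θ] at h1
  exact tendsto_nhds_unique h1 h2

lemma norm_one_sub_le (hL : IsStableLevy P 𝓕 α L) (ha : 0 ≤ a) {C : ℝ} (hC0 : 0 ≤ C)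
    (hC : ∀ ξ, ‖1 - charFun (P.map (L 1)) ξ‖ ≤ C * ‖ξ‖ ^ α)
    (h : StepLim P L α Q a b κ X) (hκ : κ ≠ ⊤) (θ : ℝ) :
    ‖1 - ∫ ω, Complex.exp ((θ * X ω : ℝ) * Complex.I) ∂P‖ ≤ C * κ.toReal * |θ| ^ α := by
  obtain ⟨κ', Y, hY, hlim⟩ := h.exists_seq
  have hYm : ∀ n, AEMeasurable (Y n) P := fun n => ((hY n).2.measurable' hL ha).aemeasurable
  have h1 := ((tendsto_integral_exp hYm hlim θ).const_sub 1).norm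
  refine le_of_tendsto h1 (Eventually.of_forall fun n => ?_)
  refine ((hY n).2.norm_one_sub_le hL ha hC θ).2.trans ?_
  have := ENNReal.toReal_mono hκ (hY n).1
  rw [mul_right_comm]
  gcongr

lemma norm_integral_exp_le (hL : IsStableLevy P 𝓕 α L) (ha : 0 ≤ a) {q : ℝ} (hq : 0 < q)
    (hQ : ∀ e ∈ Q, ‖charFun (P.map (L 1)) e‖ ≤ q) (h : StepLim P L α Q a b κ X) :
    ‖∫ ω, Complex.exp (((1 : ℝ) * X ω : ℝ) * Complex.I) ∂P‖ ≤ q ^ (b - a) := by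
  obtain ⟨κ', Y, hY, hlim⟩ := h.exists_seq
  have hYm : ∀ n, AEMeasurable (Y n) P := fun n => ((hY n).2.measurable' hL ha).aemeasurable
  exact le_of_tendsto (tendsto_integral_exp hYm hlim 1).norm
    (Eventually.of_forall fun n => (hY n).2.norm_integral_exp_le hL ha hq hQ)

/-- The scales of the approximating step sums converge because the moduli of their characteristic
functions at `1` do. The explicit formula for `s` matters: it makes the scale a continuous function
of the law, hence later of the position. -/
lemma exists_scale (hL : IsStableLevy P 𝓕 α L) (ha : 0 ≤ a) {a₀ : EuclideanSpace ℝ (Fin d)}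
    (hQ : ∀ e ∈ Q, ∃ s : ℝ, 0 ≤ s ∧ ∀ θ : ℝ,
      charFun (P.map (L 1)) (θ • e) = charFun (P.map (L 1)) ((θ * s) • a₀))
    (h : StepLim P L α Q a b κ X) :
    ∃ s : ℝ, 0 ≤ s ∧
      s = (Real.log ‖∫ ω, Complex.exp (((1 : ℝ) * X ω : ℝ) * Complex.I) ∂P‖ /
        Real.log ‖charFun (P.map (L 1)) a₀‖) ^ (1 / α) ∧
      ∀ θ : ℝ, ∫ ω, Complex.exp ((θ * X ω : ℝ) * Complex.I) ∂P =
        charFun (P.map (L 1)) ((θ * s) • a₀) := by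
  have hα := hL.alpha_pos
  have := hL.isProbabilityMeasure_map (t := 1) zero_le_one
  obtain ⟨κ', Y, hY, hlim⟩ := h.exists_seq
  have hYm : ∀ n, AEMeasurable (Y n) P := fun n => ((hY n).2.measurable' hL ha).aemeasurable
  have hconv := tendsto_integral_exp hYm hlim
  choose s hs0 hs using fun n => (hY n).2.exists_scale hL ha hQ
  simp_rw [fun θ n => hs n θ] at hconv
  set q := ‖charFun (P.map (L 1)) a₀‖ with hq
  have hq0 : 0 < q := norm_pos_iff.2 (hL.charFun_ne_zero a₀)
  have hq1 : q ≤ 1 := norm_charFun_le_one _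
  set z := ∫ ω, Complex.exp (((1 : ℝ) * X ω : ℝ) * Complex.I) ∂P with hz
  rcases hq1.eq_or_lt with hq1 | hq1
  -- The degenerate direction: every characteristic function involved is `1`, so any scale works.
  -- Here `Real.log 1 = 0` and division by zero make the formula return `0`.
  · have h1 := hL.charFun_eq_one_of_norm_eq_one hq1
    refine ⟨_, ?_, rfl, fun θ => ?_⟩
    · rw [hq1]; simp [Real.zero_rpow (inv_ne_zero hα.ne')]
    · have h2 := hconv θ
      simp_rw [h1] at h2 ⊢
      exact tendsto_nhds_unique h2 tendsto_const_nhds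
  · have hlogq : Real.log q < 0 := Real.log_neg hq0 hq1
    have hnorm : ∀ θ : ℝ, 0 ≤ θ → Tendsto (fun n => (q ^ (s n ^ α)) ^ (θ ^ α)) atTop
        (𝓝 ‖∫ ω, Complex.exp ((θ * X ω : ℝ) * Complex.I) ∂P‖) := by
      intro θ hθ
      refine (hconv θ).norm.congr fun n => ?_
      rw [hL.norm_charFun_smul (mul_nonneg hθ (hs0 n)), Real.mul_rpow hθ (hs0 n),
        ← Real.rpow_mul hq0.le, mul_comm]
    have hnorm1 : Tendsto (fun n => q ^ (s n ^ α)) atTop (𝓝 ‖z‖) := by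
      simpa only [Real.one_rpow, Real.rpow_one] using hnorm 1 zero_le_one
    -- If the limit vanished at `1`, the moduli, being powers of each other, would vanish at all `1
    -- / (m + 1)`, against continuity at the origin.
    have hz0 : z ≠ 0 := by
      intro h0
      rw [h0, norm_zero] at hnorm1
      have h1 : ∀ m : ℕ, ∫ ω, Complex.exp ((1 / ((m : ℝ) + 1) * X ω : ℝ) * Complex.I) ∂P = 0 := by
        intro m
        have hm : (0 : ℝ) < 1 / ((m : ℝ) + 1) := by positivity
        have h2 := hnorm1.rpow_const (p := (1 / ((m : ℝ) + 1)) ^ α) (Or.inr (by positivity))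
        rw [Real.zero_rpow (by positivity)] at h2
        exact norm_eq_zero.1 (tendsto_nhds_unique (hnorm _ hm.le) h2)
      have hc : Tendsto (fun m : ℕ => ∫ ω, Complex.exp (((1 : ℝ) *
          (1 / ((m : ℝ) + 1) * X ω) : ℝ) * Complex.I) ∂P) atTop
          (𝓝 (∫ ω, Complex.exp (((1 : ℝ) * (0 * X ω) : ℝ) * Complex.I) ∂P)) := by
        refine tendsto_integral_exp (fun n => h.1.const_mul _) (ae_of_all _ fun ω => ?_) 1
        exact tendsto_one_div_add_atTop_nhds_zero_nat.mul_const _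
      simp_rw [one_mul, h1] at hc
      simp at hc
    have hzpos : 0 < ‖z‖ := norm_pos_iff.2 hz0
    have h3 : Tendsto (fun n => s n ^ α) atTop (𝓝 (Real.log ‖z‖ / Real.log q)) := by
      refine ((hnorm1.log hzpos.ne').div_const (Real.log q)).congr fun n => ?_
      rw [Real.log_rpow hq0, mul_div_assoc, div_self hlogq.ne, mul_one]
    have h4 : Tendsto s atTop (𝓝 ((Real.log ‖z‖ / Real.log q) ^ (1 / α))) := by
      refine (h3.rpow_const (p := 1 / α) (Or.inr (by positivity))).congr fun n => ?_
      rw [← Real.rpow_mul (hs0 n), mul_one_div_cancel hα.ne', Real.rpow_one]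
    refine ⟨_, ge_of_tendsto' h4 hs0, rfl, fun θ => ?_⟩
    refine tendsto_nhds_unique (hconv θ) ?_
    exact (hL.continuous_charFun.tendsto _).comp ((h4.const_mul θ).smul_const a₀)

/-- Vanishing energy implies convergence to zero in probability, whatever the intervals are. -/
lemma tendstoInMeasure_zero (hL : IsStableLevy P 𝓕 α L) {X : ℕ → Ω → ℝ}
    (h : ∀ η : ℝ, 0 < η → ∀ᶠ n in atTop, ∃ a b, 0 ≤ a ∧
      StepLim P L α Q a b (ENNReal.ofReal η) (X n)) :
    TendstoInMeasure P X atTop (fun _ => 0) := by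
  have hα := hL.alpha_pos
  obtain ⟨C, hC0, hC⟩ := hL.exists_norm_one_sub_charFun_le
  rw [tendstoInMeasure_iff_measureReal_norm]
  intro ε hε
  rw [Metric.tendsto_nhds]
  intro δ hδ
  -- The constant of the tail bound at level `ε / 2`; halving passes from the strict inequality of
  -- that bound to the closed event `ε ≤ |X n|`.
  set A : ℝ := 2 * (2 / (ε / 2)) ^ α * C with hA
  have hA0 : 0 ≤ A := by positivity
  have hη : A * (δ / (2 * (A + 1))) < δ := by
    rw [mul_div_assoc', div_lt_iff₀ (by positivity)]
    nlinarith
  filter_upwards [h (δ / (2 * (A + 1))) (by positivity)] with n hn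
  obtain ⟨a, b, ha, hS⟩ := hn
  rw [Real.dist_0_eq_abs, abs_of_nonneg measureReal_nonneg]
  refine lt_of_le_of_lt ((measureReal_mono fun ω hω => ?_).trans
    (measureReal_lt_abs_le hS.1 hα (hS.norm_one_sub_le hL ha hC0 hC (by simp)) (half_pos hε))) ?_
  · simp only [mem_ofPred_eq, Real.norm_eq_abs, sub_zero] at hω ⊢
    linarith
  · rw [ENNReal.toReal_ofReal (by positivity)]
    calc _ = A * (δ / (2 * (A + 1))) := by rw [hA]; ring
      _ < δ := hη

end StepLim

end

section

/-! ### Càdlàg functions -/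

/-- The point after `t` in the partition of `[a, b]` into `m` intervals of equal length. -/
noncomputable def nextPoint (a b : ℝ) (m : ℕ) (t : ℝ) : ℝ :=
  a + (⌊(t - a) / ((b - a) / m)⌋₊ + 1) * ((b - a) / m)

section nextPoint

variable {a b t : ℝ} {m : ℕ}

/-- No measurability of `f` is required, since `nextPoint` factors through a natural number. -/
lemma measurable_comp_nextPoint (f : ℝ → ℝ) : Measurable fun t => f (nextPoint a b m t) :=
  (measurable_from_nat (f := fun k : ℕ => f (a + (k + 1) * ((b - a) / m)))).comp
    (Nat.measurable_floor.comp (by fun_prop : Measurable fun t => (t - a) / ((b - a) / m)))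

lemma floor_lt_of_mem_Ico (hm : 0 < m) (ht : t ∈ Ico a b) :
    ⌊(t - a) / ((b - a) / m)⌋₊ < m := by
  have hab : 0 < b - a := by linarith [ht.1, ht.2]
  have hm' : (0 : ℝ) < m := by exact_mod_cast hm
  rw [Nat.floor_lt (div_nonneg (by linarith [ht.1]) (by positivity)), div_lt_iff₀ (by positivity)]
  field_simp
  linarith [ht.2]

lemma lt_nextPoint (hm : 0 < m) (hab : a < b) : t < nextPoint a b m t := by
  have hm' : (0 : ℝ) < m := by exact_mod_cast hm
  have h := Nat.lt_floor_add_one ((t - a) / ((b - a) / m))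
  rw [div_lt_iff₀ (div_pos (sub_pos.2 hab) hm')] at h
  unfold nextPoint
  linarith

lemma nextPoint_le (hm : 0 < m) (ht : t ∈ Ico a b) : nextPoint a b m t ≤ b := by
  have hab : 0 < b - a := by linarith [ht.1, ht.2]
  have hm' : (0 : ℝ) < m := by exact_mod_cast hm
  have h : ((⌊(t - a) / ((b - a) / m)⌋₊ : ℝ) + 1) ≤ m := by
    exact_mod_cast floor_lt_of_mem_Ico hm ht
  unfold nextPoint
  calc a + ((⌊(t - a) / ((b - a) / m)⌋₊ : ℝ) + 1) * ((b - a) / m) ≤ a + m * ((b - a) / m) := by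
        gcongr
    _ = b := by field_simp; ring

lemma nextPoint_le_add (hab : a < b) (ht : a ≤ t) :
    nextPoint a b m t ≤ t + (b - a) / m := by
  rcases m.eq_zero_or_pos with rfl | hm
  · simpa [nextPoint] using ht
  have hm' : (0 : ℝ) < m := by exact_mod_cast hm
  have h := Nat.floor_le (a := (t - a) / ((b - a) / m))
    (div_nonneg (by linarith) (div_nonneg (by linarith) hm'.le))
  rw [le_div_iff₀ (div_pos (sub_pos.2 hab) hm')] at h
  unfold nextPoint
  linarith

/-- The points approach `t` from the right and stay in `[a, b]`, which is the direction in which a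
càdlàg function is continuous. -/
lemma tendsto_nextPoint (ht : t ∈ Ico a b) :
    Tendsto (fun m => nextPoint a b m t) atTop (𝓝[Icc a b ∩ Ici t] t) := by
  have hab : a < b := ht.1.trans_lt ht.2
  refine tendsto_nhdsWithin_iff.2 ⟨?_, ?_⟩
  · have h1 : Tendsto (fun m : ℕ => t + (b - a) / m) atTop (𝓝 (t + 0)) :=
      (tendsto_const_div_atTop_nhds_zero_nat _).const_add t
    rw [add_zero] at h1
    refine tendsto_of_tendsto_of_tendsto_of_le_of_le' tendsto_const_nhds h1 ?_
      (Eventually.of_forall fun m => nextPoint_le_add hab ht.1)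
    filter_upwards [eventually_gt_atTop 0] with m hm
    exact (lt_nextPoint hm hab).le
  · filter_upwards [eventually_gt_atTop 0] with m hm
    have := lt_nextPoint (t := t) hm hab
    exact ⟨⟨ht.1.trans this.le, nextPoint_le hm ht⟩, this.le⟩

lemma nextPoint_eq (hab : a < b) (hm : 0 < m) {k : ℕ}
    (ht : t ∈ Ico (a + k * ((b - a) / m)) (a + (k + 1) * ((b - a) / m))) :
    nextPoint a b m t = a + (k + 1) * ((b - a) / m) := by
  have hm' : (0 : ℝ) < m := by exact_mod_cast hm
  have hh : 0 < (b - a) / m := div_pos (sub_pos.2 hab) hm'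
  have h : ⌊(t - a) / ((b - a) / m)⌋₊ = k := by
    rw [Nat.floor_eq_iff (div_nonneg (by have := ht.1; have : 0 ≤ k * ((b - a) / m) := by positivity
                                         linarith) hh.le)]
    rw [le_div_iff₀ hh, div_lt_iff₀ hh]
    constructor <;> linarith [ht.1, ht.2]
  unfold nextPoint
  rw [h]

end nextPoint

namespace CadlagOn

section general

variable {E : Type*} [NormedAddCommGroup E] {f g : ℝ → E} {s s' : Set ℝ}

lemma mono (hf : CadlagOn f s) (hs : s' ⊆ s) : CadlagOn f s' := by
  intro t ht
  obtain ⟨h1, l, h2⟩ := hf t (hs ht)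
  exact ⟨h1.mono (inter_subset_inter_left _ hs),
    l, h2.mono_left (nhdsWithin_mono _ (inter_subset_inter_left _ hs))⟩

lemma add (hf : CadlagOn f s) (hg : CadlagOn g s) : CadlagOn (fun t => f t + g t) s := by
  intro t ht
  obtain ⟨h1, l, h2⟩ := hf t ht
  obtain ⟨h3, l', h4⟩ := hg t ht
  exact ⟨h1.add h3, l + l', h2.add h4⟩

lemma sub (hf : CadlagOn f s) (hg : CadlagOn g s) : CadlagOn (fun t => f t - g t) s := by
  intro t ht
  obtain ⟨h1, l, h2⟩ := hf t ht
  obtain ⟨h3, l', h4⟩ := hg t ht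
  exact ⟨h1.sub h3, l - l', h2.sub h4⟩

lemma comp_continuous {F : Type*} [NormedAddCommGroup F] {φ : E → F} (hφ : Continuous φ)
    (hf : CadlagOn f s) : CadlagOn (fun t => φ (f t)) s := by
  intro t ht
  obtain ⟨h1, l, h2⟩ := hf t ht
  exact ⟨hφ.continuousAt.comp_continuousWithinAt h1, φ l, (hφ.tendsto l).comp h2⟩

lemma of_continuousOn (hf : ContinuousOn f s) : CadlagOn f s := fun t ht =>
  ⟨(hf t ht).mono inter_subset_left, f t,
    (hf t ht).mono_left (nhdsWithin_mono _ inter_subset_left)⟩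

lemma const (c : E) : CadlagOn (fun _ => c) s := of_continuousOn continuousOn_const

lemma sum {ι : Type*} (u : Finset ι) {f : ι → ℝ → E} (h : ∀ i ∈ u, CadlagOn (f i) s) :
    CadlagOn (fun t => ∑ i ∈ u, f i t) s := by
  classical
  induction u using Finset.induction_on with
  | empty => simpa using const 0
  | insert i u hi ih =>
    simp_rw [Finset.sum_insert hi]
    exact (h i (by simp)).add (ih fun j hj => h j (by simp [hj]))

lemma comp_monotone {g : ℝ → ℝ} (hg : Monotone g) (hgc : Continuous g) (hmaps : MapsTo g s' s)
    (hf : CadlagOn f s) : CadlagOn (fun t => f (g t)) s' := by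
  intro t ht
  obtain ⟨h1, l, h2⟩ := hf (g t) (hmaps ht)
  refine ⟨ContinuousWithinAt.comp (t := s ∩ Ici (g t)) h1 hgc.continuousWithinAt
    fun y hy => ⟨hmaps hy.1, hg hy.2⟩, ?_⟩
  -- Either `g` is constant just to the left of `t`, and then so is the composition, or `g`
  -- approaches `g t` strictly from below and the left limit of `f` applies.
  by_cases hcase : ∃ t' < t, g t' = g t
  · obtain ⟨t', ht', h⟩ := hcase
    refine ⟨f (g t), tendsto_const_nhds.congr' ?_⟩
    have : ∀ᶠ y in 𝓝[s' ∩ Iio t] t, t' < y := nhdsWithin_le_nhds (lt_mem_nhds ht')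
    filter_upwards [this, self_mem_nhdsWithin] with y hy hy'
    rw [le_antisymm (hg hy'.2.le) (h ▸ hg hy.le)]
  · push Not at hcase
    refine ⟨l, h2.comp (tendsto_nhdsWithin_iff.2 ⟨hgc.continuousWithinAt, ?_⟩)⟩
    filter_upwards [self_mem_nhdsWithin] with y hy
    exact ⟨hmaps hy.1, lt_of_le_of_ne (hg hy.2.le) (hcase y hy.2)⟩

lemma of_uniform_limit [CompleteSpace E] {f : ℕ → ℝ → E} {g : ℝ → E} (hf : ∀ n, CadlagOn (f n) s)
    (h : TendstoUniformlyOn f g atTop s) : CadlagOn g s := by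
  intro t ht
  refine ⟨?_, ?_⟩
  · refine continuousWithinAt_of_locally_uniform_approx_of_continuousWithinAt ⟨ht, self_mem_Ici⟩
      fun u hu => ?_
    obtain ⟨n, hn⟩ := (h u hu).exists
    exact ⟨s ∩ Ici t, self_mem_nhdsWithin, f n, (hf n t ht).1, fun y hy => hn y hy.1⟩
  -- At a point without neighbours of `s` to its left the filter is trivial and any value serves as
  -- the left limit.
  · rcases (𝓝[s ∩ Iio t] t).eq_or_neBot with h0 | hne
    · exact ⟨0, by rw [h0]; exact tendsto_bot⟩
    choose l hl using fun n => (hf n t ht).2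
    have hcau : CauchySeq l := by
      rw [Metric.cauchySeq_iff']
      intro ε hε
      rw [Metric.tendstoUniformlyOn_iff] at h
      obtain ⟨N, hN⟩ := eventually_atTop.1 (h (ε / 4) (by positivity))
      refine ⟨N, fun n hn => ?_⟩
      have h1 : dist (l n) (l N) ≤ ε / 2 := by
        refine le_of_tendsto ((hl n).dist (hl N)) ?_
        filter_upwards [self_mem_nhdsWithin] with y hy
        have h2 := hN n hn y hy.1
        have h3 := hN N le_rfl y hy.1
        have := dist_triangle_left (f n y) (f N y) (g y)
        linarith
      linarith
    obtain ⟨L, hL⟩ := cauchySeq_tendsto_of_complete hcau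
    refine ⟨L, Metric.tendsto_nhds.2 fun ε hε => ?_⟩
    obtain ⟨n, hn1, hn2⟩ := ((Metric.tendstoUniformlyOn_iff.1 h (ε / 3) (by positivity)).and
      (Metric.tendsto_nhds.1 hL (ε / 3) (by positivity))).exists
    filter_upwards [self_mem_nhdsWithin, Metric.tendsto_nhds.1 (hl n) (ε / 3) (by positivity)]
      with y hy hy2
    have h1 := hn1 y hy.1
    have h2 := dist_triangle4 (g y) (f n y) (l n) L
    linarith

end general

variable {f g : ℝ → ℝ} {a b : ℝ}

lemma tendsto_comp_nextPoint (hf : CadlagOn f (Icc a b)) {t : ℝ} (ht : t ∈ Ico a b) :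
    Tendsto (fun m => f (nextPoint a b m t)) atTop (𝓝 (f t)) :=
  (hf t (Ico_subset_Icc_self ht)).1.tendsto.comp (tendsto_nextPoint ht)

/-- A càdlàg function that takes values in a closed set at the dyadic points takes values in it
everywhere. -/
lemma mem_of_dyadic (hf : CadlagOn f (Icc a b)) {S : Set ℝ} (hS : IsClosed S)
    (h : ∀ j k : ℕ, k ≤ 2 ^ j → f (a + k * ((b - a) / (2 ^ j : ℕ))) ∈ S) {t : ℝ}
    (ht : t ∈ Icc a b) : f t ∈ S := by
  -- The right endpoint is the dyadic point `j = 0`, `k = 1`; every other point is a limit from the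
  -- right of dyadic points.
  rcases ht.2.eq_or_lt with rfl | htb
  · have := h 0 1 (by simp)
    simpa using this
  · have h1 := (hf.tendsto_comp_nextPoint ⟨ht.1, htb⟩).comp
      (tendsto_pow_atTop_atTop_of_one_lt (r := 2) (by norm_num))
    refine hS.mem_of_tendsto h1 (Eventually.of_forall fun j => ?_)
    have h2 := h j (⌊(t - a) / ((b - a) / (2 ^ j : ℕ))⌋₊ + 1)
      (floor_lt_of_mem_Ico (by positivity) ⟨ht.1, htb⟩)
    push_cast at h2 ⊢
    simpa [nextPoint] using h2

lemma exists_bound (hf : CadlagOn f (Icc a b)) : ∃ C, ∀ t ∈ Icc a b, |f t| ≤ C := by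
  refine isCompact_Icc.induction_on (p := fun S => ∃ C, ∀ t ∈ S, |f t| ≤ C) ⟨0, by simp⟩ ?_ ?_ ?_
  · rintro S S' hS ⟨C, hC⟩
    exact ⟨C, fun t ht => hC t (hS ht)⟩
  · rintro S S' ⟨C, hC⟩ ⟨C', hC'⟩
    refine ⟨max C C', fun t ht => ?_⟩
    rcases ht with ht | ht
    · exact (hC t ht).trans (le_max_left _ _)
    · exact (hC' t ht).trans (le_max_right _ _)
  · intro t ht
    obtain ⟨h1, l, h2⟩ := hf t ht
    have hsub : 𝓝[Icc a b] t ≤ 𝓝[Icc a b ∩ Iio t] t ⊔ 𝓝[Icc a b ∩ Ici t] t := by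
      rw [← nhdsWithin_union, ← inter_union_distrib_left, Iio_union_Ici, inter_univ]
    refine ⟨{y | |f y| ≤ max (|l| + 1) (|f t| + 1)}, hsub ?_, _, fun y hy => hy⟩
    refine mem_sup.2 ⟨?_, ?_⟩
    · filter_upwards [h2.abs.eventually (gt_mem_nhds (lt_add_one |l|))] with y hy
      exact hy.le.trans (le_max_left _ _)
    · filter_upwards [h1.tendsto.abs.eventually (gt_mem_nhds (lt_add_one |f t|))] with y hy
      exact hy.le.trans (le_max_right _ _)

/-- Right-continuity exhibits `f` as the pointwise limit of the step functions `f ∘ nextPoint`. -/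
lemma aestronglyMeasurable (hf : CadlagOn f (Icc a b)) :
    AEStronglyMeasurable f (volume.restrict (Ioc a b)) := by
  rw [← restrict_Ico_eq_restrict_Ioc]
  refine aestronglyMeasurable_of_tendsto_ae atTop
    (f := fun m t => f (nextPoint a b m t))
    (fun m => (measurable_comp_nextPoint f).aestronglyMeasurable) ?_
  filter_upwards [ae_restrict_mem measurableSet_Ico] with t ht
  exact hf.tendsto_comp_nextPoint ht

lemma intervalIntegrable (hf : CadlagOn f (Icc a b)) (hab : a ≤ b) :
    IntervalIntegrable f volume a b := by
  rw [intervalIntegrable_iff_integrableOn_Ioc_of_le hab]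
  obtain ⟨C, hC⟩ := hf.exists_bound
  refine IntegrableOn.of_bound (by simp) hf.aestronglyMeasurable C ?_
  filter_upwards [ae_restrict_mem measurableSet_Ioc] with t ht
  exact hC t (Ioc_subset_Icc_self ht)

lemma mul_continuous (hf : CadlagOn f (Icc a b)) (hg : ContinuousOn g (Icc a b)) :
    CadlagOn (fun t => g t * f t) (Icc a b) := by
  intro t ht
  obtain ⟨h1, l, h2⟩ := hf t ht
  exact ⟨((hg t ht).mono inter_subset_left).mul h1, g t * l,
    ((hg t ht).mono_left (nhdsWithin_mono _ inter_subset_left)).mul h2⟩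

/-- Right-endpoint Riemann-Stieltjes sums of a càdlàg function against a `C¹` function. -/
lemma tendsto_sum_mul_sub (hf : CadlagOn f (Icc a b)) (hab : a < b) {w w' : ℝ → ℝ}
    (hw : ∀ t, HasDerivAt w (w' t) t) (hw' : Continuous w') :
    Tendsto (fun m : ℕ => ∑ j ∈ Finset.range m, f (a + (j + 1) * ((b - a) / m)) *
      (w (a + (j + 1) * ((b - a) / m)) - w (a + j * ((b - a) / m)))) atTop
      (𝓝 (∫ t in a..b, f t * w' t)) := by
  obtain ⟨C, hC⟩ := hf.exists_bound
  have hlim : Tendsto (fun m : ℕ => ∫ t in a..b, f (nextPoint a b m t) * w' t) atTop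
      (𝓝 (∫ t in a..b, f t * w' t)) := by
    refine intervalIntegral.tendsto_integral_filter_of_dominated_convergence (fun t => C * |w' t|)
      (Eventually.of_forall fun m => ?_) ?_ ?_ ?_
    · exact ((measurable_comp_nextPoint f).aestronglyMeasurable).mul hw'.aestronglyMeasurable
    · filter_upwards [eventually_gt_atTop 0] with m hm
      have : ∀ᵐ t : ℝ, t ≠ b := by simp [ae_iff]
      filter_upwards [this] with t htb ht
      rw [uIoc_of_le hab.le] at ht
      have ht' : t ∈ Ico a b := ⟨ht.1.le, lt_of_le_of_ne ht.2 htb⟩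
      rw [norm_mul, Real.norm_eq_abs, Real.norm_eq_abs]
      gcongr
      exact hC _ ⟨ht'.1.trans (lt_nextPoint hm hab).le, nextPoint_le hm ht'⟩
    · exact (Continuous.intervalIntegrable (by fun_prop) _ _)
    · have : ∀ᵐ t : ℝ, t ≠ b := by simp [ae_iff]
      filter_upwards [this] with t htb ht
      rw [uIoc_of_le hab.le] at ht
      have ht' : t ∈ Ico a b := ⟨ht.1.le, lt_of_le_of_ne ht.2 htb⟩
      exact (hf.tendsto_comp_nextPoint ht').mul_const _
  refine hlim.congr' ?_
  filter_upwards [eventually_gt_atTop 0] with m hm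
  have hm' : (0 : ℝ) < m := by exact_mod_cast hm
  have hh : 0 < (b - a) / m := div_pos (sub_pos.2 hab) hm'
  set τ : ℕ → ℝ := fun j => a + j * ((b - a) / m) with hτ
  have hτs : ∀ j : ℕ, a + ((j : ℝ) + 1) * ((b - a) / m) = τ (j + 1) := fun j => by
    simp [hτ]
  have hcell : ∀ j < m, IntervalIntegrable (fun t => f (nextPoint a b m t) * w' t) volume
      (τ j) (τ (j + 1)) ∧ ∫ t in (τ j)..(τ (j + 1)), f (nextPoint a b m t) * w' t =
      f (τ (j + 1)) * (w (τ (j + 1)) - w (τ j)) := by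
    intro j hj
    have hle : τ j ≤ τ (j + 1) := by simp only [hτ]; push_cast; nlinarith
    have hae : ∀ᵐ t : ℝ, t ∈ uIoc (τ j) (τ (j + 1)) → f (τ (j + 1)) * w' t =
        f (nextPoint a b m t) * w' t := by
      have : ∀ᵐ t : ℝ, t ≠ τ (j + 1) := by simp [ae_iff]
      filter_upwards [this] with t htb ht
      rw [uIoc_of_le hle] at ht
      rw [nextPoint_eq (k := j) hab hm ⟨ht.1.le, ?_⟩, hτs]
      rw [hτs]
      exact lt_of_le_of_ne ht.2 htb
    constructor
    · refine IntervalIntegrable.congr_ae ((hw'.intervalIntegrable _ _).const_mul (f (τ (j + 1)))) ?_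
      rwa [EventuallyEq, ae_restrict_iff' measurableSet_uIoc]
    · rw [← intervalIntegral.integral_congr_ae hae, intervalIntegral.integral_const_mul,
        intervalIntegral.integral_eq_sub_of_hasDerivAt (fun t _ => hw t)
          (hw'.intervalIntegrable _ _)]
  have h0 : τ 0 = a := by simp [hτ]
  have hmb : τ m = b := by simp only [hτ]; field_simp; ring
  have := intervalIntegral.sum_integral_adjacent_intervals (μ := volume)
    (f := fun t => f (nextPoint a b m t) * w' t) (a := τ) (n := m) fun k hk => (hcell k hk).1
  rw [h0, hmb] at this
  rw [← this]
  refine Finset.sum_congr rfl fun j hj => ?_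
  rw [(hcell j (Finset.mem_range.1 hj)).2, hτs]

/-- Integration by parts: left-endpoint Riemann-Stieltjes sums of a `C¹` function against a
càdlàg function. -/
lemma tendsto_sum_sub_mul (hf : CadlagOn f (Icc a b)) (hab : a ≤ b) {w w' : ℝ → ℝ}
    (hw : ∀ t, HasDerivAt w (w' t) t) (hw' : Continuous w') :
    Tendsto (fun m : ℕ => ∑ j ∈ Finset.range m, w (a + j * ((b - a) / m)) *
      (f (a + (j + 1) * ((b - a) / m)) - f (a + j * ((b - a) / m)))) atTop
      (𝓝 (w b * f b - w a * f a - ∫ t in a..b, f t * w' t)) := by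
  rcases hab.eq_or_lt with rfl | hab
  · simp
  refine ((hf.tendsto_sum_mul_sub hab hw hw').const_sub (w b * f b - w a * f a)).congr' ?_
  filter_upwards [eventually_gt_atTop 0] with m hm
  have hm' : (0 : ℝ) < m := by exact_mod_cast hm
  set τ : ℕ → ℝ := fun j => a + j * ((b - a) / m) with hτ
  have hτs : ∀ j : ℕ, a + ((j : ℝ) + 1) * ((b - a) / m) = τ (j + 1) := fun j => by
    simp [hτ]
  have h0 : τ 0 = a := by simp [hτ]
  have hmb : τ m = b := by simp only [hτ]; field_simp; ring
  simp_rw [hτs]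
  have := Finset.sum_range_sub (fun j => w (τ j) * f (τ j)) m
  rw [h0, hmb] at this
  rw [← this, sub_eq_iff_eq_add, ← Finset.sum_add_distrib]
  refine Finset.sum_congr rfl fun j _ => ?_
  simp only [hτ]
  ring

end CadlagOn

/-! ### A linear integral equation with càdlàg forcing -/

section linear

variable {a b r : ℝ} {f X : ℝ → ℝ}

lemma CadlagOn.hasDerivWithinAt_integral (hf : CadlagOn f (Icc a b)) {t : ℝ} (ht : t ∈ Ioo a b) :
    HasDerivWithinAt (fun u => ∫ s in a..u, f s) (f t) (Ioi t) t := by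
  have hc : ContinuousWithinAt f (Ioi t) t := by
    refine (hf t (Ioo_subset_Icc_self ht)).1.mono_of_mem_nhdsWithin ?_
    have : Ioo t b ∈ 𝓝[>] t := Ioo_mem_nhdsGT ht.2
    exact mem_of_superset this fun y hy => ⟨⟨ht.1.le.trans hy.1.le, hy.2.le⟩, hy.1.le⟩
  have hsub : Ioo t b ⊆ Ioc a b := fun y hy => ⟨ht.1.trans hy.1, hy.2.le⟩
  have hm : StronglyMeasurableAtFilter f (𝓝[>] t) volume :=
    ⟨Ioo t b, Ioo_mem_nhdsGT ht.2, hf.aestronglyMeasurable.mono_measure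
      (Measure.restrict_mono hsub le_rfl)⟩
  exact (intervalIntegral.integral_hasDerivWithinAt_right (s := Ici t) (t := Ioi t)
    ((hf.mono (Icc_subset_Icc_right ht.2.le)).intervalIntegrable ht.1.le) hm hc).mono
    Ioi_subset_Ici_self

lemma CadlagOn.continuousOn_integral (hf : CadlagOn f (Icc a b)) (hab : a ≤ b) :
    ContinuousOn (fun u => ∫ s in a..u, f s) (Icc a b) := by
  have := intervalIntegral.continuousOn_primitive_interval' (hf.intervalIntegrable hab)
    (a := a) left_mem_uIcc
  rwa [uIcc_of_le hab] at this

/-- An integrating factor: `exp (r (b - u)) ∫_a^u X` has derivative `exp (r (b - u)) f u`. Only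
right derivatives exist at jumps, and they suffice for the fundamental theorem. In particular the
final value is unique. -/
lemma linear_integral_eq_solution (hab : a ≤ b) (hf : CadlagOn f (Icc a b))
    (hX : CadlagOn X (Icc a b)) (h : ∀ t ∈ Icc a b, X t = f t + r * ∫ s in a..t, X s) :
    X b = f b + r * ∫ s in a..b, Real.exp (r * (b - s)) * f s := by
  rw [h b (right_mem_Icc.2 hab)]
  congr 2
  have hg : CadlagOn (fun s => Real.exp (r * (b - s)) * f s) (Icc a b) :=
    hf.mul_continuous (by fun_prop)
  have hd : ∀ t ∈ Ioo a b, HasDerivWithinAt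
      (fun u => Real.exp (r * (b - u)) * ∫ s in a..u, X s)
      (Real.exp (r * (b - t)) * f t) (Ioi t) t := by
    intro t ht
    have h1 : HasDerivAt (fun u => Real.exp (r * (b - u)))
        (Real.exp (r * (b - t)) * (r * (0 - 1))) t :=
      (((hasDerivAt_const t b).sub (hasDerivAt_id t)).const_mul r).exp
    have h2 := h1.hasDerivWithinAt.mul (hX.hasDerivWithinAt_integral ht)
    refine h2.congr_deriv ?_
    rw [h t (Ioo_subset_Icc_self ht)]
    ring
  have := intervalIntegral.integral_eq_sub_of_hasDeriv_right_of_le hab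
    (ContinuousOn.mul (by fun_prop) (hX.continuousOn_integral hab)) hd (hg.intervalIntegrable hab)
  rw [this]
  simp

/-- The variation of constants formula does solve the equation, with càdlàg paths. -/
lemma exists_linear_integral_eq (hf : CadlagOn f (Icc a b)) :
    CadlagOn (fun t => f t + r * ∫ s in a..t, Real.exp (r * (t - s)) * f s) (Icc a b) ∧
    ∀ t ∈ Icc a b, f t + r * (∫ s in a..t, Real.exp (r * (t - s)) * f s) =
      f t + ∫ u in a..t, r * (f u + r * ∫ s in a..u, Real.exp (r * (u - s)) * f s) := by
  have hg : CadlagOn (fun s => Real.exp (-(r * s)) * f s) (Icc a b) :=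
    hf.mul_continuous (by fun_prop)
  -- Pulling `exp (r t)` out leaves a plain primitive, to which the product rule applies.
  have hΨ : ∀ t, ∫ s in a..t, Real.exp (r * (t - s)) * f s =
      Real.exp (r * t) * ∫ s in a..t, Real.exp (-(r * s)) * f s := by
    intro t
    rw [← intervalIntegral.integral_const_mul]
    congr 1
    ext s
    rw [← mul_assoc, ← Real.exp_add]
    ring_nf
  simp_rw [hΨ]
  have hcont : ∀ t ∈ Icc a b, ContinuousOn
      (fun t => Real.exp (r * t) * ∫ s in a..t, Real.exp (-(r * s)) * f s) (Icc a t) :=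
    fun t ht => ContinuousOn.mul (by fun_prop)
      ((hg.mono (Icc_subset_Icc_right ht.2)).continuousOn_integral ht.1)
  have hcad : CadlagOn (fun t => f t + r * (Real.exp (r * t) *
      ∫ s in a..t, Real.exp (-(r * s)) * f s)) (Icc a b) := by
    rcases le_or_gt a b with hab | hab
    · exact hf.add (.of_continuousOn ((hcont b (right_mem_Icc.2 hab)).const_smul r))
    · simp [Icc_eq_empty hab.not_ge, CadlagOn]
  refine ⟨hcad, fun t ht => ?_⟩
  congr 1
  rw [intervalIntegral.integral_const_mul]
  congr 1
  have hd : ∀ u ∈ Ioo a t, HasDerivWithinAt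
      (fun u => Real.exp (r * u) * ∫ s in a..u, Real.exp (-(r * s)) * f s)
      (f u + r * (Real.exp (r * u) * ∫ s in a..u, Real.exp (-(r * s)) * f s)) (Ioi u) u := by
    intro u hu
    have h1 : HasDerivAt (fun u => Real.exp (r * u)) (Real.exp (r * u) * (r * 1)) u :=
      ((hasDerivAt_id u).const_mul r).exp
    have h2 := h1.hasDerivWithinAt.mul
      (hg.hasDerivWithinAt_integral (t := u) ⟨hu.1, hu.2.trans_le ht.2⟩)
    refine h2.congr_deriv ?_
    rw [← mul_assoc (Real.exp (r * u)) (Real.exp (-(r * u))), ← Real.exp_add]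
    simp
    ring
  rw [intervalIntegral.integral_eq_sub_of_hasDeriv_right_of_le ht.1 (hcont t ht) hd
    ((hcad.mono (Icc_subset_Icc_right ht.2)).intervalIntegrable ht.1)]
  simp

end linear

end

section

/-! ### Independence from a σ-algebra through characteristic functions -/

section independence

variable {Ω : Type*} {m mΩ : MeasurableSpace Ω} {P : Measure Ω} [IsProbabilityMeasure P]

/-- With `G` the indicator of `A`, the hypothesis says that the law of `Z` under `P` restricted to
`A` and `P A` times the law of `Z` have the same characteristic function. -/
lemma measure_inter_preimage_of_charFunDual {V : Type*} [NormedAddCommGroup V] [NormedSpace ℝ V]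
    [CompleteSpace V] [MeasurableSpace V] [BorelSpace V] [SecondCountableTopology V]
    (hm : m ≤ mΩ) {Z : Ω → V} (hZ : AEMeasurable Z P)
    (h : ∀ G : Ω → ℂ, Measurable[m] G → (∀ ω, ‖G ω‖ ≤ 1) → ∀ l : StrongDual ℝ V,
      ∫ ω, G ω * Complex.exp (l (Z ω) * Complex.I) ∂P =
        (∫ ω, G ω ∂P) * ∫ ω, Complex.exp (l (Z ω) * Complex.I) ∂P)
    {A : Set Ω} (hA : MeasurableSet[m] A) {B : Set V} (hB : MeasurableSet B) :
    P (A ∩ Z ⁻¹' B) = P A * P (Z ⁻¹' B) := by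
  have hA' : MeasurableSet A := hm A hA
  have hZA : AEMeasurable Z (P.restrict A) := hZ.restrict
  have hfin : IsFiniteMeasure (P A • P.map Z) := by
    have := Measure.isProbabilityMeasure_map hZ
    exact ⟨by simp [measure_lt_top]⟩
  have key : (P.restrict A).map Z = P A • P.map Z := by
    refine Measure.ext_of_charFunDual (funext fun l => ?_)
    have hGm : Measurable[m] (A.indicator fun _ => (1 : ℂ)) :=
      (@measurable_const _ _ _ m _).indicator hA
    have h1 := h (A.indicator fun _ => 1) hGm
      (fun ω => by by_cases hω : ω ∈ A <;> simp [hω]) l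
    rw [charFunDual_apply, charFunDual_apply, integral_map hZA (by fun_prop),
      integral_smul_measure, integral_map hZ (by fun_prop)]
    rw [integral_indicator_const _ hA'] at h1
    simp only [mul_one, Complex.real_smul] at h1
    rw [Complex.real_smul, ← measureReal_def, ← h1, ← integral_indicator hA']
    congr 1
    ext ω
    by_cases hω : ω ∈ A <;> simp [hω]
  have := congrArg (fun μ => μ B) key
  simp only [Measure.smul_apply, smul_eq_mul] at this
  rw [Measure.map_apply_of_aemeasurable hZA hB, Measure.map_apply_of_aemeasurable hZ hB,
    Measure.restrict_apply₀' hA'.nullMeasurableSet] at this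
  rw [inter_comm, this]

/-- Ottaviani's inequality. -/
lemma measure_exists_lt_abs_le {D : ℕ → Ω → ℝ} {m : ℕ → MeasurableSpace Ω} (hmono : Monotone m)
    (hm : ∀ k, m k ≤ mΩ) {N : ℕ} (hD : ∀ k ≤ N, Measurable[m k] (D k)) {lam : ℝ}
    (hind : ∀ k ≤ N, ∀ A, MeasurableSet[m k] A →
      P (A ∩ {ω | |D N ω - D k ω| ≤ lam}) = P A * P {ω | |D N ω - D k ω| ≤ lam})
    (hhalf : ∀ k ≤ N, 2⁻¹ ≤ P {ω | |D N ω - D k ω| ≤ lam}) :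
    P {ω | ∃ k ≤ N, 2 * lam < |D k ω|} ≤ 2 * P {ω | lam < |D N ω|} := by
  -- The event that the level `2 lam` is exceeded for the first time at index `k`. It is known at
  -- that index, hence independent of `C k`.
  set B : ℕ → Set Ω := fun k => {ω | 2 * lam < |D k ω| ∧ ∀ j < k, |D j ω| ≤ 2 * lam} with hB
  set C : ℕ → Set Ω := fun k => {ω | |D N ω - D k ω| ≤ lam} with hC
  have hBm : ∀ k ≤ N, MeasurableSet[m k] (B k) := by
    intro k hk
    have h1 : MeasurableSet[m k] {ω | 2 * lam < |D k ω|} :=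
      (measurable_norm.comp (hD k hk)) measurableSet_Ioi
    have h2 : ∀ j < k, MeasurableSet[m k] {ω | |D j ω| ≤ 2 * lam} := fun j hj =>
      (measurable_norm.comp ((hD j (by omega)).mono (hmono hj.le) le_rfl)) measurableSet_Iic
    have : B k = {ω | 2 * lam < |D k ω|} ∩ ⋂ j ∈ {j | j < k}, {ω | |D j ω| ≤ 2 * lam} := by
      ext ω; simp [hB]
    rw [this]
    exact h1.inter (MeasurableSet.biInter (to_countable _) h2)
  have hBdisj : ∀ i j, i < j → Disjoint (B i) (B j) := by
    intro i j hij
    rw [Set.disjoint_left]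
    intro ω hi hj
    exact absurd hi.1 (not_lt.2 (hj.2 i hij))
  have hpair : ∀ S : ℕ → Set Ω, (∀ k, S k ⊆ B k) →
      (↑(Finset.range (N + 1)) : Set ℕ).PairwiseDisjoint S := by
    intro S hS i _ j _ hij
    rcases lt_or_gt_of_ne hij with h | h
    · exact (hBdisj i j h).mono (hS i) (hS j)
    · exact (hBdisj j i h).symm.mono (hS i) (hS j)
  have hCm : ∀ k ≤ N, MeasurableSet (C k) := fun k hk =>
    (measurable_norm.comp (((hD N le_rfl).mono (hm N) le_rfl).sub
      ((hD k hk).mono (hm k) le_rfl))) measurableSet_Iic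
  have hunion : {ω | ∃ k ≤ N, 2 * lam < |D k ω|} = ⋃ k ∈ Finset.range (N + 1), B k := by
    classical
    ext ω
    simp only [mem_ofPred_eq, mem_iUnion, Finset.mem_range, Nat.lt_succ_iff, hB, exists_prop]
    constructor
    · rintro h
      refine ⟨Nat.find h, (Nat.find_spec h).1, (Nat.find_spec h).2, fun j hj => ?_⟩
      have := Nat.find_min h hj
      push Not at this
      exact this (hj.le.trans (Nat.find_spec h).1)
    · rintro ⟨k, hk, h, -⟩
      exact ⟨k, hk, h⟩
  have h1 : P {ω | ∃ k ≤ N, 2 * lam < |D k ω|} = ∑ k ∈ Finset.range (N + 1), P (B k) := by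
    rw [hunion, measure_biUnion_finset (hpair B fun _ => subset_rfl)]
    exact fun k hk => hm k _ (hBm k (Nat.lt_succ_iff.1 (Finset.mem_range.1 hk)))
  -- On `B k ∩ C k` the last value cannot have come back below `lam`.
  have h2 : ∑ k ∈ Finset.range (N + 1), P (B k ∩ C k) ≤ P {ω | lam < |D N ω|} := by
    rw [← measure_biUnion_finset (hpair _ fun _ => inter_subset_left)]
    · refine measure_mono (iUnion₂_subset fun k _ ω hω => ?_)
      have h1 := hω.1.1
      have h2 : |D N ω - D k ω| ≤ lam := hω.2
      have h3 := abs_sub_abs_le_abs_sub (D k ω) (D N ω)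
      rw [abs_sub_comm] at h3
      simp only [mem_ofPred_eq]
      linarith
    · intro k hk
      have hk' := Nat.lt_succ_iff.1 (Finset.mem_range.1 hk)
      exact (hm k _ (hBm k hk')).inter (hCm k hk')
  calc P {ω | ∃ k ≤ N, 2 * lam < |D k ω|} = ∑ k ∈ Finset.range (N + 1), P (B k) := h1
    _ ≤ ∑ k ∈ Finset.range (N + 1), 2 * P (B k ∩ C k) := by
      refine Finset.sum_le_sum fun k hk => ?_
      have hk' := Nat.lt_succ_iff.1 (Finset.mem_range.1 hk)
      rw [hind k hk' _ (hBm k hk')]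
      calc P (B k) = 2 * (P (B k) * 2⁻¹) := by
            rw [mul_left_comm, ENNReal.mul_inv_cancel (by simp) (by simp), mul_one]
        _ ≤ _ := by gcongr; exact hhalf k hk'
    _ ≤ _ := by
      rw [← Finset.mul_sum]
      gcongr

end independence

/-! ### Construction of the stochastic integral of a deterministic continuous function -/

variable {Ω : Type*} {mΩ : MeasurableSpace Ω} {P : Measure Ω} [IsProbabilityMeasure P] {d : ℕ}
  {𝓕 : Filtration ℝ mΩ} {α : ℝ} {L : ℝ → Ω → EuclideanSpace ℝ (Fin d)}
  {Q : Set (EuclideanSpace ℝ (Fin d))} {a b c : ℝ} {κ κ' : ℝ≥0∞} {X Y Y' : Ω → ℝ}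

/-- A step limit over `[a, b]` is independent of the information at time `a`. -/
lemma StepLim.measure_inter (hL : IsStableLevy P 𝓕 α L) (ha : 0 ≤ a)
    (h : StepLim P L α Q a b κ X) {A : Set Ω} (hA : MeasurableSet[𝓕 a] A) {B : Set ℝ}
    (hB : MeasurableSet B) : P (A ∩ X ⁻¹' B) = P A * P (X ⁻¹' B) := by
  refine measure_inter_preimage_of_charFunDual (𝓕.le a) h.1 (fun G hG hG1 l => ?_) hA hB
  have hl : ∀ x, l x = l 1 * x := fun x => by
    rw [mul_comm, ← smul_eq_mul, ← map_smul, smul_eq_mul, mul_one]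
  simp only [fun ω => hl (X ω)]
  exact h.integral_mul_exp hL ha hG hG1 (l 1)

/-- The integral over `[0, t]` of the step function that equals `e k` on the `k`-th cell of the
partition of `[0, T]` into `n` intervals of equal length. -/
noncomputable def gridIntegral (L : ℝ → Ω → EuclideanSpace ℝ (Fin d)) (T : ℝ) (n : ℕ)
    (e : ℕ → EuclideanSpace ℝ (Fin d)) (t : ℝ) (ω : Ω) : ℝ :=
  ∑ k ∈ Finset.range n,
    inner ℝ (e k) (L (min t ((k + 1 : ℕ) * (T / n))) ω - L (min t (k * (T / n))) ω)

section gridIntegral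

variable {T s t ε : ℝ} {n : ℕ} {e : ℕ → EuclideanSpace ℝ (Fin d)}

lemma apply_min_sub_apply_min {V : Type*} [AddCommGroup V] (f : ℝ → V) (hst : s ≤ t) (x : ℝ) :
    f (min t x) - f (min s x) = f (max s (min t x)) - f s := by
  rcases le_total x s with h | h
  · rw [min_eq_right (h.trans hst), min_eq_right h, max_eq_left h]; simp
  · rw [min_eq_left h, max_eq_right (le_min hst h)]

/-- An increment of the integral is the step sum over the partition clamped to `[s, t]`, so cells
outside become degenerate. -/
lemma gridIntegral_sub (hst : s ≤ t) (e : ℕ → EuclideanSpace ℝ (Fin d)) (ω : Ω) :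
    gridIntegral L T n e t ω - gridIntegral L T n e s ω =
      ∑ k ∈ Finset.range n, inner ℝ (e k) (L (max s (min t ((k + 1 : ℕ) * (T / n)))) ω -
        L (max s (min t (k * (T / n)))) ω) := by
  unfold gridIntegral
  rw [← Finset.sum_sub_distrib]
  refine Finset.sum_congr rfl fun k _ => ?_
  rw [← inner_sub_right]
  congr 1
  have h1 := apply_min_sub_apply_min (fun x => L x ω) hst ((k + 1 : ℕ) * (T / n))
  have h2 := apply_min_sub_apply_min (fun x => L x ω) hst (k * (T / n))
  rw [sub_sub_sub_comm, h1, h2, sub_sub_sub_cancel_right]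

lemma clamp_grid_zero (hs : 0 ≤ s) (hst : s ≤ t) :
    max s (min t ((0 : ℕ) * (T / n))) = s := by
  simp [hs.trans hst, hs]

lemma clamp_grid_last (hst : s ≤ t) (htT : t ≤ T) (hn : 0 < n) :
    max s (min t ((n : ℕ) * (T / n))) = t := by
  have : (n : ℝ) * (T / n) = T := by field_simp
  rw [this, min_eq_left htT, max_eq_right hst]

lemma monotone_clamp_grid (hT : 0 ≤ T) :
    Monotone fun k : ℕ => max s (min t ((k : ℝ) * (T / n))) := by
  intro i j hij
  have hij' : (i : ℝ) ≤ j := by exact_mod_cast hij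
  have : 0 ≤ T / (n : ℝ) := by positivity
  dsimp only
  gcongr

/-- Only the coefficients of cells that meet the interval in positive length enter the energy. -/
lemma stepLim_gridIntegral (hL : IsStableLevy P 𝓕 α L) (hs : 0 ≤ s) (hst : s ≤ t) (htT : t ≤ T)
    (hn : 0 < n) (hε : 0 ≤ ε)
    (he : ∀ k < n, max s (min t (k * (T / n))) < max s (min t ((k + 1 : ℕ) * (T / n))) →
      ‖e k‖ ≤ ε) :
    StepLim P L α univ s t (ENNReal.ofReal (ε ^ α * (t - s)))
      (fun ω => gridIntegral L T n e t ω - gridIntegral L T n e s ω) := by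
  have hα := hL.alpha_pos
  have hT : 0 ≤ T := hs.trans (hst.trans htT)
  set τ : ℕ → ℝ := fun k => max s (min t ((k : ℝ) * (T / n))) with hτ
  have hτm : Monotone τ := monotone_clamp_grid hT
  have h0 : τ 0 = s := clamp_grid_zero hs hst
  have hnt : τ n = t := clamp_grid_last hst htT hn
  have h := IsStepSum.of_monotone (L := L) (α := α) (Q := univ) hτm e n (fun _ _ _ => mem_univ _)
  rw [h0, hnt] at h
  have hE : ∑ k ∈ Finset.range n, ENNReal.ofReal (‖e k‖ ^ α * (τ (k + 1) - τ k)) ≤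
      ENNReal.ofReal (ε ^ α * (t - s)) := by
    rw [← h0, ← hnt, ← Finset.sum_range_sub, Finset.mul_sum, ENNReal.ofReal_sum_of_nonneg]
    · refine Finset.sum_le_sum fun k hk => ENNReal.ofReal_le_ofReal ?_
      rcases (hτm k.le_succ).eq_or_lt with h' | h'
      · simp only [Nat.succ_eq_add_one] at h'
        rw [h']; simp
      · have := he k (Finset.mem_range.1 hk) h'
        have := sub_nonneg.2 (hτm k.le_succ)
        simp only [Nat.succ_eq_add_one] at this
        gcongr
    · intro k _
      exact mul_nonneg (by positivity) (sub_nonneg.2 (hτm k.le_succ))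
  have := (StepLim.of_isStepSum hL hs h).mono hE subset_rfl
  refine this.congr (ae_of_all _ fun ω => ?_)
  simp only
  rw [gridIntegral_sub hst]

lemma gridIntegral_const (hst : s ≤ t) (hs : 0 ≤ s) (htT : t ≤ T) (hn : 0 < n)
    (e₀ : EuclideanSpace ℝ (Fin d)) (ω : Ω) :
    gridIntegral L T n (fun _ => e₀) t ω - gridIntegral L T n (fun _ => e₀) s ω =
      inner ℝ e₀ (L t ω - L s ω) := by
  rw [gridIntegral_sub hst, ← inner_sum]
  rw [Finset.sum_range_sub (fun k : ℕ => L (max s (min t (k * (T / n)))) ω),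
    clamp_grid_last hst htT hn, clamp_grid_zero hs hst]

lemma gridIntegral_sub_coeff (e e' : ℕ → EuclideanSpace ℝ (Fin d)) (ω : Ω) :
    gridIntegral L T n (fun k => e k - e' k) t ω =
      gridIntegral L T n e t ω - gridIntegral L T n e' t ω := by
  unfold gridIntegral
  simp_rw [inner_sub_left, Finset.sum_sub_distrib]

lemma gridIntegral_zero (hT : 0 ≤ T) (ω : Ω) : gridIntegral L T n e 0 ω = 0 := by
  refine Finset.sum_eq_zero fun k _ => ?_
  rw [min_eq_left (by positivity), min_eq_left (by positivity)]
  simp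

/-- The same step function written on a finer partition, the division `k / q` being that of natural
numbers. It allows two dyadic approximations to be subtracted. -/
lemma gridIntegral_refine {q : ℕ} (hq : 0 < q) (hn : 0 < n) (e : ℕ → EuclideanSpace ℝ (Fin d))
    (ω : Ω) : gridIntegral L T (n * q) (fun k => e (k / q)) t ω = gridIntegral L T n e t ω := by
  unfold gridIntegral
  set g : ℕ → EuclideanSpace ℝ (Fin d) := fun k => L (min t (k * (T / (n * q : ℕ)))) ω with hg
  have h1 : ∀ k : ℕ, L (min t (k * (T / n))) ω = g (k * q) := by
    intro k
    simp only [hg]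
    congr 2
    push_cast
    field_simp
  simp_rw [h1]
  have h2 : ∀ N : ℕ, ∑ k ∈ Finset.range (N * q), inner ℝ (e (k / q)) (g (k + 1) - g k) =
      ∑ k ∈ Finset.range N, inner ℝ (e k) (g ((k + 1) * q) - g (k * q)) := by
    intro N
    induction N with
    | zero => simp
    | succ N ih =>
      rw [Nat.succ_mul, Finset.sum_range_add, Finset.sum_range_succ, ih]
      congr 1
      have h3 := Finset.sum_range_sub (fun x => g (N * q + x)) q
      simp only [add_zero] at h3
      rw [Nat.succ_mul, ← h3, inner_sum]
      refine Finset.sum_congr rfl fun x hx => ?_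
      rw [mul_comm N q, Nat.mul_add_div hq, Nat.div_eq_of_lt (Finset.mem_range.1 hx), add_zero,
        add_assoc]
  exact h2 n

lemma measurable_gridIntegral (hL : IsStableLevy P 𝓕 α L) (hT : 0 ≤ T) (ht : 0 ≤ t) :
    Measurable[𝓕 t] (gridIntegral L T n e t) := by
  have : Measurable[𝓕 t] fun ω => ∑ k ∈ Finset.range n,
      inner ℝ (e k) (L (min t ((k + 1 : ℕ) * (T / n))) ω - L (min t (k * (T / n))) ω) := by
    refine Finset.measurable_fun_sum _ fun k _ => ?_
    have h4 : Measurable fun x : EuclideanSpace ℝ (Fin d) => (inner ℝ (e k) x : ℝ) := by fun_prop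
    have hLm : ∀ x : ℝ, 0 ≤ x → Measurable[𝓕 t] (L (min t x)) := fun x hx =>
      (hL.adapted _ (le_min ht hx)).mono (𝓕.mono (min_le_left _ _)) le_rfl
    exact h4.comp ((hLm _ (by positivity)).sub (hLm _ (by positivity)))
  exact this

lemma cadlagOn_gridIntegral (hT : 0 ≤ T) {ω : Ω}
    (h : CadlagOn (fun t => L t ω) (Ici 0)) :
    CadlagOn (fun t => gridIntegral L T n e t ω) (Icc 0 T) := by
  refine CadlagOn.sum _ fun k _ => CadlagOn.comp_continuous
    (φ := fun x : EuclideanSpace ℝ (Fin d) => (inner ℝ (e k) x : ℝ)) (by fun_prop) ?_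
  have hc : ∀ x : ℝ, 0 ≤ x → CadlagOn (fun t => L (min t x) ω) (Icc 0 T) := fun x hx =>
    h.comp_monotone (g := fun t => min t x) (fun _ _ h => min_le_min_right _ h) (by fun_prop)
      fun t ht => le_min ht.1 hx
  exact (hc _ (by positivity)).sub (hc _ (by positivity))

/-- A maximal inequality that is uniform over the partitions: small coefficients give a small
energy, hence small tails for all increments up to `T`. Ottaviani's inequality on dyadic times
followed by right-continuity of the paths bounds the whole supremum. -/
lemma measure_exists_lt_abs_gridIntegral_le (hL : IsStableLevy P 𝓕 α L) (hT : 0 < T) {δ : ℝ}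
    (hδ : 0 < δ) : ∃ ε : ℝ, 0 < ε ∧ ∀ (n : ℕ) (e : ℕ → EuclideanSpace ℝ (Fin d)), 0 < n →
      (∀ k < n, ‖e k‖ ≤ ε) →
      P {ω | ∃ t ∈ Icc 0 T, δ < |gridIntegral L T n e t ω|} ≤ ENNReal.ofReal δ := by
  have hα := hL.alpha_pos
  obtain ⟨C, hC0, hC⟩ := hL.exists_norm_one_sub_charFun_le
  set A : ℝ := 2 * (2 / (δ / 2)) ^ α * (C * T) with hA
  have hA0 : 0 ≤ A := by positivity
  -- The bound `1/2` yields the hypothesis of Ottaviani's inequality and `δ/2` absorbs the factor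
  -- `2` in its conclusion.
  obtain ⟨ε, hε, hεA⟩ : ∃ ε : ℝ, 0 < ε ∧ A * ε ^ α ≤ min (1 / 2) (δ / 2) := by
    have h1 : Tendsto (fun ε : ℝ => A * ε ^ α) (𝓝[>] 0) (𝓝 (A * 0 ^ α)) :=
      (((Real.continuous_rpow_const hα.le).tendsto 0).const_mul A).mono_left nhdsWithin_le_nhds
    rw [Real.zero_rpow hα.ne', mul_zero] at h1
    have h2 := h1.eventually (gt_mem_nhds (show 0 < min (1 / 2) (δ / 2) by positivity))
    obtain ⟨ε, h3, h4⟩ := (h2.and self_mem_nhdsWithin).exists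
    exact ⟨ε, h4, h3.le⟩
  refine ⟨ε, hε, fun n e hn he => ?_⟩
  set D := gridIntegral L T n e with hD
  have hstep : ∀ s ∈ Icc 0 T, StepLim P L α univ s T (ENNReal.ofReal (ε ^ α * (T - s)))
      (fun ω => D T ω - D s ω) := fun s hs =>
    stepLim_gridIntegral hL hs.1 hs.2 le_rfl hn hε.le fun k hk _ => he k hk
  have htail : ∀ s ∈ Icc 0 T, P.real {ω | δ / 2 < |D T ω - D s ω|} ≤ A * ε ^ α := by
    intro s hs
    refine (measureReal_lt_abs_le (hstep s hs).1 hα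
      ((hstep s hs).norm_one_sub_le hL hs.1 hC0 hC (by simp)) (by positivity)).trans ?_
    rw [ENNReal.toReal_ofReal (mul_nonneg (by positivity) (sub_nonneg.2 hs.2))]
    calc 2 * (2 / (δ / 2)) ^ α * (C * (ε ^ α * (T - s)))
        ≤ 2 * (2 / (δ / 2)) ^ α * (C * (ε ^ α * T)) := by gcongr; linarith [hs.1]
      _ = A * ε ^ α := by rw [hA]; ring
  have hDm : ∀ s, 0 ≤ s → Measurable (D s) := fun s hs =>
    (measurable_gridIntegral hL hT.le hs).mono (𝓕.le s) le_rfl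
  have hfin : ∀ N : ℕ, 0 < N →
      P {ω | ∃ k ≤ N, δ < |D (k * (T / N)) ω|} ≤ ENNReal.ofReal δ := by
    intro N hN
    have hNT : (N : ℝ) * (T / N) = T := by field_simp
    have hmem : ∀ k : ℕ, k ≤ N → (k : ℝ) * (T / N) ∈ Icc 0 T := fun k hk => by
      have hk' : (k : ℝ) ≤ N := by exact_mod_cast hk
      refine ⟨by positivity, ?_⟩
      calc (k : ℝ) * (T / N) ≤ N * (T / N) := by gcongr
        _ = T := hNT
    have hott := measure_exists_lt_abs_le (P := P) (N := N) (lam := δ / 2)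
      (D := fun k : ℕ => D (k * (T / N))) (m := fun k : ℕ => 𝓕 (k * (T / N)))
      (fun i j hij => 𝓕.mono (by gcongr)) (fun k => 𝓕.le _)
      (fun k _ => measurable_gridIntegral hL hT.le (by positivity)) ?_ ?_
    · simp only [mul_div_cancel₀ δ (two_ne_zero' ℝ), hNT] at hott
      refine hott.trans ?_
      have h1 := htail 0 ⟨le_rfl, hT.le⟩
      simp only [hD, gridIntegral_zero hT.le, sub_zero] at h1
      calc 2 * P {ω | δ / 2 < |D T ω|}
          = ENNReal.ofReal (2 * P.real {ω | δ / 2 < |D T ω|}) := by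
            rw [ENNReal.ofReal_mul (by norm_num), ofReal_measureReal]; simp
        _ ≤ ENNReal.ofReal δ := by
            refine ENNReal.ofReal_le_ofReal ?_
            have := h1.trans (hεA.trans (min_le_right _ _))
            linarith
    · intro k hk B hB
      simp only [hNT]
      exact (hstep _ (hmem k hk)).measure_inter hL (hmem k hk).1 hB (B := {x | |x| ≤ δ / 2})
        (measurable_norm measurableSet_Iic)
    · intro k hk
      simp only [hNT]
      have h1 := htail _ (hmem k hk)
      have hms : MeasurableSet {ω | δ / 2 < |D T ω - D (k * (T / N)) ω|} :=
        (measurable_norm.comp ((hDm T hT.le).sub (hDm _ (hmem k hk).1))) measurableSet_Ioi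
      have h2 : {ω | |D T ω - D (k * (T / N)) ω| ≤ δ / 2} =
          {ω | δ / 2 < |D T ω - D (k * (T / N)) ω|}ᶜ := by ext ω; simp
      rw [h2, ← ofReal_measureReal, probReal_compl_eq_one_sub hms,
        show (2⁻¹ : ℝ≥0∞) = ENNReal.ofReal (1 / 2) by
          rw [one_div, ENNReal.ofReal_inv_of_pos two_pos]; simp]
      refine ENNReal.ofReal_le_ofReal ?_
      have := h1.trans (hεA.trans (min_le_left _ _))
      linarith
  -- The dyadic grids are nested, so the exceedance events increase and continuity from below
  -- applies to their union.
  have hmono : Monotone fun j : ℕ =>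
      {ω | ∃ k : ℕ, k ≤ 2 ^ j ∧ δ < |D (k * (T / (2 ^ j : ℕ))) ω|} := by
    refine monotone_nat_of_le_succ fun j ω => ?_
    rintro ⟨k, hk, h⟩
    refine ⟨k * 2, by rw [pow_succ]; omega, ?_⟩
    have h1 : ((k * 2 : ℕ) : ℝ) * (T / (2 ^ (j + 1) : ℕ)) = k * (T / (2 ^ j : ℕ)) := by
      push_cast
      rw [pow_succ]
      field_simp
    rwa [h1]
  calc P {ω | ∃ t ∈ Icc 0 T, δ < |D t ω|}
      ≤ P (⋃ j : ℕ, {ω | ∃ k : ℕ, k ≤ 2 ^ j ∧ δ < |D (k * (T / (2 ^ j : ℕ))) ω|}) := by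
        refine measure_mono_ae ?_
        filter_upwards [hL.cadlag] with ω hω hex
        obtain ⟨t, ht, h⟩ := hex
        by_contra hcon
        replace hcon : ω ∉ ⋃ j : ℕ, {ω | ∃ k : ℕ, k ≤ 2 ^ j ∧ δ <
          |D (k * (T / (2 ^ j : ℕ))) ω|} := hcon
        simp only [mem_iUnion, mem_ofPred_eq, not_exists, not_and, not_lt] at hcon
        have := (cadlagOn_gridIntegral (n := n) (e := e) hT.le hω).mem_of_dyadic
          (S := {x | |x| ≤ δ}) (isClosed_le continuous_abs continuous_const) ?_ ht
        · exact absurd h (not_lt.2 this)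
        · intro j k hk
          have := hcon j k hk
          simpa using this
    _ = ⨆ j : ℕ, P {ω | ∃ k : ℕ, k ≤ 2 ^ j ∧ δ < |D (k * (T / (2 ^ j : ℕ))) ω|} :=
        hmono.measure_iUnion
    _ ≤ ENNReal.ofReal δ := iSup_le fun j => hfin (2 ^ j) (by positivity)

end gridIntegral

/-- `I` is an integral process `I_t = ∫₀ᵗ ⟨h, dL⟩`, `t ∈ [0, T]`, of the deterministic function
`h`, characterised by the fact that over a short interval it is close to the increments of `L`
multiplied by a nearby value of `h`. -/
structure IsDetIntegral (P : Measure Ω) (L : ℝ → Ω → EuclideanSpace ℝ (Fin d)) (α T : ℝ)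
    (h : ℝ → EuclideanSpace ℝ (Fin d)) (I : ℝ → Ω → ℝ) : Prop where
  cadlag : ∀ᵐ ω ∂P, CadlagOn (fun t => I t ω) (Icc 0 T)
  aemeasurable : ∀ t ∈ Icc 0 T, AEMeasurable (I t) P
  stepLim : ∀ (s t : ℝ) (e₀ : EuclideanSpace ℝ (Fin d)) (ε δ : ℝ), 0 ≤ s → s ≤ t → t ≤ T →
    0 ≤ ε → 0 < δ → (∀ v ∈ Icc (s - δ) t, ‖h v - e₀‖ ≤ ε) →
    StepLim P L α univ s t (ENNReal.ofReal (ε ^ α * (t - s)))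
      (fun ω => I t ω - I s ω - inner ℝ e₀ (L t ω - L s ω))

/-- Along a fast subsequence, successive dyadic step integrals differ uniformly by at most `2^(-j)`
outside an event of probability `2^(-j)`. By Borel–Cantelli they converge uniformly almost surely,
so the limit inherits càdlàg paths. -/
theorem exists_isDetIntegral (hL : IsStableLevy P 𝓕 α L) {T : ℝ} (hT : 0 < T)
    {h : ℝ → EuclideanSpace ℝ (Fin d)} (hh : UniformContinuous h) :
    ∃ I, IsDetIntegral P L α T h I := by
  set Z : ℕ → ℝ → Ω → ℝ := fun m => gridIntegral L T (2 ^ m) (fun k => h (k * (T / (2 ^ m : ℕ))))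
    with hZ
  have hmesh : Tendsto (fun m : ℕ => T / ((2 ^ m : ℕ) : ℝ)) atTop (𝓝 0) :=
    (tendsto_const_div_atTop_nhds_zero_nat T).comp
      (tendsto_pow_atTop_atTop_of_one_lt (r := 2) (by norm_num))
  have hclose : ∀ j : ℕ, ∀ᶠ m in atTop, ∀ m' ≥ m,
      P {ω | ∃ t ∈ Icc 0 T, (1 / 2 : ℝ) ^ j < |Z m' t ω - Z m t ω|} ≤
        ENNReal.ofReal ((1 / 2 : ℝ) ^ j) := by
    intro j
    obtain ⟨ε, hε, H⟩ := measure_exists_lt_abs_gridIntegral_le hL hT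
      (show (0 : ℝ) < (1 / 2) ^ j by positivity)
    obtain ⟨δ, hδ, hu⟩ := Metric.uniformContinuous_iff.1 hh ε hε
    filter_upwards [hmesh.eventually (gt_mem_nhds hδ)] with m hm m' hm'
    obtain ⟨i, rfl⟩ := Nat.exists_eq_add_of_le hm'
    have hsub : ∀ t ω, Z (m + i) t ω - Z m t ω = gridIntegral L T (2 ^ (m + i))
        (fun k => h (k * (T / (2 ^ (m + i) : ℕ))) -
          h ((k / 2 ^ i : ℕ) * (T / (2 ^ m : ℕ)))) t ω := by
      intro t ω
      rw [gridIntegral_sub_coeff]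
      congr 1
      have := gridIntegral_refine (L := L) (T := T) (t := t) (n := 2 ^ m) (q := 2 ^ i)
        (by positivity) (by positivity) (fun k => h (k * (T / (2 ^ m : ℕ)))) ω
      rw [← pow_add] at this
      exact this.symm
    simp_rw [hsub]
    -- The value of `h` at a fine grid point is compared with its value at the left end of the
    -- coarse cell containing that point; the two points are less than one coarse mesh apart.
    refine H _ _ (by positivity) fun k _ => ?_
    rw [← dist_eq_norm]
    refine (hu ?_).le
    rw [Real.dist_eq]
    have hpi : (0 : ℝ) < 2 ^ i := by positivity
    have hpm : (0 : ℝ) < 2 ^ m := by positivity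
    have h1 : (k : ℝ) * (T / (2 ^ (m + i) : ℕ)) = (k / 2 ^ i : ℝ) * (T / (2 ^ m : ℕ)) := by
      push_cast; rw [pow_add]; field_simp
    have h2 : ((k / 2 ^ i : ℕ) : ℝ) ≤ (k / 2 ^ i : ℝ) := by
      have := Nat.cast_div_le (α := ℝ) (m := k) (n := 2 ^ i)
      push_cast at this
      exact this
    have h3 : (k / 2 ^ i : ℝ) < ((k / 2 ^ i : ℕ) : ℝ) + 1 := by
      rw [div_lt_iff₀ hpi]
      have := Nat.lt_div_mul_add (a := k) (b := 2 ^ i) (by positivity)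
      rw [← Nat.succ_mul] at this
      exact_mod_cast this
    have hm0 : 0 < T / ((2 ^ m : ℕ) : ℝ) := by positivity
    rw [h1, ← sub_mul, abs_mul, abs_of_nonneg (sub_nonneg.2 h2), abs_of_pos hm0]
    nlinarith
  obtain ⟨φ, hφ, hφc⟩ := extraction_forall_of_eventually hclose
  have hBC : ∀ᵐ ω ∂P, ∀ᶠ j in atTop, ∀ t ∈ Icc 0 T,
      |Z (φ (j + 1)) t ω - Z (φ j) t ω| ≤ (1 / 2 : ℝ) ^ j := by
    have hsum : ∑' j : ℕ, P {ω | ∃ t ∈ Icc 0 T, (1 / 2 : ℝ) ^ j <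
        |Z (φ (j + 1)) t ω - Z (φ j) t ω|} ≠ ⊤ := by
      refine ne_top_of_le_ne_top (b := ∑' j : ℕ, ENNReal.ofReal ((1 / 2 : ℝ) ^ j)) ?_
        (ENNReal.tsum_le_tsum fun j => hφc j _ (hφ.monotone j.le_succ))
      rw [← ENNReal.ofReal_tsum_of_nonneg (fun j => by positivity)
        (summable_geometric_of_lt_one (by norm_num) (by norm_num))]
      simp
    filter_upwards [ae_eventually_notMem hsum] with ω hω
    filter_upwards [hω] with j hj t ht
    by_contra hcon
    exact hj ⟨t, ht, not_le.1 hcon⟩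
  set I : ℝ → Ω → ℝ := fun t ω => limUnder atTop fun j => Z (φ j) t ω with hI
  have hunif : ∀ᵐ ω ∂P, TendstoUniformlyOn (fun j t => Z (φ j) t ω) (fun t => I t ω) atTop
      (Icc 0 T) := by
    filter_upwards [hBC] with ω hω
    obtain ⟨J, hJ⟩ := eventually_atTop.1 hω
    have hgeo : ∀ t ∈ Icc 0 T, ∀ i : ℕ, dist (Z (φ (i + J)) t ω) (Z (φ (i + 1 + J)) t ω) ≤
        (1 / 2 : ℝ) ^ J * (1 / 2) ^ i := by
      intro t ht i
      rw [dist_comm, Real.dist_eq, show i + 1 + J = i + J + 1 by ring]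
      refine (hJ (i + J) (by omega) t ht).trans_eq ?_
      rw [pow_add]; ring
    have hlim : ∀ t ∈ Icc 0 T, Tendsto (fun j => Z (φ j) t ω) atTop (𝓝 (I t ω)) := by
      intro t ht
      have hc : CauchySeq fun j => Z (φ (j + J)) t ω :=
        cauchySeq_of_le_geometric _ _ (by norm_num) (hgeo t ht)
      obtain ⟨x, hx⟩ := cauchySeq_tendsto_of_complete hc
      rw [tendsto_add_atTop_iff_nat (f := fun j => Z (φ j) t ω) J] at hx
      exact tendsto_nhds_limUnder ⟨x, hx⟩
    rw [Metric.tendstoUniformlyOn_iff]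
    intro ε hε
    have h0 : Tendsto (fun i : ℕ => (1 / 2 : ℝ) ^ J * (1 / 2) ^ i / (1 - 1 / 2)) atTop (𝓝 0) := by
      have := ((tendsto_pow_atTop_nhds_zero_of_lt_one (r := (1 / 2 : ℝ)) (by norm_num)
        (by norm_num)).const_mul ((1 / 2 : ℝ) ^ J)).div_const (1 - 1 / 2)
      simpa using this
    obtain ⟨i₀, hi₀⟩ := eventually_atTop.1 (h0.eventually (gt_mem_nhds hε))
    filter_upwards [eventually_ge_atTop (i₀ + J)] with j hj t ht
    obtain ⟨i, rfl⟩ := Nat.exists_eq_add_of_le hj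
    have := dist_le_of_le_geometric_of_tendsto (1 / 2) ((1 / 2 : ℝ) ^ J) (by norm_num) (hgeo t ht)
      ((tendsto_add_atTop_iff_nat (f := fun j => Z (φ j) t ω) J).2 (hlim t ht)) (i₀ + i)
    rw [dist_comm, show i₀ + J + i = i₀ + i + J by ring]
    exact this.trans_lt (hi₀ _ (by omega))
  have hZm : ∀ m t, 0 ≤ t → Measurable (Z m t) := fun m t ht =>
    (measurable_gridIntegral hL hT.le ht).mono (𝓕.le t) le_rfl
  have hpt : ∀ t ∈ Icc 0 T, ∀ᵐ ω ∂P, Tendsto (fun j => Z (φ j) t ω) atTop (𝓝 (I t ω)) := by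
    intro t ht
    filter_upwards [hunif] with ω hω using hω.tendsto_at ht
  have hIm : ∀ t ∈ Icc 0 T, AEMeasurable (I t) P := fun t ht =>
    aemeasurable_of_tendsto_metrizable_ae atTop (fun j => (hZm _ t ht.1).aemeasurable) (hpt t ht)
  refine ⟨I, ?_, hIm, ?_⟩
  · filter_upwards [hunif, hL.cadlag] with ω hω hc
    exact CadlagOn.of_uniform_limit (fun j => cadlagOn_gridIntegral hT.le hc) hω
  · intro s t e₀ ε δ hs hst htT hε hδ hv
    have ht : t ∈ Icc 0 T := ⟨hs.trans hst, htT⟩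
    have hs' : s ∈ Icc 0 T := ⟨hs, hst.trans htT⟩
    have hLm : AEMeasurable (fun ω => (inner ℝ e₀ (L t ω - L s ω) : ℝ)) P := by
      have := ((hL.measurable_at ht.1).sub (hL.measurable_at hs))
      have h4 : Measurable fun x : EuclideanSpace ℝ (Fin d) => (inner ℝ e₀ x : ℝ) := by fun_prop
      exact (h4.comp this).aemeasurable
    refine StepLim.of_tendstoInMeasure (X' := fun j ω =>
      Z (φ j) t ω - Z (φ j) s ω - inner ℝ e₀ (L t ω - L s ω)) ?_
      (((hIm t ht).sub (hIm s hs')).sub hLm) ?_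
    · have hev := (hmesh.comp hφ.tendsto_atTop).eventually (gt_mem_nhds hδ)
      filter_upwards [hev] with j hj
      simp only [Function.comp_apply] at hj
      have := stepLim_gridIntegral (n := 2 ^ φ j) (ε := ε)
        (e := fun k => h (k * (T / (2 ^ φ j : ℕ))) - e₀) hL hs hst htT (by positivity) hε ?_
      · refine this.congr (ae_of_all _ fun ω => ?_)
        simp only
        rw [gridIntegral_sub_coeff, gridIntegral_sub_coeff,
          ← gridIntegral_const (n := 2 ^ φ j) hst hs htT (by positivity) e₀ ω]
        ring
      -- A cell that meets `[s, t]` nontrivially starts no earlier than one mesh before `s` and no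
      -- later than `t`. This is why the hypothesis on `h` reaches back to `s - δ`.
      · intro k hk hlt
        refine hv _ ⟨?_, ?_⟩
        · by_contra! hcon
          have h1 : ((k + 1 : ℕ) : ℝ) * (T / (2 ^ φ j : ℕ)) ≤ s := by
            push_cast at hcon hj ⊢
            linarith
          rw [max_eq_left ((min_le_right _ _).trans h1)] at hlt
          exact absurd hlt (not_lt.2 (le_max_left _ _))
        · by_contra! hcon
          rw [min_eq_left hcon.le, max_eq_right hst] at hlt
          exact absurd hlt (not_lt.2 (max_le hst (min_le_left _ _)))
    · refine tendstoInMeasure_of_tendsto_ae (fun j => ?_) ?_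
      · exact ((((hZm _ t ht.1).sub (hZm _ s hs)).aemeasurable).sub hLm).aestronglyMeasurable
      · filter_upwards [hpt t ht, hpt s hs'] with ω h1 h2
        exact (h1.sub h2).sub_const _

end

section

/-! ### Algebra of convergence in measure -/

section inMeasure

variable {Ω : Type*} {mΩ : MeasurableSpace Ω} {P : Measure Ω} [IsProbabilityMeasure P]
  {f f' : ℕ → Ω → ℝ} {g g' : Ω → ℝ}

lemma tendstoInMeasure_add (hf : ∀ n, AEStronglyMeasurable (f n) P)
    (hf' : ∀ n, AEStronglyMeasurable (f' n) P) (h : TendstoInMeasure P f atTop g)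
    (h' : TendstoInMeasure P f' atTop g') :
    TendstoInMeasure P (fun n ω => f n ω + f' n ω) atTop (fun ω => g ω + g' ω) := by
  refine (exists_seq_tendstoInMeasure_atTop_iff fun n => (hf n).add (hf' n)).2 ?_
  intro ns hns
  obtain ⟨ns', hns', h1⟩ := (h.comp hns.tendsto_atTop).exists_seq_tendsto_ae
  obtain ⟨ns'', hns'', h2⟩ :=
    (h'.comp (hns.comp hns').tendsto_atTop).exists_seq_tendsto_ae
  refine ⟨ns' ∘ ns'', hns'.comp hns'', ?_⟩
  filter_upwards [h1, h2] with ω hω1 hω2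
  exact (hω1.comp hns''.tendsto_atTop).add hω2

lemma tendstoInMeasure_mul_left {c : Ω → ℝ} (hc : AEStronglyMeasurable c P)
    (hf : ∀ n, AEStronglyMeasurable (f n) P) (h : TendstoInMeasure P f atTop g) :
    TendstoInMeasure P (fun n ω => c ω * f n ω) atTop (fun ω => c ω * g ω) := by
  refine (exists_seq_tendstoInMeasure_atTop_iff fun n => hc.mul (hf n)).2 ?_
  intro ns hns
  obtain ⟨ns', hns', h1⟩ := (h.comp hns.tendsto_atTop).exists_seq_tendsto_ae
  refine ⟨ns', hns', ?_⟩
  filter_upwards [h1] with ω hω1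
  exact hω1.const_mul _

lemma tendstoInMeasure_sum {ι : Type*} (u : Finset ι) {f : ι → ℕ → Ω → ℝ} {g : ι → Ω → ℝ}
    (hf : ∀ i n, AEStronglyMeasurable (f i n) P)
    (h : ∀ i ∈ u, TendstoInMeasure P (f i) atTop (g i)) :
    TendstoInMeasure P (fun n ω => ∑ i ∈ u, f i n ω) atTop (fun ω => ∑ i ∈ u, g i ω) := by
  classical
  induction u using Finset.induction_on with
  | empty =>
    simp only [Finset.sum_empty]
    exact tendstoInMeasure_of_tendsto_ae (fun _ => aestronglyMeasurable_const)
      (ae_of_all _ fun _ => tendsto_const_nhds)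
  | insert i u hi ih =>
    simp_rw [Finset.sum_insert hi]
    exact tendstoInMeasure_add (hf i)
      (fun n => Finset.aestronglyMeasurable_fun_sum _ fun j _ => hf j n) (h i (by simp))
      (ih fun j hj => h j (by simp [hj]))

end inMeasure

variable {Ω : Type*} {mΩ : MeasurableSpace Ω} {P : Measure Ω} [IsProbabilityMeasure P] {d : ℕ}
  {𝓕 : Filtration ℝ mΩ} {α : ℝ} {L : ℝ → Ω → EuclideanSpace ℝ (Fin d)}
  {Q : Set (EuclideanSpace ℝ (Fin d))} {a b c : ℝ} {κ κ' : ℝ≥0∞} {X Y Y' : Ω → ℝ}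

namespace StepLim

/-- A single increment with coefficient `0`; it pads a step limit so that its interval covers a
whole cell. -/
lemma zero (hL : IsStableLevy P 𝓕 α L) (ha : 0 ≤ a) (hab : a ≤ b) :
    StepLim P L α univ a b 0 (fun _ => 0) := by
  have h := IsStepSum.nil (L := L) (α := α) (Q := univ) (a := a) |>.snoc hab (mem_univ 0)
  refine ((of_isStepSum hL ha h).mono ?_ subset_rfl).congr (ae_of_all _ fun ω => ?_)
  · simp [Real.zero_rpow hL.alpha_pos.ne']
  · simp

lemma sum (hL : IsStableLevy P 𝓕 α L) {τ : ℕ → ℝ} (h0 : 0 ≤ τ 0) {κ : ℕ → ℝ≥0∞}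
    {X : ℕ → Ω → ℝ} (n : ℕ) (h : ∀ k < n, StepLim P L α Q (τ k) (τ (k + 1)) (κ k) (X k)) :
    StepLim P L α Q (τ 0) (τ n) (∑ k ∈ Finset.range n, κ k)
      (fun ω => ∑ k ∈ Finset.range n, X k ω) := by
  induction n with
  | zero => simpa using of_isStepSum hL h0 IsStepSum.nil
  | succ n ih =>
    simp_rw [Finset.sum_range_succ]
    exact (ih fun k hk => h k (by omega)).trans (h n (by omega))

end StepLim

/-! ### Riemann sums converge to the integral -/

namespace IsDetIntegral

variable {T : ℝ} {h : ℝ → EuclideanSpace ℝ (Fin d)} {I : ℝ → Ω → ℝ}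

lemma aestronglyMeasurable_riemann (hL : IsStableLevy P 𝓕 α L) {t : ℝ} (ha : 0 ≤ a)
    (hat : a ≤ t) (p : ℝ → Prop) [DecidablePred p] (h : ℝ → EuclideanSpace ℝ (Fin d)) (m : ℕ) :
    AEStronglyMeasurable (fun ω => ∑ j ∈ Finset.range m,
      if p (a + j * ((t - a) / m)) then inner ℝ (h (a + j * ((t - a) / m)))
        (L (a + (j + 1) * ((t - a) / m)) ω - L (a + j * ((t - a) / m)) ω) else 0) P := by
  have hta : 0 ≤ t - a := sub_nonneg.2 hat
  refine Finset.aestronglyMeasurable_fun_sum _ fun j _ => ?_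
  split_ifs with hp
  · have h4 : Measurable fun x : EuclideanSpace ℝ (Fin d) =>
      (inner ℝ (h (a + j * ((t - a) / m))) x : ℝ) := by fun_prop
    exact (h4.comp ((hL.measurable_at (by positivity)).sub
      (hL.measurable_at (by positivity)))).aestronglyMeasurable
  · exact aestronglyMeasurable_const

/-- Cells beyond the cut-off `c` have small error energy by uniform continuity of `h`, cells before
it contribute to neither side, and at most one cell contains `c`; its energy vanishes with the mesh
because `h` is bounded. -/
lemma tendsto_riemann_lt (hL : IsStableLevy P 𝓕 α L) (hI : IsDetIntegral P L α T h I)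
    (hh : UniformContinuous h) {C : ℝ} (hC : ∀ s, ‖h s‖ ≤ C) {t : ℝ} (ha : 0 ≤ a) (hat : a ≤ t)
    (htT : t ≤ T) (c : ℝ) :
    TendstoInMeasure P (fun m ω => ∑ j ∈ Finset.range m,
      if c < a + j * ((t - a) / m) then inner ℝ (h (a + j * ((t - a) / m)))
        (L (a + (j + 1) * ((t - a) / m)) ω - L (a + j * ((t - a) / m)) ω) else 0) atTop
      (fun ω => I t ω - I (max a (min t c)) ω) := by
  have hα := hL.alpha_pos
  have hC0 : 0 ≤ C := (norm_nonneg _).trans (hC 0)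
  have hta : 0 ≤ t - a := sub_nonneg.2 hat
  set R : ℕ → Ω → ℝ := fun m ω => ∑ j ∈ Finset.range m,
      if c < a + j * ((t - a) / m) then inner ℝ (h (a + j * ((t - a) / m)))
        (L (a + (j + 1) * ((t - a) / m)) ω - L (a + j * ((t - a) / m)) ω) else 0 with hR
  set J : Ω → ℝ := fun ω => I t ω - I (max a (min t c)) ω with hJ
  have hRm : ∀ m, AEStronglyMeasurable (R m) P := fun m =>
    aestronglyMeasurable_riemann hL ha hat (fun s => c < s) h m
  have hJm : AEStronglyMeasurable J P :=
    ((hI.aemeasurable t ⟨ha.trans hat, htT⟩).sub (hI.aemeasurable _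
      ⟨ha.trans (le_max_left _ _), max_le (hat.trans htT)
        ((min_le_left _ _).trans htT)⟩)).aestronglyMeasurable
  suffices hmain : TendstoInMeasure P (fun m ω => J ω - R m ω) atTop (fun _ => 0) by
    have h1 := tendstoInMeasure_mul_left (c := fun _ => -1) aestronglyMeasurable_const
      (fun m => hJm.sub (hRm m)) hmain
    have h2 := tendstoInMeasure_add (f := fun _ => J) (g := J) (fun _ => hJm)
      (fun m => (hJm.sub (hRm m)).const_mul (-1))
      (tendstoInMeasure_of_tendsto_ae (fun _ => hJm) (ae_of_all _ fun _ => tendsto_const_nhds)) h1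
    refine (h2.congr (fun m => ae_of_all _ fun ω => ?_) (ae_of_all _ fun ω => ?_))
    · change J ω + -1 * (J ω - R m ω) = R m ω
      ring
    · ring
  refine StepLim.tendstoInMeasure_zero (Q := univ) hL fun η hη => ?_
  -- Half of the budget `η` goes to the oscillation of `h`, the other half to the cell containing
  -- `c`.
  obtain ⟨ε, hε, hεη⟩ : ∃ ε : ℝ, 0 < ε ∧ ε ^ α * (t - a) ≤ η / 2 := by
    have h1 : Tendsto (fun ε : ℝ => ε ^ α * (t - a)) (𝓝[>] 0) (𝓝 (0 ^ α * (t - a))) :=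
      (((Real.continuous_rpow_const hα.le).tendsto 0).mul_const (t - a)).mono_left
        nhdsWithin_le_nhds
    rw [Real.zero_rpow hα.ne', zero_mul] at h1
    obtain ⟨ε, h3, h4⟩ :=
      ((h1.eventually (gt_mem_nhds (half_pos hη))).and self_mem_nhdsWithin).exists
    exact ⟨ε, h4, h3.le⟩
  obtain ⟨δ, hδ, hu⟩ := Metric.uniformContinuous_iff.1 hh ε hε
  have hmesh : Tendsto (fun m : ℕ => (t - a) / (m : ℝ)) atTop (𝓝 0) :=
    tendsto_const_div_atTop_nhds_zero_nat _
  have hmesh' : Tendsto (fun m : ℕ => C ^ α * ((t - a) / (m : ℝ))) atTop (𝓝 0) := by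
    simpa using hmesh.const_mul (C ^ α)
  filter_upwards [eventually_gt_atTop 0, hmesh.eventually (gt_mem_nhds (half_pos hδ)),
    hmesh'.eventually (gt_mem_nhds (half_pos hη))] with m hm hm1 hm2
  refine ⟨a, t, ha, ?_⟩
  have hm' : (0 : ℝ) < m := by exact_mod_cast hm
  set w : ℝ := (t - a) / m with hw
  have hw0 : 0 ≤ w := by positivity
  set τ : ℕ → ℝ := fun j => a + j * w with hτ
  have hτs : ∀ j : ℕ, a + ((j : ℝ) + 1) * w = τ (j + 1) := fun j => by simp [hτ]
  have hτle : ∀ j, τ j ≤ τ (j + 1) := fun j => by simp only [hτ]; push_cast; nlinarith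
  have hτm : Monotone τ := monotone_nat_of_le_succ hτle
  have hτw : ∀ j, τ (j + 1) - τ j = w := fun j => by simp only [hτ]; push_cast; ring
  have h0 : τ 0 = a := by simp [hτ]
  have hmt : τ m = t := by simp only [hτ, hw]; field_simp; ring
  have haτ : ∀ j, a ≤ τ j := fun j => h0 ▸ hτm (Nat.zero_le j)
  have hτT : ∀ j < m, τ (j + 1) ≤ T := fun j hj => (hmt ▸ hτm (Nat.succ_le_of_lt hj)).trans htT
  set G : ℝ → Ω → ℝ := fun x ω => I x ω - I (max a (min x c)) ω with hG
  have hcell : ∀ j < m, StepLim P L α univ (τ j) (τ (j + 1))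
      (ENNReal.ofReal (ε ^ α * w) +
        if τ j ≤ c ∧ c < τ (j + 1) then ENNReal.ofReal (C ^ α * w) else 0)
      (fun ω => G (τ (j + 1)) ω - G (τ j) ω -
        if c < τ j then inner ℝ (h (τ j)) (L (τ (j + 1)) ω - L (τ j) ω) else 0) := by
    intro j hj
    have hτ0 : 0 ≤ τ j := ha.trans (haτ j)
    rcases lt_or_ge c (τ j) with h1 | h1
    · simp only [h1, if_true]
      have h2 : ¬ (τ j ≤ c ∧ c < τ (j + 1)) := fun h => absurd h.1 (not_le.2 h1)
      have h3 := hI.stepLim (τ j) (τ (j + 1)) (h (τ j)) ε (δ / 2) hτ0 (hτle j) (hτT j hj) hε.le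
        (half_pos hδ) fun v hv => by
          rw [← dist_eq_norm]
          refine (hu ?_).le
          rw [Real.dist_eq, abs_lt]
          constructor
          · linarith [hv.1]
          · linarith [hv.2, hτw j]
      rw [hτw] at h3
      refine (h3.mono le_self_add subset_rfl).congr (ae_of_all _ fun ω => ?_)
      simp only [hG]
      rw [min_eq_right h1.le, min_eq_right (h1.le.trans (hτle j))]
      ring
    · simp only [not_lt.2 h1, if_false, sub_zero]
      have hGj : ∀ ω, G (τ j) ω = 0 := fun ω => by
        simp only [hG]
        rw [min_eq_left h1, max_eq_right (haτ j), sub_self]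
      rcases lt_or_ge c (τ (j + 1)) with h2 | h2
      · simp only [h1, h2, and_self, if_true]
        have h3 := hI.stepLim c (τ (j + 1)) 0 C 1 (hτ0.trans h1) h2.le (hτT j hj) hC0 one_pos
          fun v _ => by simpa using hC v
        have h4 := (StepLim.zero hL hτ0 h1).trans h3
        refine (h4.mono ?_ subset_rfl).congr (ae_of_all _ fun ω => ?_)
        · rw [zero_add]
          refine le_trans (ENNReal.ofReal_le_ofReal ?_) le_add_self
          have := hτw j
          gcongr
          linarith
        · simp only [hGj]
          simp only [hG]
          rw [min_eq_right h2.le, max_eq_right ((haτ j).trans h1)]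
          simp
      · refine ((StepLim.zero hL hτ0 (hτle j)).mono zero_le subset_rfl).congr
          (ae_of_all _ fun ω => ?_)
        change 0 = G _ ω - G _ ω
        rw [hGj]
        simp only [hG]
        rw [min_eq_left h2, max_eq_right (haτ _)]
        simp
  have hsum := StepLim.sum hL (τ := τ) (by rw [h0]; exact ha) m hcell
  rw [h0, hmt] at hsum
  refine (hsum.mono ?_ subset_rfl).congr (ae_of_all _ fun ω => ?_)
  · rw [Finset.sum_add_distrib, Finset.sum_const, Finset.card_range, ← Finset.sum_filter,
      Finset.sum_const, nsmul_eq_mul, nsmul_eq_mul]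
    have hcard : ((Finset.range m).filter fun j => τ j ≤ c ∧ c < τ (j + 1)).card ≤ 1 := by
      rw [Finset.card_le_one]
      intro i hi j hj
      simp only [Finset.mem_filter] at hi hj
      by_contra hne
      rcases lt_or_gt_of_ne hne with hlt | hlt
      · exact absurd (hi.2.2.trans_le (hτm (Nat.succ_le_of_lt hlt))) (not_lt.2 hj.2.1)
      · exact absurd (hj.2.2.trans_le (hτm (Nat.succ_le_of_lt hlt))) (not_lt.2 hi.2.1)
    have e1 : (m : ℝ≥0∞) * ENNReal.ofReal (ε ^ α * w) = ENNReal.ofReal (ε ^ α * (t - a)) := by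
      rw [← ENNReal.ofReal_natCast, ← ENNReal.ofReal_mul (by positivity), hw]
      congr 1
      field_simp
    rw [e1, show η = η / 2 + η / 2 by ring, ENNReal.ofReal_add (by positivity) (by positivity)]
    refine add_le_add (ENNReal.ofReal_le_ofReal hεη) ?_
    calc _ ≤ (1 : ℝ≥0∞) * ENNReal.ofReal (C ^ α * w) := by
          gcongr
          exact_mod_cast hcard
      _ ≤ _ := by
          rw [one_mul]
          exact ENNReal.ofReal_le_ofReal hm2.le
  · change (∑ k ∈ Finset.range m, (G (τ (k + 1)) ω - G (τ k) ω -
      if c < τ k then inner ℝ (h (τ k)) (L (τ (k + 1)) ω - L (τ k) ω) else 0)) = J ω - R m ω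
    rw [Finset.sum_sub_distrib, Finset.sum_range_sub (fun j => G (τ j) ω), h0, hmt]
    have hGa : G a ω = 0 := by
      simp only [hG]
      rw [max_eq_left (min_le_left _ _), sub_self]
    rw [hGa, sub_zero]
    simp only [hJ, hG, hR]
    congr 1
    refine Finset.sum_congr rfl fun j _ => ?_
    rw [← hτs]

/-- The indicator of `(c, c']` is the difference of those of two half-lines. -/
lemma tendsto_riemann_indicator (hL : IsStableLevy P 𝓕 α L) (hI : IsDetIntegral P L α T h I)
    (hh : UniformContinuous h) {C : ℝ} (hC : ∀ s, ‖h s‖ ≤ C) {t : ℝ} (ha : 0 ≤ a) (hat : a ≤ t)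
    (htT : t ≤ T) {c c' : ℝ} (hc : c ≤ c') :
    TendstoInMeasure P (fun m ω => ∑ j ∈ Finset.range m,
      if a + j * ((t - a) / m) ∈ Ioc c c' then inner ℝ (h (a + j * ((t - a) / m)))
        (L (a + (j + 1) * ((t - a) / m)) ω - L (a + j * ((t - a) / m)) ω) else 0) atTop
      (fun ω => I (max a (min t c')) ω - I (max a (min t c)) ω) := by
  have h1 := hI.tendsto_riemann_lt hL hh hC ha hat htT c
  have h2 := hI.tendsto_riemann_lt hL hh hC ha hat htT c'
  have hm1 := aestronglyMeasurable_riemann (P := P) hL ha hat (fun s => c < s) h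
  have hm2 := aestronglyMeasurable_riemann (P := P) hL ha hat (fun s => c' < s) h
  have h3 := tendstoInMeasure_add hm1 (fun m => (hm2 m).const_mul (-1)) h1
    (tendstoInMeasure_mul_left (c := fun _ => -1) aestronglyMeasurable_const hm2 h2)
  refine h3.congr (fun m => ae_of_all _ fun ω => ?_) (ae_of_all _ fun ω => ?_)
  · simp only
    rw [Finset.mul_sum, ← Finset.sum_add_distrib]
    refine Finset.sum_congr rfl fun j _ => ?_
    simp only [mem_Ioc]
    by_cases hx : c < a + j * ((t - a) / m)
    · by_cases hx' : c' < a + j * ((t - a) / m)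
      · simp [hx, hx', not_le.2 hx']
      · simp [hx, hx', not_lt.1 hx']
    · have hx' : ¬ c' < a + j * ((t - a) / m) := fun h => hx (hc.trans_lt h)
      simp [hx, hx']
  · simp only
    ring

lemma tendsto_riemann (hL : IsStableLevy P 𝓕 α L) (hI : IsDetIntegral P L α T h I)
    (hh : UniformContinuous h) {C : ℝ} (hC : ∀ s, ‖h s‖ ≤ C) {t : ℝ} (ha : 0 ≤ a) (hat : a ≤ t)
    (htT : t ≤ T) :
    TendstoInMeasure P (fun m ω => ∑ j ∈ Finset.range m, inner ℝ (h (a + j * ((t - a) / m)))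
        (L (a + (j + 1) * ((t - a) / m)) ω - L (a + j * ((t - a) / m)) ω)) atTop
      (fun ω => I t ω - I a ω) := by
  have hta : 0 ≤ t - a := sub_nonneg.2 hat
  -- A cut-off strictly below `a` discards nothing; the cut-off `a` itself would drop the first
  -- cell.
  have h1 := hI.tendsto_riemann_lt hL hh hC ha hat htT (a - 1)
  refine h1.congr (fun m => ae_of_all _ fun ω => ?_) (ae_of_all _ fun ω => ?_)
  · refine Finset.sum_congr rfl fun j _ => ?_
    have : a - 1 < a + j * ((t - a) / m) := by
      have : 0 ≤ j * ((t - a) / m) := by positivity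
      linarith
    rw [if_pos this]
  · have : max a (min t (a - 1)) = a := by
      rw [min_eq_right (by linarith), max_eq_left (by linarith)]
    simp

end IsDetIntegral

end

section

/-! ### The linear functional that solves the wealth equation -/

/-- The value at time `b` of the solution of `X t = f t + r ∫ s in a..t, X s`. -/
noncomputable def compound (r a b : ℝ) (f : ℝ → ℝ) : ℝ :=
  f b + r * ∫ s in a..b, Real.exp (r * (b - s)) * f s

section compound

variable {r a b : ℝ} {f g : ℝ → ℝ}

lemma CadlagOn.exp_mul (hf : CadlagOn f (Icc a b)) (c : ℝ) :
    CadlagOn (fun s => Real.exp (r * (c - s)) * f s) (Icc a b) :=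
  hf.mul_continuous (by fun_prop)

lemma compound_add (hab : a ≤ b) (hf : CadlagOn f (Icc a b)) (hg : CadlagOn g (Icc a b)) :
    compound r a b (fun t => f t + g t) = compound r a b f + compound r a b g := by
  simp only [compound, mul_add]
  rw [intervalIntegral.integral_add ((hf.exp_mul b).intervalIntegrable hab)
    ((hg.exp_mul b).intervalIntegrable hab)]
  ring

lemma compound_const_mul (c : ℝ) :
    compound r a b (fun t => c * f t) = c * compound r a b f := by
  simp only [compound]
  simp_rw [mul_left_comm _ c]
  rw [intervalIntegral.integral_const_mul]
  ring

lemma compound_sum {ι : Type*} (u : Finset ι) {f : ι → ℝ → ℝ} (hab : a ≤ b)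
    (hf : ∀ i ∈ u, CadlagOn (f i) (Icc a b)) :
    compound r a b (fun t => ∑ i ∈ u, f i t) = ∑ i ∈ u, compound r a b (f i) := by
  classical
  induction u using Finset.induction_on with
  | empty => simp [compound]
  | insert i u hi ih =>
    simp_rw [Finset.sum_insert hi]
    rw [compound_add hab (hf i (by simp)) (CadlagOn.sum u fun j hj => hf j (by simp [hj])),
      ih fun j hj => hf j (by simp [hj])]

/-- The constant forcing `x` grows to `x exp (r (b - a))`, which is exactly what the gain subtracts.
-/
lemma compound_const (x : ℝ) : compound r a b (fun _ => x) = x * Real.exp (r * (b - a)) := by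
  simp only [compound, intervalIntegral.integral_mul_const]
  have h : ∀ s ∈ uIcc a b, HasDerivAt (fun s => -Real.exp (r * (b - s)))
      (r * Real.exp (r * (b - s))) s := fun s _ => by
    have h1 : HasDerivAt (fun s => r * (b - s)) (r * (-1)) s :=
      ((hasDerivAt_id s).const_sub b).const_mul r
    exact h1.exp.neg.congr_deriv (by ring)
  have h2 := intervalIntegral.integral_eq_sub_of_hasDerivAt h
    (Continuous.intervalIntegrable (by fun_prop) _ _)
  rw [intervalIntegral.integral_const_mul] at h2
  rw [← mul_assoc, h2]
  simp
  ring

lemma compound_congr (hab : a ≤ b) (h : ∀ t ∈ Icc a b, f t = g t) :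
    compound r a b f = compound r a b g := by
  simp only [compound]
  rw [h b (right_mem_Icc.2 hab)]
  congr 2
  refine intervalIntegral.integral_congr fun s hs => ?_
  rw [uIcc_of_le hab] at hs
  simp only [h s hs]

end compound

/-- The pathwise integral is a limit of finite sums of measurable variables, which replaces a joint
measurability argument. -/
lemma aemeasurable_integral_mul {Ω : Type*} {mΩ : MeasurableSpace Ω} {P : Measure Ω}
    {Y : ℝ → Ω → ℝ} {a b : ℝ} {w' : ℝ → ℝ} (hab : a ≤ b)
    (hY : ∀ t ∈ Icc a b, AEMeasurable (Y t) P)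
    (hc : ∀ᵐ ω ∂P, CadlagOn (fun t => Y t ω) (Icc a b)) (hw' : Continuous w') :
    AEMeasurable (fun ω => ∫ s in a..b, w' s * Y s ω) P := by
  rcases hab.eq_or_lt with rfl | hlt
  · simp
  set w : ℝ → ℝ := fun t => ∫ s in a..t, w' s with hw
  have hwd : ∀ t, HasDerivAt w (w' t) t := fun t => hw'.integral_hasStrictDerivAt a t |>.hasDerivAt
  refine aemeasurable_of_tendsto_metrizable_ae atTop (f := fun (m : ℕ) ω =>
    ∑ j ∈ Finset.range m, Y (a + (j + 1) * ((b - a) / m)) ω *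
      (w (a + (j + 1) * ((b - a) / m)) - w (a + j * ((b - a) / m)))) (fun m => ?_) ?_
  · refine Finset.aemeasurable_fun_sum _ fun j hj => (hY _ ⟨?_, ?_⟩).mul_const _
    · have : 0 ≤ ((j : ℝ) + 1) * ((b - a) / m) := by
        have := sub_nonneg.2 hab
        positivity
      linarith
    · have hjm : ((j : ℝ) + 1) ≤ m := by exact_mod_cast Finset.mem_range.1 hj
      have hm : (0 : ℝ) < m := by
        have : (0 : ℝ) ≤ j := Nat.cast_nonneg j
        linarith
      have h1 : ((j : ℝ) + 1) * ((b - a) / m) ≤ m * ((b - a) / m) := by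
        have := sub_nonneg.2 hab
        gcongr
      rw [mul_div_cancel₀ _ hm.ne'] at h1
      linarith
  · filter_upwards [hc] with ω hω
    have := hω.tendsto_sum_mul_sub hlt hwd hw'
    simpa only [mul_comm] using this

/-! ### The wealth process -/

namespace MeanRiskProblem

variable {Ω : Type*} {mΩ : MeasurableSpace Ω} {P : Measure Ω} {d N : ℕ}

/-- The standing assumptions on the noise, the time grid and the coefficients. -/
structure IsRegular (D : MeanRiskProblem P d N) (α : ℝ) : Prop where
  stable : IsStableLevy P D.𝓕 α D.L
  grid_zero : D.grid 0 = 0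
  strictMono : StrictMono D.grid
  cont_μ : ContinuousOn D.μ (Icc 0 D.horizon)
  cont_σ : ContinuousOn D.σ (Icc 0 D.horizon)

/-- The `i`-th row of the volatility matrix, extended to a continuous function on `ℝ`. -/
noncomputable def vol (D : MeanRiskProblem P d N) (i : Fin d) (s : ℝ) :
    EuclideanSpace ℝ (Fin d) :=
  WithLp.toLp 2 (D.σ (max 0 (min D.horizon s)) i)

/-- The increments over the `k`-th period of the integral processes `B`, started at time `t_n`. -/
def noise (D : MeanRiskProblem P d N) (B : Fin d → ℝ → Ω → ℝ) (n k : Fin N) (i : Fin d) (t : ℝ)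
    (ω : Ω) : ℝ :=
  B i (max (D.start n) (min t (D.grid k.succ))) ω -
    B i (max (D.start n) (min t (D.grid k.castSucc))) ω

/-- The excess drift of the `i`-th asset accumulated over the `k`-th period. -/
noncomputable def drift (D : MeanRiskProblem P d N) (n k : Fin N) (i : Fin d) (t : ℝ) : ℝ :=
  ∫ s in (D.start n)..t, (Ioc (D.grid k.castSucc) (D.grid k.succ)).indicator
    (fun s => D.μ s i - D.r) s

variable {D : MeanRiskProblem P d N} {α : ℝ} {B : Fin d → ℝ → Ω → ℝ} {n k : Fin N}
  {u : Fin N → Ω → EuclideanSpace ℝ (Fin d)}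

lemma path_apply (u : Fin N → Ω → EuclideanSpace ℝ (Fin d)) (s : ℝ) (ω : Ω) (i : Fin d) :
    D.path u s ω i =
      ∑ k : Fin N, if s ∈ Ioc (D.grid k.castSucc) (D.grid k.succ) then u k ω i else 0 := by
  simp only [path, indicator_apply, WithLp.ofLp_sum, Finset.sum_apply]
  refine Finset.sum_congr rfl fun k _ => ?_
  split_ifs <;> simp

namespace IsRegular

lemma grid_nonneg (hD : D.IsRegular α) (k : Fin (N + 1)) : 0 ≤ D.grid k :=
  hD.grid_zero ▸ hD.strictMono.monotone (Fin.zero_le k)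

lemma grid_le (hD : D.IsRegular α) (k : Fin (N + 1)) : D.grid k ≤ D.horizon :=
  hD.strictMono.monotone (Fin.le_last k)

lemma start_nonneg (hD : D.IsRegular α) (n : Fin N) : 0 ≤ D.start n := hD.grid_nonneg _

lemma grid_lt (hD : D.IsRegular α) (n : Fin N) : D.grid n.castSucc < D.grid n.succ :=
  hD.strictMono n.castSucc_lt_succ

lemma start_lt (hD : D.IsRegular α) (n : Fin N) : D.start n < D.horizon :=
  (hD.grid_lt n).trans_le (hD.grid_le _)

lemma horizon_pos (hD : D.IsRegular α) (n : Fin N) : 0 < D.horizon :=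
  (hD.start_nonneg n).trans_lt (hD.start_lt n)

lemma horizon_nonneg (hD : D.IsRegular α) : 0 ≤ D.horizon := hD.grid_nonneg _

lemma clamp_mem (hD : D.IsRegular α) (s : ℝ) :
    max 0 (min D.horizon s) ∈ Icc 0 D.horizon :=
  ⟨le_max_left _ _, max_le hD.horizon_nonneg (min_le_left _ _)⟩

lemma continuous_vol (hD : D.IsRegular α) (i : Fin d) : Continuous (D.vol i) := by
  have h1 : Continuous fun s => D.σ (max 0 (min D.horizon s)) :=
    hD.cont_σ.comp_continuous (by fun_prop) hD.clamp_mem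
  exact (PiLp.continuous_toLp 2 _).comp ((continuous_apply i).comp h1)

lemma vol_eq (i : Fin d) {s : ℝ} (hs : s ∈ Icc 0 D.horizon) :
    D.vol i s = WithLp.toLp 2 (D.σ s i) := by
  simp [vol, min_eq_right hs.2, max_eq_right hs.1]

lemma uniformContinuous_vol (hD : D.IsRegular α) (i : Fin d) : UniformContinuous (D.vol i) := by
  have h1 : UniformContinuousOn (D.vol i) (Icc 0 D.horizon) :=
    isCompact_Icc.uniformContinuousOn_of_continuous (hD.continuous_vol i).continuousOn
  rw [Metric.uniformContinuousOn_iff] at h1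
  rw [Metric.uniformContinuous_iff]
  intro ε hε
  obtain ⟨δ, hδ, h⟩ := h1 ε hε
  refine ⟨δ, hδ, fun x y hxy => ?_⟩
  have key := h _ (hD.clamp_mem x) _ (hD.clamp_mem y) (lt_of_le_of_lt ?_ hxy)
  · rwa [vol_eq _ (hD.clamp_mem x), vol_eq _ (hD.clamp_mem y)] at key
  · rw [Real.dist_eq, Real.dist_eq]
    refine (abs_max_sub_max_le_max _ _ _ _).trans ?_
    rw [sub_self, abs_zero, max_eq_right (abs_nonneg _)]
    refine (abs_min_sub_min_le_max _ _ _ _).trans ?_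
    rw [sub_self, abs_zero, max_eq_right (abs_nonneg _)]

lemma exists_norm_vol_le (hD : D.IsRegular α) (i : Fin d) : ∃ C, ∀ s, ‖D.vol i s‖ ≤ C := by
  obtain ⟨C, hC⟩ := isCompact_Icc.exists_bound_of_continuousOn
    (hD.continuous_vol i).continuousOn (s := Icc 0 D.horizon)
  refine ⟨C, fun s => ?_⟩
  have := hC _ (hD.clamp_mem s)
  rwa [vol_eq _ (hD.clamp_mem s)] at this

/-- Separates the positions from the rows of the volatility, so that one integral per asset with a
deterministic integrand serves all strategies. -/
lemma inner_vecMul (v : Fin d → ℝ) {s : ℝ} (hs : s ∈ Icc 0 D.horizon)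
    (ℓ : EuclideanSpace ℝ (Fin d)) :
    inner ℝ (WithLp.toLp 2 (v ᵥ* D.σ s) : EuclideanSpace ℝ (Fin d)) ℓ =
      ∑ i, v i * inner ℝ (D.vol i s) ℓ := by
  have : (WithLp.toLp 2 (v ᵥ* D.σ s) : EuclideanSpace ℝ (Fin d)) = ∑ i, v i • D.vol i s := by
    ext j
    simp [Matrix.vecMul, dotProduct, vol_eq _ hs, Finset.sum_apply]
  rw [this, sum_inner]
  simp_rw [real_inner_smul_left]

lemma clamp_mem_Icc (hD : D.IsRegular α) (n : Fin N) {t x : ℝ}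
    (ht : t ∈ Icc (D.start n) D.horizon) :
    max (D.start n) (min t x) ∈ Icc 0 D.horizon :=
  ⟨(hD.start_nonneg n).trans (le_max_left _ _),
    max_le (hD.start_lt n).le ((min_le_left _ _).trans ht.2)⟩

lemma aemeasurable_noise (hD : D.IsRegular α)
    (hB : ∀ i, IsDetIntegral P D.L α D.horizon (D.vol i) (B i)) (n k : Fin N) (i : Fin d) {t : ℝ}
    (ht : t ∈ Icc (D.start n) D.horizon) : AEMeasurable (D.noise B n k i t) P :=
  ((hB i).aemeasurable _ (hD.clamp_mem_Icc n ht)).sub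
    ((hB i).aemeasurable _ (hD.clamp_mem_Icc n ht))

lemma cadlagOn_noise (hD : D.IsRegular α)
    (hB : ∀ i, IsDetIntegral P D.L α D.horizon (D.vol i) (B i)) (n : Fin N) :
    ∀ᵐ ω ∂P, ∀ k i, CadlagOn (fun t => D.noise B n k i t ω) (Icc (D.start n) D.horizon) := by
  have h1 : ∀ᵐ ω ∂P, ∀ i, CadlagOn (fun t => B i t ω) (Icc 0 D.horizon) :=
    ae_all_iff.2 fun i => (hB i).cadlag
  filter_upwards [h1] with ω hω k i
  have hc : ∀ x : ℝ, CadlagOn (fun t => B i (max (D.start n) (min t x)) ω)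
      (Icc (D.start n) D.horizon) := fun x =>
    (hω i).comp_monotone (g := fun t => max (D.start n) (min t x))
      (fun s t hst => max_le_max le_rfl (min_le_min hst le_rfl)) (by fun_prop)
      fun t ht => hD.clamp_mem_Icc n ht
  exact (hc _).sub (hc _)

lemma intervalIntegrable_excess (hD : D.IsRegular α) (n k : Fin N) (i : Fin d) {t : ℝ}
    (ht : t ∈ Icc (D.start n) D.horizon) :
    IntervalIntegrable ((Ioc (D.grid k.castSucc) (D.grid k.succ)).indicator
      (fun s => D.μ s i - D.r)) volume (D.start n) t := by
  have h1 : ContinuousOn (fun s => D.μ s i - D.r) (Icc (D.start n) t) :=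
    (((continuous_apply i).comp_continuousOn hD.cont_μ).mono
      (Icc_subset_Icc (hD.start_nonneg n) ht.2)).sub continuousOn_const
  have h2 : IntervalIntegrable (fun s => D.μ s i - D.r) volume (D.start n) t :=
    h1.intervalIntegrable_of_Icc ht.1
  rw [intervalIntegrable_iff] at h2 ⊢
  exact h2.indicator measurableSet_Ioc

lemma cadlagOn_drift (hD : D.IsRegular α) (n k : Fin N) (i : Fin d) :
    CadlagOn (D.drift n k i) (Icc (D.start n) D.horizon) := by
  refine CadlagOn.of_continuousOn ?_
  have h := hD.intervalIntegrable_excess n k i (right_mem_Icc.2 (hD.start_lt n).le)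
  have := intervalIntegral.continuousOn_primitive_interval (a := D.start n) (b := D.horizon)
    (μ := volume) (f := (Ioc (D.grid k.castSucc) (D.grid k.succ)).indicator
      (fun s => D.μ s i - D.r)) (by
        rw [uIcc_of_le (hD.start_lt n).le, integrableOn_Icc_iff_integrableOn_Ioc,
          ← intervalIntegrable_iff_integrableOn_Ioc_of_le (hD.start_lt n).le]
        exact h)
  rwa [uIcc_of_le (hD.start_lt n).le] at this

lemma integral_path_drift (hD : D.IsRegular α) (n : Fin N)
    (u : Fin N → Ω → EuclideanSpace ℝ (Fin d)) (ω : Ω) {t : ℝ}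
    (ht : t ∈ Icc (D.start n) D.horizon) :
    IntervalIntegrable (fun s => ∑ i, D.path u s ω i * (D.μ s i - D.r)) volume (D.start n) t ∧
    ∫ s in (D.start n)..t, (∑ i, D.path u s ω i * (D.μ s i - D.r)) =
      ∑ k, ∑ i, u k ω i * D.drift n k i t := by
  have h1 : (fun s => ∑ i, D.path u s ω i * (D.μ s i - D.r)) = fun s =>
      ∑ k : Fin N, ∑ i, u k ω i * (Ioc (D.grid k.castSucc) (D.grid k.succ)).indicator
        (fun s => D.μ s i - D.r) s := by
    ext s
    rw [Finset.sum_comm]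
    refine Finset.sum_congr rfl fun i _ => ?_
    rw [path_apply, Finset.sum_mul]
    refine Finset.sum_congr rfl fun k _ => ?_
    rw [indicator_apply]
    split_ifs <;> simp
  have h2 : ∀ k i, IntervalIntegrable (fun s => u k ω i *
      (Ioc (D.grid k.castSucc) (D.grid k.succ)).indicator (fun s => D.μ s i - D.r) s) volume
      (D.start n) t := fun k i => (hD.intervalIntegrable_excess n k i ht).const_mul _
  have h3 : ∀ k, IntervalIntegrable (fun s => ∑ i, u k ω i *
      (Ioc (D.grid k.castSucc) (D.grid k.succ)).indicator (fun s => D.μ s i - D.r) s) volume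
      (D.start n) t := fun k => by
    have := IntervalIntegrable.sum Finset.univ (fun i _ => h2 k i)
    refine this.congr (fun s _ => ?_)
    simp
  rw [h1]
  constructor
  · have := IntervalIntegrable.sum Finset.univ (fun k _ => h3 k)
    refine this.congr (fun s _ => ?_)
    simp
  · rw [intervalIntegral.integral_finsetSum fun k _ => h3 k]
    refine Finset.sum_congr rfl fun k _ => ?_
    rw [intervalIntegral.integral_finsetSum fun i _ => h2 k i]
    refine Finset.sum_congr rfl fun i _ => ?_
    rw [intervalIntegral.integral_const_mul]
    rfl

end IsRegular

end MeanRiskProblem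

end

/-! ### Existence and uniqueness of the wealth process, and the gain in closed form. -/

section

namespace MeanRiskProblem

variable {Ω : Type*} {mΩ : MeasurableSpace Ω} {P : Measure Ω} [IsProbabilityMeasure P] {d N : ℕ}
  {D : MeanRiskProblem P d N} {α : ℝ} {B : Fin d → ℝ → Ω → ℝ} {n k : Fin N}
  {u : Fin N → Ω → EuclideanSpace ℝ (Fin d)}

namespace IsRegular

/-- A position is constant in time during its period, so it factors out of the Riemann sums as a
random coefficient. -/
lemma tendstoInMeasure_riemannSum (hD : D.IsRegular α)
    (hB : ∀ i, IsDetIntegral P D.L α D.horizon (D.vol i) (B i)) (n : Fin N)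
    (hu : ∀ k, Measurable (u k)) {t : ℝ} (ht : t ∈ Icc (D.start n) D.horizon) :
    TendstoInMeasure P (fun m => riemannSum
      (fun s ω => WithLp.toLp 2 ((D.path u s ω).ofLp ᵥ* D.σ s)) D.L (D.start n) t m) atTop
      (fun ω => ∑ k, ∑ i, u k ω i * D.noise B n k i t ω) := by
  set R : Fin N → Fin d → ℕ → Ω → ℝ := fun k i m ω => ∑ j ∈ Finset.range m,
      if D.start n + j * ((t - D.start n) / m) ∈ Ioc (D.grid k.castSucc) (D.grid k.succ) then
        inner ℝ (D.vol i (D.start n + j * ((t - D.start n) / m)))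
          (D.L (D.start n + (j + 1) * ((t - D.start n) / m)) ω -
            D.L (D.start n + j * ((t - D.start n) / m)) ω) else 0 with hR
  have hRlim : ∀ k i, TendstoInMeasure P (R k i) atTop (D.noise B n k i t) := fun k i => by
    obtain ⟨C, hC⟩ := hD.exists_norm_vol_le i
    exact (hB i).tendsto_riemann_indicator hD.stable (hD.uniformContinuous_vol i) hC
      (hD.start_nonneg n) ht.1 ht.2 (hD.grid_lt k).le
  have hRm : ∀ k i m, AEStronglyMeasurable (R k i m) P := fun k i m =>
    IsDetIntegral.aestronglyMeasurable_riemann hD.stable (hD.start_nonneg n) ht.1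
      (fun s => s ∈ Ioc (D.grid k.castSucc) (D.grid k.succ)) (D.vol i) m
  have huc : ∀ k i, AEStronglyMeasurable (fun ω => u k ω i) P := fun k i => by
    have : Measurable fun ω => u k ω i :=
      ((measurable_pi_apply i).comp (WithLp.measurable_ofLp 2 _)).comp (hu k)
    exact this.aestronglyMeasurable
  have h1 := tendstoInMeasure_sum (P := P) (Finset.univ : Finset (Fin N))
    (f := fun k m ω => ∑ i, u k ω i * R k i m ω)
    (g := fun k ω => ∑ i, u k ω i * D.noise B n k i t ω)
    (fun k m => Finset.aestronglyMeasurable_fun_sum _ fun i _ => (huc k i).mul (hRm k i m))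
    (fun k _ => tendstoInMeasure_sum (P := P) Finset.univ
      (f := fun i m ω => u k ω i * R k i m ω)
      (fun i m => (huc k i).mul (hRm k i m))
      (fun i _ => tendstoInMeasure_mul_left (huc k i) (hRm k i) (hRlim k i)))
  refine h1.congr (fun m => ae_of_all _ fun ω => ?_) (ae_of_all _ fun ω => rfl)
  simp only [riemannSum, hR, Finset.mul_sum]
  rw [Finset.sum_congr rfl fun k _ => Finset.sum_comm, Finset.sum_comm]
  refine Finset.sum_congr rfl fun j hj => ?_
  have hjm : (j : ℝ) ≤ m := by exact_mod_cast (Finset.mem_range.1 hj).le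
  have hm : (0 : ℝ) < m := by exact_mod_cast (Nat.zero_le j).trans_lt (Finset.mem_range.1 hj)
  have hs : D.start n + j * ((t - D.start n) / m) ∈ Icc 0 D.horizon := by
    have h0 := sub_nonneg.2 ht.1
    have h2 : (j : ℝ) * ((t - D.start n) / m) ≤ m * ((t - D.start n) / m) := by gcongr
    rw [mul_div_cancel₀ _ hm.ne'] at h2
    have h3 : 0 ≤ (j : ℝ) * ((t - D.start n) / m) := by positivity
    have := hD.start_nonneg n
    constructor <;> linarith [ht.2]
  rw [inner_vecMul _ hs, Finset.sum_comm]
  refine Finset.sum_congr rfl fun i _ => ?_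
  rw [path_apply, Finset.sum_mul]
  refine Finset.sum_congr rfl fun k _ => ?_
  split_ifs <;> simp

lemma isStochIntegral (hD : D.IsRegular α)
    (hB : ∀ i, IsDetIntegral P D.L α D.horizon (D.vol i) (B i)) (n : Fin N)
    (hu : ∀ k, Measurable (u k)) :
    IsStochIntegral P (fun s ω => WithLp.toLp 2 ((D.path u s ω).ofLp ᵥ* D.σ s)) D.L (D.start n)
      D.horizon (fun t ω => ∑ k, ∑ i, u k ω i * D.noise B n k i t ω) := by
  refine ⟨?_, fun t ht => hD.tendstoInMeasure_riemannSum hB n hu ht⟩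
  filter_upwards [hD.cadlagOn_noise hB n] with ω hω
  exact CadlagOn.sum _ fun k _ => CadlagOn.sum _ fun i _ =>
    (hω k i).comp_continuous (continuous_const_mul (u k ω i))

/-- Limits in probability agree almost surely at the countably many dyadic points, and càdlàg paths
are determined there. -/
lemma stochIntegral_unique {H : ℝ → Ω → EuclideanSpace ℝ (Fin d)}
    {L : ℝ → Ω → EuclideanSpace ℝ (Fin d)} {a b : ℝ} {I I' : ℝ → Ω → ℝ} (hab : a ≤ b)
    (hI : IsStochIntegral P H L a b I) (hI' : IsStochIntegral P H L a b I') :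
    ∀ᵐ ω ∂P, ∀ t ∈ Icc a b, I t ω = I' t ω := by
  have hpt : ∀ j k : ℕ, k ≤ 2 ^ j → a + k * ((b - a) / (2 ^ j : ℕ)) ∈ Icc a b := fun j k hk => by
    have h0 := sub_nonneg.2 hab
    have hk' : (k : ℝ) ≤ (2 ^ j : ℕ) := by exact_mod_cast hk
    have hm : (0 : ℝ) < (2 ^ j : ℕ) := by positivity
    have h2 : (k : ℝ) * ((b - a) / (2 ^ j : ℕ)) ≤ (2 ^ j : ℕ) * ((b - a) / (2 ^ j : ℕ)) := by gcongr
    rw [mul_div_cancel₀ _ hm.ne'] at h2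
    have h3 : 0 ≤ (k : ℝ) * ((b - a) / (2 ^ j : ℕ)) := by positivity
    constructor <;> linarith
  have hdy : ∀ᵐ ω ∂P, ∀ j k : ℕ, k ≤ 2 ^ j →
      I (a + k * ((b - a) / (2 ^ j : ℕ))) ω = I' (a + k * ((b - a) / (2 ^ j : ℕ))) ω := by
    refine ae_all_iff.2 fun j => ae_all_iff.2 fun k => ?_
    by_cases hk : k ≤ 2 ^ j
    · filter_upwards [tendstoInMeasure_ae_unique (hI.2 _ (hpt j k hk)) (hI'.2 _ (hpt j k hk))]
        with ω hω _ using hω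
    · exact ae_of_all _ fun ω h => absurd h hk
  filter_upwards [hI.1, hI'.1, hdy] with ω h1 h2 h3 t ht
  have := (h1.sub h2).mem_of_dyadic (isClosed_singleton (x := (0 : ℝ)))
    (fun j k hk => sub_eq_zero.2 (h3 j k hk)) ht
  exact sub_eq_zero.1 this

/-- The source term of the linear integral equation for the wealth. -/
noncomputable def source (D : MeanRiskProblem P d N) (B : Fin d → ℝ → Ω → ℝ) (n : Fin N) (x : ℝ)
    (u : Fin N → Ω → EuclideanSpace ℝ (Fin d)) (t : ℝ) (ω : Ω) : ℝ :=
  x + ∑ k, ∑ i, u k ω i * (D.drift n k i t + D.noise B n k i t ω)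

lemma cadlagOn_source (hD : D.IsRegular α)
    (hB : ∀ i, IsDetIntegral P D.L α D.horizon (D.vol i) (B i)) (n : Fin N) :
    ∀ᵐ ω ∂P, ∀ x u, CadlagOn (fun t => source D B n x u t ω) (Icc (D.start n) D.horizon) := by
  filter_upwards [hD.cadlagOn_noise hB n] with ω hω x u
  exact (CadlagOn.const x).add (CadlagOn.sum _ fun k _ => CadlagOn.sum _ fun i _ =>
    ((hD.cadlagOn_drift n k i).add (hω k i)).comp_continuous (continuous_const_mul (u k ω i)))

lemma exists_isWealth (hD : D.IsRegular α)
    (hB : ∀ i, IsDetIntegral P D.L α D.horizon (D.vol i) (B i)) (n : Fin N) (x : ℝ)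
    (hu : ∀ k, Measurable (u k)) : ∃ X, D.IsWealth n x u X := by
  have huc : ∀ k i, AEMeasurable (fun ω => u k ω i) P := fun k i => by
    have : Measurable fun ω => u k ω i :=
      ((measurable_pi_apply i).comp (WithLp.measurable_ofLp 2 _)).comp (hu k)
    exact this.aemeasurable
  have hΦm : ∀ t ∈ Icc (D.start n) D.horizon, AEMeasurable (source D B n x u t) P := fun t ht =>
    aemeasurable_const.add (Finset.aemeasurable_fun_sum _ fun k _ =>
      Finset.aemeasurable_fun_sum _ fun i _ => (huc k i).mul
        (aemeasurable_const.add (hD.aemeasurable_noise hB n k i ht)))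
  have hΦc := hD.cadlagOn_source hB n
  refine ⟨fun t ω => source D B n x u t ω +
    D.r * ∫ s in (D.start n)..t, Real.exp (D.r * (t - s)) * source D B n x u s ω,
    fun t ht => ?_, ?_, _, hD.isStochIntegral hB n hu, ?_⟩
  · refine (hΦm t ht).add ((aemeasurable_integral_mul ht.1
      (fun s hs => hΦm s ⟨hs.1, hs.2.trans ht.2⟩) ?_ (by fun_prop)).const_mul _)
    filter_upwards [hΦc] with ω hω
    exact (hω x u).mono (Icc_subset_Icc le_rfl ht.2)
  · filter_upwards [hΦc] with ω hω
    exact (exists_linear_integral_eq (hω x u)).1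
  · filter_upwards [hΦc] with ω hω t ht
    obtain ⟨h1, h2⟩ := exists_linear_integral_eq (r := D.r) (hω x u)
    have h3 := hD.integral_path_drift n u ω ht
    rw [h2 t ht, intervalIntegral.integral_add
      (((h1.mono (Icc_subset_Icc le_rfl ht.2)).intervalIntegrable ht.1).const_mul _) h3.1, h3.2]
    simp only [source, mul_add, Finset.sum_add_distrib]
    ring

/-- `wealth` is an arbitrary choice among the solutions; this pins down its final value almost
surely. -/
lemma isWealth_horizon (hD : D.IsRegular α)
    (hB : ∀ i, IsDetIntegral P D.L α D.horizon (D.vol i) (B i)) (n : Fin N) (x : ℝ)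
    (hu : ∀ k, Measurable (u k)) {X : ℝ → Ω → ℝ} (hX : D.IsWealth n x u X) :
    ∀ᵐ ω ∂P, X D.horizon ω = compound D.r (D.start n) D.horizon
      (fun t => source D B n x u t ω) := by
  obtain ⟨-, hXc, I, hI, hXe⟩ := hX
  filter_upwards [hXc, hXe, hD.cadlagOn_source hB n,
    stochIntegral_unique (hD.start_lt n).le hI (hD.isStochIntegral hB n hu)] with ω h1 h2 h3 h4
  refine linear_integral_eq_solution (hD.start_lt n).le (h3 x u) h1 fun t ht => ?_
  have h5 := hD.integral_path_drift n u ω ht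
  rw [h2 t ht, h4 t ht, intervalIntegral.integral_add
      (((h1.mono (Icc_subset_Icc le_rfl ht.2)).intervalIntegrable ht.1).const_mul _) h5.1, h5.2,
      intervalIntegral.integral_const_mul]
  simp only [source, mul_add, Finset.sum_add_distrib]
  ring

lemma isWealth_wealth {x : ℝ} (h : ∃ X, D.IsWealth n x u X) :
    D.IsWealth n x u (D.wealth n x u) := by
  rw [wealth, dif_pos h]
  exact h.choose_spec

/-- The random discounted noise in the `k`-th period, as a coefficient of the position. -/
noncomputable def noiseVec (D : MeanRiskProblem P d N) (B : Fin d → ℝ → Ω → ℝ) (n k : Fin N)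
    (ω : Ω) : EuclideanSpace ℝ (Fin d) :=
  WithLp.toLp 2 fun i => compound D.r (D.start n) D.horizon fun t => D.noise B n k i t ω

/-- The discounted drift in the `k`-th period, as a coefficient of the position. -/
noncomputable def driftVec (D : MeanRiskProblem P d N) (n k : Fin N) : EuclideanSpace ℝ (Fin d) :=
  WithLp.toLp 2 fun i => compound D.r (D.start n) D.horizon (D.drift n k i)

lemma aemeasurable_noiseVec (hD : D.IsRegular α)
    (hB : ∀ i, IsDetIntegral P D.L α D.horizon (D.vol i) (B i)) (n k : Fin N) :
    AEMeasurable (noiseVec D B n k) P := by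
  refine (WithLp.measurable_toLp 2 _).comp_aemeasurable (aemeasurable_pi_lambda _ fun i => ?_)
  refine (hD.aemeasurable_noise hB n k i (right_mem_Icc.2 (hD.start_lt n).le)).add
    ((aemeasurable_integral_mul (hD.start_lt n).le
      (fun s hs => hD.aemeasurable_noise hB n k i hs) ?_ (by fun_prop)).const_mul _)
  filter_upwards [hD.cadlagOn_noise hB n] with ω hω using hω k i

/-- `compound` is linear in the source term, and the part coming from `x` cancels. -/
lemma gain_eq (hD : D.IsRegular α)
    (hB : ∀ i, IsDetIntegral P D.L α D.horizon (D.vol i) (B i)) (n : Fin N) (x : ℝ)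
    (hu : ∀ k, Measurable (u k)) :
    ∀ᵐ ω ∂P, D.gain n x u ω =
      ∑ k, inner ℝ (u k ω) (noiseVec D B n k ω + driftVec D n k) := by
  filter_upwards [hD.isWealth_horizon hB n x hu (isWealth_wealth (hD.exists_isWealth hB n x hu)),
    hD.cadlagOn_noise hB n] with ω h1 h2
  have hab := (hD.start_lt n).le
  have h3 : ∀ k i, CadlagOn (fun t => D.drift n k i t + D.noise B n k i t ω)
    (Icc (D.start n) D.horizon) := fun k i => (hD.cadlagOn_drift n k i).add (h2 k i)
  have h4 : ∀ k i, CadlagOn (fun t => u k ω i * (D.drift n k i t + D.noise B n k i t ω))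
    (Icc (D.start n) D.horizon) := fun k i => (h3 k i).comp_continuous (continuous_const_mul _)
  have h5 : ∀ k, CadlagOn (fun t => ∑ i, u k ω i * (D.drift n k i t + D.noise B n k i t ω))
    (Icc (D.start n) D.horizon) := fun k => CadlagOn.sum _ fun i _ => h4 k i
  rw [gain, h1]
  simp only [source]
  rw [compound_add hab (CadlagOn.const x) (CadlagOn.sum _ fun k _ => h5 k), compound_const,
    add_sub_cancel_left, compound_sum _ hab fun k _ => h5 k]
  refine Finset.sum_congr rfl fun k _ => ?_
  rw [compound_sum _ hab fun i _ => h4 k i]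
  simp only [PiLp.inner_apply, PiLp.add_apply, noiseVec, driftVec, RCLike.inner_apply, conj_trivial]
  refine Finset.sum_congr rfl fun i _ => ?_
  rw [compound_const_mul, compound_add hab (hD.cadlagOn_drift n k i) (h2 k i)]
  ring

/-- Both ends of a period that is over are clamped to the starting time. -/
lemma noise_of_lt (hD : D.IsRegular α) (hk : k < n) (B : Fin d → ℝ → Ω → ℝ) (i : Fin d) (t : ℝ)
    (ω : Ω) : D.noise B n k i t ω = 0 := by
  have h1 : D.grid k.succ ≤ D.start n := hD.strictMono.monotone (by
    rw [Fin.le_def, Fin.val_succ, Fin.val_castSucc]; exact hk)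
  have h2 := (hD.grid_lt k).le.trans h1
  rw [noise, max_eq_left ((min_le_right _ _).trans h1), max_eq_left ((min_le_right _ _).trans h2),
    sub_self]

lemma noiseVec_of_lt (hD : D.IsRegular α) (hk : k < n) (B : Fin d → ℝ → Ω → ℝ) (ω : Ω) :
    noiseVec D B n k ω = 0 := by
  ext i
  simp [noiseVec, compound, hD.noise_of_lt hk]

lemma driftVec_of_lt (hD : D.IsRegular α) (hk : k < n) : driftVec D n k = 0 := by
  have h1 : D.grid k.succ ≤ D.start n := hD.strictMono.monotone (by
    rw [Fin.le_def, Fin.val_succ, Fin.val_castSucc]; exact hk)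
  have h2 : ∀ i, ∀ t ∈ Icc (D.start n) D.horizon, D.drift n k i t = 0 := fun i t ht => by
    rw [drift, intervalIntegral.integral_of_le ht.1]
    refine setIntegral_eq_zero_of_forall_eq_zero fun s hs => ?_
    rw [indicator_of_notMem]
    exact fun h => absurd (h.2.trans h1) (not_le.2 hs.1)
  ext i
  simp only [driftVec, PiLp.zero_apply]
  rw [compound_congr (hD.start_lt n).le (h2 i)]
  simp [compound_const]

end IsRegular

end MeanRiskProblem

end

/-! ### The compounded noise as a limit of step sums with controlled coefficients. -/

section

namespace MeanRiskProblem.IsRegular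

variable {Ω : Type*} {mΩ : MeasurableSpace Ω} {P : Measure Ω} [IsProbabilityMeasure P] {d N : ℕ}
  {D : MeanRiskProblem P d N} {α : ℝ} {B : Fin d → ℝ → Ω → ℝ} {n k : Fin N}
  {Q : Set (EuclideanSpace ℝ (Fin d))}

/-- The scaled increments of the integral of `c ᵥ* σ`. -/
lemma stepLim_increment (hD : D.IsRegular α)
    (hB : ∀ i, IsDetIntegral P D.L α D.horizon (D.vol i) (B i)) (c : EuclideanSpace ℝ (Fin d))
    {y p q : ℝ} (hp : 0 ≤ p) (hpq : p ≤ q) (hq : q ≤ D.horizon)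
    (hQ : ∀ s ∈ Icc p q, y • (WithLp.toLp 2 (c.ofLp ᵥ* D.σ s) : EuclideanSpace ℝ (Fin d)) ∈ Q) :
    StepLim P D.L α Q p q ⊤ (fun ω => y * ∑ i, c i * (B i q ω - B i p ω)) := by
  set R : ℕ → Ω → ℝ := fun m ω => y * ∑ i, c i * ∑ j ∈ Finset.range m,
    inner ℝ (D.vol i (p + j * ((q - p) / m)))
        (D.L (p + (j + 1) * ((q - p) / m)) ω - D.L (p + j * ((q - p) / m)) ω) with hR
  have hBm : ∀ i, ∀ s ∈ Icc 0 D.horizon, AEMeasurable (B i s) P := fun i => (hB i).aemeasurable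
  have hm : AEMeasurable (fun ω => y * ∑ i, c i * (B i q ω - B i p ω)) P :=
    (Finset.aemeasurable_fun_sum _ fun i _ => ((hBm i q ⟨hp.trans hpq, hq⟩).sub
      (hBm i p ⟨hp, hpq.trans hq⟩)).const_mul _).const_mul _
  have hRm : ∀ i m, AEStronglyMeasurable (fun ω => ∑ j ∈ Finset.range m,
      inner ℝ (D.vol i (p + j * ((q - p) / m)))
        (D.L (p + (j + 1) * ((q - p) / m)) ω - D.L (p + j * ((q - p) / m)) ω)) P := fun i m => by
    have := IsDetIntegral.aestronglyMeasurable_riemann (P := P) hD.stable hp hpq (fun _ => True)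
      (D.vol i) m
    simpa using this
  have hlim : TendstoInMeasure P R atTop (fun ω => y * ∑ i, c i * (B i q ω - B i p ω)) := by
    refine tendstoInMeasure_mul_left (c := fun _ => y) aestronglyMeasurable_const
      (fun m => Finset.aestronglyMeasurable_fun_sum _ fun i _ => (hRm i m).const_mul _) ?_
    refine tendstoInMeasure_sum (P := P) Finset.univ (fun i m => (hRm i m).const_mul _)
      fun i _ => ?_
    obtain ⟨C, hC⟩ := hD.exists_norm_vol_le i
    exact tendstoInMeasure_mul_left (c := fun _ => c i) aestronglyMeasurable_const (hRm i)
      ((hB i).tendsto_riemann hD.stable (hD.uniformContinuous_vol i) hC hp hpq hq)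
  refine StepLim.of_tendstoInMeasure ?_ hm hlim
  -- The `i`-th Riemann sums, weighted by `y * c i`, combine into one step sum whose coefficients
  -- are `y • (c ᵥ* σ)`. From here on only membership in `Q` is tracked, so the energy bound is `⊤`.
  filter_upwards [eventually_gt_atTop 0] with m hm0
  have hm' : (0 : ℝ) < m := by exact_mod_cast hm0
  have hqp := sub_nonneg.2 hpq
  set τ : ℕ → ℝ := fun j => p + j * ((q - p) / m) with hτ
  have hτmono : Monotone τ := fun i j hij => by
    have : (i : ℝ) ≤ j := by exact_mod_cast hij
    simp only [hτ]
    gcongr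
  have h0 : τ 0 = p := by simp [hτ]
  have hm1 : τ m = q := by simp only [hτ]; field_simp; ring
  have hmem : ∀ j ≤ m, τ j ∈ Icc p q := fun j hj =>
    ⟨h0 ▸ hτmono (Nat.zero_le j), hm1 ▸ hτmono hj⟩
  have h1 := IsStepSum.of_monotone (L := D.L) (α := α) (Q := Q) hτmono
    (fun j => y • (WithLp.toLp 2 (c.ofLp ᵥ* D.σ (τ j)) : EuclideanSpace ℝ (Fin d))) m
    (fun j hj _ => hQ _ (hmem j hj.le))
  rw [h0, hm1] at h1
  refine ((StepLim.of_isStepSum hD.stable hp h1).mono le_top subset_rfl).congr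
    (ae_of_all _ fun ω => ?_)
  simp only [hR, Finset.mul_sum]
  rw [Finset.sum_comm]
  refine Finset.sum_congr rfl fun j hj => ?_
  have h2 := hmem j (Finset.mem_range.1 hj).le
  have h3 : τ (j + 1) = p + (j + 1) * ((q - p) / m) := by simp [hτ]
  rw [real_inner_smul_left, inner_vecMul _ ⟨hp.trans h2.1, h2.2.trans hq⟩, h3, Finset.mul_sum]

lemma noise_eq (hD : D.IsRegular α) (hk : n ≤ k) (i : Fin d) {t : ℝ} (ht : D.start n ≤ t) (ω : Ω) :
    D.noise B n k i t ω = B i (max (D.grid k.castSucc) (min t (D.grid k.succ))) ω -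
      B i (D.grid k.castSucc) ω := by
  have h1 : D.start n ≤ D.grid k.castSucc := hD.strictMono.monotone hk
  have h2 := hD.grid_lt k
  rw [noise]
  rcases le_total t (D.grid k.castSucc) with h | h
  · rw [min_eq_left h, min_eq_left (h.trans h2.le), max_eq_right ht, max_eq_left h]
    simp
  · rw [min_eq_right h, max_eq_right h1, max_eq_right (le_min ht (h1.trans h2.le)),
      max_eq_right (le_min h h2.le)]

/-- Integration by parts turns the compounded noise into the integral of `exp (r (T - s'))` against
the noise. In its sums the exponential is taken at a point of one partition and the volatility at
points of finer partitions inside a cell, which is why the hypothesis decouples `s'` and `s`. -/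
lemma stepLim_noiseVec (hD : D.IsRegular α)
    (hB : ∀ i, IsDetIntegral P D.L α D.horizon (D.vol i) (B i)) (hk : n ≤ k)
    (c : EuclideanSpace ℝ (Fin d))
    (hQ : ∀ s' ∈ Icc 0 D.horizon, ∀ s ∈ Icc (D.grid k.castSucc) (D.grid k.succ),
      Real.exp (D.r * (D.horizon - s')) •
        (WithLp.toLp 2 (c.ofLp ᵥ* D.σ s) : EuclideanSpace ℝ (Fin d)) ∈ Q) :
    StepLim P D.L α Q (D.grid k.castSucc) (D.grid k.succ) ⊤
      (fun ω => inner ℝ c (noiseVec D B n k ω)) := by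
  have h1 : D.start n ≤ D.grid k.castSucc := hD.strictMono.monotone hk
  have h2 := hD.grid_lt k
  have hab := (hD.start_lt n).le
  set a := D.start n with ha
  set b := D.horizon with hb
  set w : ℝ → ℝ := fun s => Real.exp (D.r * (b - s)) with hw
  have hwd : ∀ t, HasDerivAt w (Real.exp (D.r * (b - t)) * (-D.r)) t := fun t => by
    have h1 : HasDerivAt (fun s => D.r * (b - s)) (D.r * (-1)) t :=
      ((hasDerivAt_id t).const_sub b).const_mul D.r
    exact h1.exp.congr_deriv (by ring)
  set f : Ω → ℝ → ℝ := fun ω t => ∑ i, c i * D.noise B n k i t ω with hf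
  have hm : AEMeasurable (fun ω => inner ℝ c (noiseVec D B n k ω)) P := by
    have h4 : Measurable fun x : EuclideanSpace ℝ (Fin d) => (inner ℝ c x : ℝ) := by fun_prop
    exact h4.comp_aemeasurable (hD.aemeasurable_noiseVec hB n k)
  set R : ℕ → Ω → ℝ := fun m ω => ∑ j ∈ Finset.range m, w (a + j * ((b - a) / m)) *
    (f ω (a + (j + 1) * ((b - a) / m)) - f ω (a + j * ((b - a) / m))) with hR
  set cl : ℝ → ℝ := fun t => max (D.grid k.castSucc) (min t (D.grid k.succ)) with hcl
  have hclm : Monotone cl := fun s t hst => max_le_max le_rfl (min_le_min hst le_rfl)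
  have hclmem : ∀ t, cl t ∈ Icc (D.grid k.castSucc) (D.grid k.succ) := fun t =>
    ⟨le_max_left _ _, max_le h2.le (min_le_right _ _)⟩
  have hstep : ∀ᶠ m in atTop, StepLim P D.L α Q (D.grid k.castSucc) (D.grid k.succ) ⊤ (R m) := by
    filter_upwards [eventually_gt_atTop 0] with m hm0
    have hm' : (0 : ℝ) < m := by exact_mod_cast hm0
    have hba := sub_nonneg.2 hab
    set τ : ℕ → ℝ := fun j => a + j * ((b - a) / m) with hτ
    have hτmono : Monotone τ := fun i j hij => by
      have : (i : ℝ) ≤ j := by exact_mod_cast hij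
      simp only [hτ]
      gcongr
    have h0 : τ 0 = a := by simp [hτ]
    have hm1 : τ m = b := by simp only [hτ]; field_simp; ring
    have hmem : ∀ j ≤ m, τ j ∈ Icc a b := fun j hj =>
      ⟨h0 ▸ hτmono (Nat.zero_le j), hm1 ▸ hτmono hj⟩
    have hcell : ∀ j < m, StepLim P D.L α Q (cl (τ j)) (cl (τ (j + 1))) ⊤
        (fun ω => w (τ j) * ∑ i, c i * (B i (cl (τ (j + 1))) ω - B i (cl (τ j)) ω)) := by
      intro j hj
      refine hD.stepLim_increment hB c ((hD.grid_nonneg _).trans (hclmem _).1)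
        (hclm (hτmono j.le_succ)) ((hclmem _).2.trans (hD.grid_le _)) fun s hs => ?_
      have h3 := hmem j hj.le
      exact hQ _ ⟨(hD.start_nonneg n).trans h3.1, h3.2⟩ s
        ⟨(hclmem _).1.trans hs.1, hs.2.trans (hclmem _).2⟩
    have hsum := StepLim.sum hD.stable (τ := fun j => cl (τ j))
      ((hD.grid_nonneg _).trans (hclmem _).1) m hcell
    have hc0 : cl (τ 0) = D.grid k.castSucc := by
      rw [h0]; exact max_eq_left ((min_le_left _ _).trans h1)
    have hcm : cl (τ m) = D.grid k.succ := by
      rw [hm1]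
      simp only [hcl]
      rw [min_eq_right (hD.grid_le _), max_eq_right h2.le]
    simp only [hc0, hcm] at hsum
    refine (hsum.mono le_top subset_rfl).congr (ae_of_all _ fun ω => ?_)
    simp only [hR]
    refine Finset.sum_congr rfl fun j hj => ?_
    have h3 : τ (j + 1) = a + (j + 1) * ((b - a) / m) := by simp [hτ]
    rw [← h3]
    simp only [hf]
    rw [← Finset.sum_sub_distrib]
    congr 1
    refine Finset.sum_congr rfl fun i _ => ?_
    have h4 := hmem j (Finset.mem_range.1 hj).le
    have h5 := hmem (j + 1) (Finset.mem_range.1 hj)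
    rw [hD.noise_eq hk i h4.1, hD.noise_eq hk i h5.1]
    ring
  have hRm : ∀ m, AEStronglyMeasurable (R m) P := fun m => by
    refine AEMeasurable.aestronglyMeasurable ?_
    refine Finset.aemeasurable_fun_sum _ fun j hj => ?_
    have hpt : ∀ i : ℕ, i ≤ m → a + i * ((b - a) / m) ∈ Icc a b := fun i hi => by
      have hm' : (0 : ℝ) < m := by
        exact_mod_cast (Nat.zero_le j).trans_lt (Finset.mem_range.1 hj)
      have h0 := sub_nonneg.2 hab
      have hi' : (i : ℝ) ≤ m := by exact_mod_cast hi
      have h2 : (i : ℝ) * ((b - a) / m) ≤ m * ((b - a) / m) := by gcongr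
      rw [mul_div_cancel₀ _ hm'.ne'] at h2
      have h3 : 0 ≤ (i : ℝ) * ((b - a) / m) := by positivity
      constructor <;> linarith
    have h3 := hpt j (Finset.mem_range.1 hj).le
    have h4 := hpt (j + 1) (Finset.mem_range.1 hj)
    push_cast at h4
    exact ((Finset.aemeasurable_fun_sum _ fun i _ =>
      (hD.aemeasurable_noise hB n k i h4).const_mul _).sub
      (Finset.aemeasurable_fun_sum _ fun i _ =>
      (hD.aemeasurable_noise hB n k i h3).const_mul _)).const_mul _
  refine StepLim.of_tendstoInMeasure hstep hm (tendstoInMeasure_of_tendsto_ae hRm ?_)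
  filter_upwards [hD.cadlagOn_noise hB n] with ω hω
  have hfi : ∀ i, CadlagOn (fun t => c i * D.noise B n k i t ω) (Icc a b) := fun i =>
    (hω k i).comp_continuous (continuous_const_mul (c i))
  have hfc : CadlagOn (f ω) (Icc a b) := CadlagOn.sum _ fun i _ => hfi i
  have h6 := hfc.tendsto_sum_sub_mul hab hwd (by fun_prop)
  have hfa : f ω a = 0 := by
    simp only [hf]
    refine Finset.sum_eq_zero fun i _ => ?_
    rw [hD.noise_eq hk i le_rfl, max_eq_left ((min_le_left _ _).trans h1), sub_self, mul_zero]
  -- The boundary term at `a` vanishes since the noise starts from zero, and the weight at `b` is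
  -- `1`.
  have h7 : w b * f ω b - w a * f ω a -
      ∫ t in a..b, f ω t * (Real.exp (D.r * (b - t)) * (-D.r)) =
      inner ℝ c (noiseVec D B n k ω) := by
    have h8 : inner ℝ c (noiseVec D B n k ω) = compound D.r a b (f ω) := by
      simp only [hf]
      rw [compound_sum _ hab fun i _ => hfi i]
      simp only [PiLp.inner_apply, noiseVec, RCLike.inner_apply, conj_trivial, compound_const_mul]
      exact Finset.sum_congr rfl fun i _ => mul_comm _ _
    rw [h8, hfa, mul_zero, sub_zero, compound]
    have h9 : ∀ t, f ω t * (Real.exp (D.r * (b - t)) * (-D.r)) =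
        (-D.r) * (Real.exp (D.r * (b - t)) * f ω t) := fun t => by ring
    simp_rw [h9]
    rw [intervalIntegral.integral_const_mul]
    simp only [hw, sub_self, mul_zero, Real.exp_zero]
    ring
  rw [← h7]
  exact h6

lemma stepLim_sum_noiseVec (hD : D.IsRegular α)
    (hB : ∀ i, IsDetIntegral P D.L α D.horizon (D.vol i) (B i)) (n : Fin N)
    (v : Fin N → EuclideanSpace ℝ (Fin d))
    (hQ : ∀ k, n ≤ k → ∀ s' ∈ Icc 0 D.horizon, ∀ s ∈ Icc (D.grid k.castSucc) (D.grid k.succ),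
      Real.exp (D.r * (D.horizon - s')) •
        (WithLp.toLp 2 ((v k).ofLp ᵥ* D.σ s) : EuclideanSpace ℝ (Fin d)) ∈ Q) :
    StepLim P D.L α Q (D.start n) D.horizon ⊤
      (fun ω => ∑ k, inner ℝ (v k) (noiseVec D B n k ω)) := by
  -- Clamping at the starting time turns the periods already over into empty intervals; `Fin.ofNat`
  -- extends the grid to all natural indices, only those up to `N` being used.
  set τ : ℕ → ℝ := fun j => max (D.start n) (D.grid (Fin.ofNat (N + 1) j)) with hτ
  set X : ℕ → Ω → ℝ := fun j ω =>
    if h : j < N then inner ℝ (v ⟨j, h⟩) (noiseVec D B n ⟨j, h⟩ ω) else 0 with hX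
  have hg0 : ∀ k : Fin N, D.grid (Fin.ofNat (N + 1) k) = D.grid k.castSucc := fun k => by
    congr 1
    ext
    simp
  have hg1 : ∀ k : Fin N, D.grid (Fin.ofNat (N + 1) (k + 1)) = D.grid k.succ := fun k => by
    congr 1
    ext
    simp [Nat.mod_eq_of_lt (Nat.succ_lt_succ k.2)]
  have hcell : ∀ j < N, StepLim P D.L α Q (τ j) (τ (j + 1)) ⊤ (X j) := by
    intro j hj
    have e0 : τ j = max (D.start n) (D.grid (⟨j, hj⟩ : Fin N).castSucc) :=
      congrArg _ (hg0 ⟨j, hj⟩)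
    have e1 : τ (j + 1) = max (D.start n) (D.grid (⟨j, hj⟩ : Fin N).succ) :=
      congrArg _ (hg1 ⟨j, hj⟩)
    rcases lt_or_ge (⟨j, hj⟩ : Fin N) n with h | h
    · have h1 : D.grid (⟨j, hj⟩ : Fin N).succ ≤ D.start n := hD.strictMono.monotone (by
        rw [Fin.le_def, Fin.val_succ, Fin.val_castSucc]; exact h)
      rw [e0, e1, max_eq_left h1, max_eq_left ((hD.grid_lt _).le.trans h1)]
      refine ((StepLim.of_isStepSum hD.stable (hD.start_nonneg n) IsStepSum.nil).mono zero_le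
        subset_rfl).congr (ae_of_all _ fun ω => ?_)
      simp [hX, hj, hD.noiseVec_of_lt h]
    · have h1 : D.start n ≤ D.grid (⟨j, hj⟩ : Fin N).castSucc := hD.strictMono.monotone h
      rw [e0, e1, max_eq_right h1, max_eq_right (h1.trans (hD.grid_lt _).le)]
      refine (hD.stepLim_noiseVec hB h _ (hQ _ h)).congr (ae_of_all _ fun ω => ?_)
      simp [hX, hj]
  have hsum := StepLim.sum hD.stable (τ := τ) ((hD.start_nonneg n).trans (le_max_left _ _)) N hcell
  have e0 : τ 0 = D.start n := by
    have : D.grid (Fin.ofNat (N + 1) 0) ≤ D.start n := by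
      simp [hD.grid_zero, hD.start_nonneg n]
    exact max_eq_left this
  have e1 : τ N = D.horizon := by
    have : D.grid (Fin.ofNat (N + 1) N) = D.horizon := by
      unfold horizon
      congr 1
      ext
      simp
    simp only [hτ]
    rw [this]
    exact max_eq_right (hD.start_lt n).le
  rw [e0, e1] at hsum
  refine (hsum.mono le_top subset_rfl).congr (ae_of_all _ fun ω => ?_)
  simp only
  rw [Finset.sum_range]
  refine Finset.sum_congr rfl fun k _ => ?_
  simp [hX]

/-- The gain is linear in the positions, with coefficients whose linear combinations are limits of
step sums over the remaining time. -/
theorem exists_coeff (hD : D.IsRegular α) (n : Fin N) :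
    ∃ (A : Fin N → Ω → EuclideanSpace ℝ (Fin d)) (m : Fin N → EuclideanSpace ℝ (Fin d)),
      (∀ k, AEMeasurable (A k) P) ∧ (∀ k < n, (∀ ω, A k ω = 0) ∧ m k = 0) ∧
      (∀ (x : ℝ) (u : Fin N → Ω → EuclideanSpace ℝ (Fin d)), (∀ k, Measurable (u k)) →
        (∃ X, D.IsWealth n x u X) ∧
        ∀ᵐ ω ∂P, D.gain n x u ω = ∑ k, inner ℝ (u k ω) (A k ω + m k)) ∧
      (∀ (k : Fin N), n ≤ k → ∀ (c : EuclideanSpace ℝ (Fin d))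
        (Q : Set (EuclideanSpace ℝ (Fin d))),
        (∀ s' ∈ Icc 0 D.horizon, ∀ s ∈ Icc (D.grid k.castSucc) (D.grid k.succ),
          Real.exp (D.r * (D.horizon - s')) •
            (WithLp.toLp 2 (c.ofLp ᵥ* D.σ s) : EuclideanSpace ℝ (Fin d)) ∈ Q) →
        StepLim P D.L α Q (D.grid k.castSucc) (D.grid k.succ) ⊤
          (fun ω => inner ℝ c (A k ω))) ∧
      (∀ (v : Fin N → EuclideanSpace ℝ (Fin d)) (Q : Set (EuclideanSpace ℝ (Fin d))),
        (∀ k, n ≤ k → ∀ s' ∈ Icc 0 D.horizon, ∀ s ∈ Icc (D.grid k.castSucc) (D.grid k.succ),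
          Real.exp (D.r * (D.horizon - s')) •
            (WithLp.toLp 2 ((v k).ofLp ᵥ* D.σ s) : EuclideanSpace ℝ (Fin d)) ∈ Q) →
        StepLim P D.L α Q (D.start n) D.horizon ⊤ (fun ω => ∑ k, inner ℝ (v k) (A k ω))) := by
  have h := fun i => exists_isDetIntegral hD.stable (hD.horizon_pos n) (hD.uniformContinuous_vol i)
  choose B hB using h
  exact ⟨noiseVec D B n, driftVec D n, hD.aemeasurable_noiseVec hB n,
    fun k hk => ⟨hD.noiseVec_of_lt hk B, hD.driftVec_of_lt hk⟩,
    fun x u hu => ⟨hD.exists_isWealth hB n x hu, hD.gain_eq hB n x hu⟩,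
    fun k hk c Q hQ => hD.stepLim_noiseVec hB hk c hQ,
    fun v Q hQ => hD.stepLim_sum_noiseVec hB n v hQ⟩

end MeanRiskProblem.IsRegular

end

section

/-! ### Conditioning a function of an independent pair -/

section freezing

variable {Ω S V : Type*} {mΩ : MeasurableSpace Ω} {mS : MeasurableSpace S} {mV : MeasurableSpace V}
  {P : Measure Ω} [IsProbabilityMeasure P] {X : Ω → S} {Z : Ω → V} {Y : Ω → ℝ} {h : S × V → ℝ}

/-- Freezing: by independence the joint law of `X` and `Y` disintegrates as the law of `X` followed
by the law of `h (x, Z)`, and disintegrations are almost everywhere unique. -/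
lemma condDistrib_ae_eq_of_indepFun (hX : Measurable X) (hZ : AEMeasurable Z P)
    (hind : IndepFun X Z P) (hh : Measurable h) (hY : Y =ᵐ[P] fun ω => h (X ω, Z ω)) :
    ∀ᵐ ω ∂P, condDistrib Y X P (X ω) = P.map (fun ω' => h (X ω, Z ω')) := by
  have hνp : IsProbabilityMeasure (P.map Z) := Measure.isProbabilityMeasure_map hZ
  have hμp : IsProbabilityMeasure (P.map X) := Measure.isProbabilityMeasure_map hX.aemeasurable
  have hhs : ∀ s, Measurable fun z => h (s, z) := fun s => hh.comp measurable_prodMk_left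
  set κ : Kernel S ℝ := ⟨fun s => (P.map Z).map fun z => h (s, z), by
    refine Measure.measurable_of_measurable_coe _ fun t ht => ?_
    simp_rw [Measure.map_apply (hhs _) ht]
    exact measurable_measure_prodMk_left (hh ht)⟩ with hκ
  have hκa : ∀ s, κ s = (P.map Z).map fun z => h (s, z) := fun s => rfl
  have hκm : IsMarkovKernel κ := ⟨fun s => by
    rw [hκa]; exact Measure.isProbabilityMeasure_map (hhs s).aemeasurable⟩
  have hYm : AEMeasurable Y P :=
    (hh.comp_aemeasurable (hX.aemeasurable.prodMk hZ)).congr hY.symm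
  have hF : Measurable fun p : S × V => (p.1, h p) := measurable_fst.prodMk hh
  have key : P.map (fun ω => (X ω, Y ω)) = P.map X ⊗ₘ κ := by
    have h1 : P.map (fun ω => (X ω, Y ω)) =
        ((P.map X).prod (P.map Z)).map fun p => (p.1, h p) := by
      rw [← (indepFun_iff_map_prod_eq_prod_map_map hX.aemeasurable hZ).1 hind,
        AEMeasurable.map_map_of_aemeasurable hF.aemeasurable (hX.aemeasurable.prodMk hZ)]
      refine Measure.map_congr ?_
      filter_upwards [hY] with ω hω
      simp [hω]
    rw [h1]
    ext t ht
    rw [Measure.map_apply hF ht, Measure.prod_apply (hF ht), Measure.compProd_apply ht]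
    refine lintegral_congr fun s => ?_
    rw [hκa, Measure.map_apply (hhs s) (measurable_prodMk_left ht)]
    rfl
  have h2 := condDistrib_ae_eq_of_measure_eq_compProd X hYm key
  filter_upwards [ae_of_ae_map hX.aemeasurable h2] with ω hω
  rw [hω, hκa, AEMeasurable.map_map_of_aemeasurable (hhs _).aemeasurable hZ]
  rfl

/-- Fubini with a bound that is uniform over the frozen argument. -/
lemma integrable_comp_of_indepFun (hX : Measurable X) (hZ : AEMeasurable Z P)
    (hind : IndepFun X Z P) (hh : Measurable h) {C : ℝ≥0∞} (hC : C ≠ ⊤)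
    (hb : ∀ ω, ∫⁻ ω', ‖h (X ω, Z ω')‖ₑ ∂P ≤ C) :
    Integrable (fun ω => h (X ω, Z ω)) P := by
  have hνp : IsProbabilityMeasure (P.map Z) := Measure.isProbabilityMeasure_map hZ
  have hXZ : AEMeasurable (fun ω => (X ω, Z ω)) P := hX.aemeasurable.prodMk hZ
  refine ⟨(hh.comp_aemeasurable hXZ).aestronglyMeasurable, ?_⟩
  have h1 : ∫⁻ ω, ‖h (X ω, Z ω)‖ₑ ∂P = ∫⁻ p, ‖h p‖ₑ ∂(P.map X).prod (P.map Z) := by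
    rw [← (indepFun_iff_map_prod_eq_prod_map_map hX.aemeasurable hZ).1 hind,
      lintegral_map' hh.enorm.aemeasurable hXZ]
  rw [HasFiniteIntegral, h1, lintegral_prod _ hh.enorm.aemeasurable,
    lintegral_map hh.enorm.lintegral_prod_right' hX]
  refine lt_of_le_of_lt (lintegral_mono fun ω => ?_) (b := ∫⁻ _, C ∂P) (by simpa using hC.lt_top)
  refine le_trans (le_of_eq ?_) (hb ω)
  exact lintegral_map' (hh.enorm.comp measurable_prodMk_left).aemeasurable hZ

end freezing

section freezing

variable {Ω V V' : Type*} {m mΩ : MeasurableSpace Ω} {mV : MeasurableSpace V}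
  {mV' : MeasurableSpace V'} {P : Measure Ω} [IsProbabilityMeasure P] {Z : Ω → V} {Y : Ω → ℝ}
  {h : V' × V → ℝ} {ξ : Ω → V'}

/-- Conditioning on a σ-algebra `m` is conditioning on the identity map into `Ω` equipped with `m`,
the form used in `condLaw`. -/
lemma indepFun_id_of_measure_inter
    (hind : ∀ A, MeasurableSet[m] A → ∀ B, MeasurableSet B →
      P (A ∩ Z ⁻¹' B) = P A * P (Z ⁻¹' B)) :
    @IndepFun Ω Ω V mΩ m mV id Z P := by
  rw [indepFun_iff_measure_inter_preimage_eq_mul]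
  exact fun s t hs ht => hind s hs t ht

lemma condLaw_ae_eq (hm : m ≤ mΩ) (hZ : AEMeasurable Z P)
    (hind : ∀ A, MeasurableSet[m] A → ∀ B, MeasurableSet B →
      P (A ∩ Z ⁻¹' B) = P A * P (Z ⁻¹' B)) (hh : Measurable h) (hξ : Measurable[m] ξ)
    (hY : Y =ᵐ[P] fun ω => h (ξ ω, Z ω)) :
    ∀ᵐ ω ∂P, condLaw m P Y ω = P.map (fun ω' => h (ξ ω, Z ω')) := by
  have hh' : @Measurable (Ω × V) ℝ (@Prod.instMeasurableSpace Ω V m mV) _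
      (fun p : Ω × V => h (ξ p.1, p.2)) :=
    hh.comp ((hξ.comp (@measurable_fst Ω V m mV)).prodMk (@measurable_snd Ω V m mV))
  exact condDistrib_ae_eq_of_indepFun (mS := m) (X := id) (h := fun p : Ω × V => h (ξ p.1, p.2))
    (measurable_id'' hm) hZ (indepFun_id_of_measure_inter hind) hh' hY

lemma condExp_comp_ae_eq (hm : m ≤ mΩ) (hZ : AEMeasurable Z P)
    (hind : ∀ A, MeasurableSet[m] A → ∀ B, MeasurableSet B →
      P (A ∩ Z ⁻¹' B) = P A * P (Z ⁻¹' B)) (hh : Measurable h) (hξ : Measurable[m] ξ)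
    (hY : Y =ᵐ[P] fun ω => h (ξ ω, Z ω)) {f : ℝ → ℝ} (hf : Continuous f)
    (hint : Integrable (fun ω => f (Y ω)) P) :
    ∀ᵐ ω ∂P, (P[fun ω => f (Y ω) | m]) ω = ∫ ω', f (h (ξ ω, Z ω')) ∂P := by
  have hYm : AEMeasurable Y P := (hh.comp_aemeasurable
    ((hξ.mono hm le_rfl).aemeasurable.prodMk hZ)).congr hY.symm
  have h1 := condExp_ae_eq_integral_condDistrib (mβ := m) (X := id) (measurable_id'' hm) hYm
    hf.stronglyMeasurable hint
  rw [MeasurableSpace.comap_id] at h1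
  filter_upwards [h1, condLaw_ae_eq hm hZ hind hh hξ hY] with ω h2 h3
  rw [h2]
  change ∫ y, f y ∂(condLaw m P Y ω) = _
  have hg : AEMeasurable (fun ω' => h (ξ ω, Z ω')) P :=
    (hh.comp measurable_prodMk_left).comp_aemeasurable hZ
  rw [h3, integral_map hg hf.aestronglyMeasurable]

lemma integrable_comp_of_measure_inter (hm : m ≤ mΩ) (hZ : AEMeasurable Z P)
    (hind : ∀ A, MeasurableSet[m] A → ∀ B, MeasurableSet B →
      P (A ∩ Z ⁻¹' B) = P A * P (Z ⁻¹' B)) (hh : Measurable h) (hξ : Measurable[m] ξ)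
    (hY : Y =ᵐ[P] fun ω => h (ξ ω, Z ω)) {f : ℝ → ℝ} (hf : Continuous f) {C : ℝ≥0∞} (hC : C ≠ ⊤)
    (hb : ∀ ω, ∫⁻ ω', ‖f (h (ξ ω, Z ω'))‖ₑ ∂P ≤ C) :
    Integrable (fun ω => f (Y ω)) P := by
  have h1 : Integrable (fun ω => f (h (ξ ω, Z ω))) P := by
    refine integrable_comp_of_indepFun (h := fun p => f (h p)) (hξ.mono hm le_rfl) hZ ?_
      (hf.measurable.comp hh) hC hb
    rw [indepFun_iff_measure_inter_preimage_eq_mul]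
    exact fun s t hs ht => hind _ (hξ hs) t ht
  refine h1.congr ?_
  filter_upwards [hY] with ω hω
  rw [hω]

end freezing

end

/-! ### The gain as an affine function of the current position. -/

section

namespace MeanRiskProblem.IsRegular

variable {Ω : Type*} {mΩ : MeasurableSpace Ω} {P : Measure Ω} [IsProbabilityMeasure P] {d N : ℕ}
  {D : MeanRiskProblem P d N} {α : ℝ} {n k : Fin N}

/-- Given deterministic positions after the `n`-th period, the gain is an affine function of the
position in the `n`-th period with random coefficients that are independent of the past. -/
theorem exists_affine (hD : D.IsRegular α) (n : Fin N) (v : Fin N → EuclideanSpace ℝ (Fin d)) :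
    ∃ (Z : Ω → EuclideanSpace ℝ (Fin d) × ℝ) (μ₁ : EuclideanSpace ℝ (Fin d)) (μ₂ : ℝ),
      AEMeasurable Z P ∧
      (∀ A, MeasurableSet[D.𝓕 (D.start n)] A → ∀ B, MeasurableSet B →
        P (A ∩ Z ⁻¹' B) = P A * P (Z ⁻¹' B)) ∧
      (∀ (x : ℝ) (u : Fin N → Ω → EuclideanSpace ℝ (Fin d)), (∀ k, Measurable (u k)) →
        (∀ k, n < k → u k =ᵐ[P] fun _ => v k) →
        (∃ X, D.IsWealth n x u X) ∧
        D.gain n x u =ᵐ[P] fun ω => inner ℝ (u n ω) (Z ω).1 + (Z ω).2) ∧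
      (∀ (c : EuclideanSpace ℝ (Fin d)) (Q : Set (EuclideanSpace ℝ (Fin d))),
        (∀ s' ∈ Icc 0 D.horizon, ∀ s ∈ Icc (D.grid n.castSucc) (D.grid n.succ),
          Real.exp (D.r * (D.horizon - s')) •
            (WithLp.toLp 2 (c.ofLp ᵥ* D.σ s) : EuclideanSpace ℝ (Fin d)) ∈ Q) →
        StepLim P D.L α Q (D.grid n.castSucc) (D.grid n.succ) ⊤
          (fun ω => inner ℝ c ((Z ω).1 - μ₁))) ∧
      (∀ (c : EuclideanSpace ℝ (Fin d)) (Q : Set (EuclideanSpace ℝ (Fin d))),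
        (∀ k, n ≤ k → ∀ s' ∈ Icc 0 D.horizon, ∀ s ∈ Icc 0 D.horizon,
          Real.exp (D.r * (D.horizon - s')) •
            (WithLp.toLp 2 ((Function.update v n c k).ofLp ᵥ* D.σ s) :
              EuclideanSpace ℝ (Fin d)) ∈ Q) →
        StepLim P D.L α Q (D.start n) D.horizon ⊤
          (fun ω => inner ℝ c ((Z ω).1 - μ₁) + ((Z ω).2 - μ₂))) := by
  obtain ⟨A, m, hAm, hlt, hgain, hstep, hsum⟩ := hD.exists_coeff n
  have hin : ∀ c : EuclideanSpace ℝ (Fin d), Measurable fun x : EuclideanSpace ℝ (Fin d) =>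
    (inner ℝ c x : ℝ) := fun c => by fun_prop
  set Z : Ω → EuclideanSpace ℝ (Fin d) × ℝ := fun ω =>
    (A n ω + m n, ∑ k ∈ Finset.univ.erase n, inner ℝ (v k) (A k ω + m k)) with hZ
  have hZm : AEMeasurable Z P := ((hAm n).add_const _).prodMk
    (Finset.aemeasurable_fun_sum _ fun k _ => (hin _).comp_aemeasurable ((hAm k).add_const _))
  refine ⟨Z, m n, ∑ k ∈ Finset.univ.erase n, inner ℝ (v k) (m k), hZm, fun F hF G hG => ?_,
    fun x u hu huv => ?_, fun c Q hQ => ?_, fun c Q hQ => ?_⟩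
  · refine measure_inter_preimage_of_charFunDual (D.𝓕.le _) hZm (fun g hg hg1 l => ?_) hF hG
    -- A functional of the pair `Z` splits into an inner product with `θ` and a multiple of the
    -- scalar part. Up to a constant it is therefore the noise of the deterministic strategy `v'`
    -- below, hence a step limit and independent of the past.
    set θ : EuclideanSpace ℝ (Fin d) := (InnerProductSpace.toDual ℝ _).symm
      (l.comp (ContinuousLinearMap.inl ℝ (EuclideanSpace ℝ (Fin d)) ℝ)) with hθ
    have h1 : ∀ p : EuclideanSpace ℝ (Fin d) × ℝ, l p = inner ℝ θ p.1 + p.2 * l (0, 1) := by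
      intro p
      have e1 : inner ℝ θ p.1 = l (p.1, 0) := by
        rw [hθ, InnerProductSpace.toDual_symm_apply]; rfl
      have e2 : p = (p.1, 0) + p.2 • ((0 : EuclideanSpace ℝ (Fin d)), (1 : ℝ)) := by
        ext <;> simp
      rw [e1]
      conv_lhs => rw [e2]
      rw [map_add, map_smul, smul_eq_mul]
    set v' : Fin N → EuclideanSpace ℝ (Fin d) :=
      Function.update (fun k => l (0, 1) • v k) n θ with hv'
    have h2 : ∀ ω, l (Z ω) = (∑ k, inner ℝ (v' k) (A k ω)) + ∑ k, inner ℝ (v' k) (m k) := by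
      intro ω
      rw [h1, ← Finset.sum_add_distrib, ← Finset.add_sum_erase _ _ (Finset.mem_univ n)]
      simp only [hv', Function.update_self, hZ, inner_add_right]
      congr 1
      rw [Finset.sum_mul]
      refine Finset.sum_congr rfl fun k hk => ?_
      rw [Function.update_of_ne (Finset.ne_of_mem_erase hk), real_inner_smul_left,
        real_inner_smul_left]
      ring
    have h3 := hsum v' univ fun _ _ _ _ _ _ => mem_univ _
    have h4 := h3.integral_mul_exp hD.stable (hD.start_nonneg n) hg (K := 1) hg1 1
    set κ : ℝ := ∑ k, inner ℝ (v' k) (m k) with hκ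
    have h5 : ∀ ω, Complex.exp (l (Z ω) * Complex.I) =
        Complex.exp (((1 : ℝ) * ∑ k, inner ℝ (v' k) (A k ω) : ℝ) * Complex.I) *
          Complex.exp (κ * Complex.I) := fun ω => by
      rw [h2, ← Complex.exp_add]
      congr 1
      push_cast
      ring
    simp_rw [h5, ← mul_assoc, integral_mul_const, h4, mul_assoc]
  · obtain ⟨h1, h2⟩ := hgain x u hu
    refine ⟨h1, ?_⟩
    have h3 : ∀ᵐ ω ∂P, ∀ k, n < k → u k ω = v k := by
      refine ae_all_iff.2 fun k => ?_
      by_cases hk : n < k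
      · filter_upwards [huv k hk] with ω hω _ using hω
      · exact ae_of_all _ fun ω h => absurd h hk
    filter_upwards [h2, h3] with ω h4 h5
    rw [h4, ← Finset.add_sum_erase _ _ (Finset.mem_univ n)]
    congr 1
    refine Finset.sum_congr rfl fun k hk => ?_
    rcases lt_or_gt_of_ne (Finset.ne_of_mem_erase hk) with h | h
    · rw [(hlt k h).1, (hlt k h).2]; simp
    · rw [h5 k h]
  · refine (hstep n le_rfl c Q hQ).congr (ae_of_all _ fun ω => ?_)
    simp [hZ]
  · refine (hsum (Function.update v n c) Q fun k hk s' hs' s hs => hQ k hk s' hs' s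
      ⟨(hD.grid_nonneg _).trans hs.1, hs.2.trans (hD.grid_le _)⟩).congr (ae_of_all _ fun ω => ?_)
    simp only
    rw [← Finset.add_sum_erase _ _ (Finset.mem_univ n)]
    simp only [hZ, Function.update_self, add_sub_cancel_right]
    congr 1
    rw [← Finset.sum_sub_distrib]
    refine Finset.sum_congr rfl fun k hk => ?_
    rw [Function.update_of_ne (Finset.ne_of_mem_erase hk), inner_add_right]
    ring

end MeanRiskProblem.IsRegular

/-! ### One-dimensional projections up to a scale -/

namespace IsStableLevy

variable {Ω : Type*} {mΩ : MeasurableSpace Ω} {P : Measure Ω} [IsProbabilityMeasure P] {d : ℕ}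
  {𝓕 : Filtration ℝ mΩ} {α : ℝ} {L : ℝ → Ω → EuclideanSpace ℝ (Fin d)}

local notation "φ" => charFun (P.map (L 1))

/-- Symmetry makes `φ` real, and stability makes it the square of a real number. -/
lemma charFun_eq_norm_of_symm (hL : IsStableLevy P 𝓕 α L)
    (hsymm : P.map (fun ω => -L 1 ω) = P.map (L 1)) (ξ : EuclideanSpace ℝ (Fin d)) :
    charFun (P.map (L 1)) ξ = ‖charFun (P.map (L 1)) ξ‖ := by
  have hreal : ∀ η, (starRingEnd ℂ) (charFun (P.map (L 1)) η) = charFun (P.map (L 1)) η := by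
    intro η
    rw [← charFun_neg]
    have hm := (hL.measurable_at zero_le_one)
    conv_rhs => rw [← hsymm]
    have hm' : AEMeasurable (fun ω => -L 1 ω) P := hm.neg.aemeasurable
    rw [charFun_apply, charFun_apply, integral_map hm.aemeasurable (by fun_prop),
      integral_map hm' (by fun_prop)]
    simp
  have h2 := hL.charFun_mul (s := 1 / 2) (t := 1 / 2) (by norm_num) (by norm_num) ξ
  rw [show (1 / 2 + 1 / 2 : ℝ) = 1 by norm_num, Real.one_rpow, one_smul] at h2
  obtain ⟨y, hy⟩ := Complex.conj_eq_iff_real.1 (hreal (((1 / 2 : ℝ) ^ (1 / α)) • ξ))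
  rw [← h2, hy, ← Complex.ofReal_mul, Complex.norm_real, Real.norm_of_nonneg (mul_self_nonneg y)]

/-- A positive `φ` is determined on each line by its modulus at a single point, so a ratio of
logarithms gives the scale. -/
lemma exists_scale_of_symm (hL : IsStableLevy P 𝓕 α L)
    (hsymm : P.map (fun ω => -L 1 ω) = P.map (L 1)) {a₀ : EuclideanSpace ℝ (Fin d)}
    (ha₀ : ‖charFun (P.map (L 1)) a₀‖ < 1) (e : EuclideanSpace ℝ (Fin d)) :
    ∃ s : ℝ, 0 ≤ s ∧ ∀ θ : ℝ,
      charFun (P.map (L 1)) (θ • e) = charFun (P.map (L 1)) ((θ * s) • a₀) := by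
  have hα := hL.alpha_pos
  have hprob := hL.isProbabilityMeasure_map zero_le_one
  have habs : ∀ (θ : ℝ) η, ‖charFun (P.map (L 1)) (θ • η)‖ =
      ‖charFun (P.map (L 1)) η‖ ^ (|θ| ^ α) := by
    intro θ η
    rw [← hL.norm_charFun_smul (abs_nonneg θ)]
    rcases abs_choice θ with h | h
    · rw [h]
    · rw [h, neg_smul, charFun_neg, RCLike.norm_conj]
  have h0 : 0 < ‖charFun (P.map (L 1)) a₀‖ := norm_pos_iff.2 (hL.charFun_ne_zero a₀)
  have he0 : 0 < ‖charFun (P.map (L 1)) e‖ := norm_pos_iff.2 (hL.charFun_ne_zero e)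
  have he1 : ‖charFun (P.map (L 1)) e‖ ≤ 1 := norm_charFun_le_one _
  have hlog := Real.log_neg h0 ha₀
  have hq : 0 ≤ Real.log ‖charFun (P.map (L 1)) e‖ / Real.log ‖charFun (P.map (L 1)) a₀‖ :=
    div_nonneg_of_nonpos (Real.log_nonpos he0.le he1) hlog.le
  refine ⟨_, Real.rpow_nonneg hq (1 / α), fun θ => ?_⟩
  rw [hL.charFun_eq_norm_of_symm hsymm, hL.charFun_eq_norm_of_symm hsymm ((_ * _) • a₀), habs, habs,
    abs_mul, abs_of_nonneg (Real.rpow_nonneg hq _),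
    Real.mul_rpow (abs_nonneg _) (Real.rpow_nonneg hq _), ← Real.rpow_mul hq,
    one_div_mul_cancel hα.ne', Real.rpow_one, Real.rpow_def_of_pos he0, Real.rpow_def_of_pos h0]
  congr 2
  rw [mul_left_comm, mul_div_cancel₀ _ hlog.ne, mul_comm]

end IsStableLevy

namespace MeanRiskProblem.IsRegular

variable {Ω : Type*} {mΩ : MeasurableSpace Ω} {P : Measure Ω} [IsProbabilityMeasure P] {d N : ℕ}
  {D : MeanRiskProblem P d N} {α M : ℝ}

/-- A set of positions for which all the projections of the noise agree up to a scale. -/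
theorem exists_cone (hD : D.IsRegular α)
    (hσpos : ∀ t ∈ Icc 0 D.horizon, (D.σ t).PosDef) (hM : 0 < M)
    (hK : (P.map (fun ω => -D.L 1 ω) = P.map (D.L 1) ∧ D.K = {v | ∀ i, |v i| ≤ M}) ∨
      (d = 1 ∧ D.K = {v | ∀ i, 0 ≤ v i ∧ v i ≤ M})) :
    ∃ a₀ ∈ D.K, ∃ Q : Set (EuclideanSpace ℝ (Fin d)),
      (∀ e ∈ Q, ∃ s : ℝ, 0 ≤ s ∧ ∀ θ : ℝ,
        charFun (P.map (D.L 1)) (θ • e) = charFun (P.map (D.L 1)) ((θ * s) • a₀)) ∧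
      ∀ c ∈ D.K, ∀ y : ℝ, ∀ s ∈ Icc 0 D.horizon,
        Real.exp y • (WithLp.toLp 2 (c.ofLp ᵥ* D.σ s) : EuclideanSpace ℝ (Fin d)) ∈ Q := by
  have hprob := hD.stable.isProbabilityMeasure_map zero_le_one
  rcases hK with ⟨hsymm, hK⟩ | ⟨rfl, hK⟩
  -- If `φ` has modulus one everywhere then the noise vanishes, and scale `0` works with `a₀ = 0`.
  · by_cases hdeg : ∀ ξ, ‖charFun (P.map (D.L 1)) ξ‖ = 1
    · refine ⟨0, by simp [hK, hM.le], univ, fun e _ => ⟨0, le_rfl, fun θ => ?_⟩,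
        fun _ _ _ _ _ => mem_univ _⟩
      rw [hD.stable.charFun_eq_one_of_norm_eq_one (hdeg e)]
      simp
    · push Not at hdeg
      obtain ⟨ξ, hξ⟩ := hdeg
      have hξ1 : ‖charFun (P.map (D.L 1)) ξ‖ < 1 := lt_of_le_of_ne (norm_charFun_le_one _) hξ
      -- Shrinks `ξ` into the box; adding `1` keeps the denominator positive.
      set y : ℝ := M / (‖ξ‖ + 1) with hy
      have hy0 : 0 < y := by positivity
      refine ⟨y • ξ, ?_, univ, fun e _ => hD.stable.exists_scale_of_symm hsymm ?_ e,
        fun _ _ _ _ _ => mem_univ _⟩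
      · rw [hK]
        intro i
        have h1 : |ξ i| ≤ ‖ξ‖ := by simpa using PiLp.norm_apply_le ξ i
        simp only [PiLp.smul_apply, smul_eq_mul, abs_mul]
        rw [abs_of_pos hy0, hy, div_mul_eq_mul_div, div_le_iff₀ (by positivity)]
        nlinarith
      · rw [hD.stable.norm_charFun_smul hy0.le]
        exact Real.rpow_lt_one (norm_nonneg _) hξ1 (Real.rpow_pos_of_pos hy0 _)
  -- In one dimension nonnegative multiples of a single direction suffice. The volatility is
  -- positive, so positions without short selling keep all coefficients nonnegative; no symmetry of
  -- the noise is needed.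
  · refine ⟨WithLp.toLp 2 fun _ => M, by simp [hK, hM.le], {e | 0 ≤ e 0}, fun e he => ?_, ?_⟩
    · refine ⟨e 0 / M, div_nonneg he hM.le, fun θ => ?_⟩
      congr 1
      ext i
      rw [Subsingleton.elim i 0]
      simp
      field_simp
    · intro c hc y s hs
      rw [hK] at hc
      have h1 := (hσpos s hs).diag_pos (i := 0)
      simp [Matrix.vecMul, dotProduct]
      have := (hc 0).1
      positivity

end MeanRiskProblem.IsRegular

end

/-! ### Laws of step limits, non-degeneracy, and the gain as a scaled and shifted projection. -/

section

section laws

variable {Ω : Type*} {mΩ : MeasurableSpace Ω} {P : Measure Ω} [IsProbabilityMeasure P] {d : ℕ}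
  {𝓕 : Filtration ℝ mΩ} {α : ℝ} {L : ℝ → Ω → EuclideanSpace ℝ (Fin d)}

lemma charFun_map_real {X : Ω → ℝ} (hX : AEMeasurable X P) (θ : ℝ) :
    charFun (P.map X) θ = ∫ ω, Complex.exp ((θ * X ω : ℝ) * Complex.I) ∂P := by
  rw [charFun_apply, integral_map hX (by fun_prop)]
  simp

lemma charFun_map_smul_inner (hL : IsStableLevy P 𝓕 α L) (a : EuclideanSpace ℝ (Fin d))
    (s θ : ℝ) : charFun (P.map fun ω => s * inner ℝ a (L 1 ω)) θ =
      charFun (P.map (L 1)) ((θ * s) • a) := by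
  have hm := hL.measurable_at zero_le_one
  have hm' : Measurable fun ω => s * inner ℝ a (L 1 ω) := by fun_prop
  rw [charFun_map_real hm'.aemeasurable, charFun_apply, integral_map hm.aemeasurable (by fun_prop)]
  refine integral_congr_ae (ae_of_all _ fun ω => ?_)
  simp only
  rw [real_inner_smul_right, real_inner_comm]
  congr 3
  ring

/-- The nonvanishing of the characteristic function at `1` is recorded because the scale contains
its logarithm, which has to be continuous in the position. -/
lemma StepLim.map_eq (hL : IsStableLevy P 𝓕 α L) {a b : ℝ} (ha : 0 ≤ a)
    {Q : Set (EuclideanSpace ℝ (Fin d))} {κ : ℝ≥0∞} {X : Ω → ℝ} {a₀ : EuclideanSpace ℝ (Fin d)}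
    (hQ : ∀ e ∈ Q, ∃ s : ℝ, 0 ≤ s ∧ ∀ θ : ℝ,
      charFun (P.map (L 1)) (θ • e) = charFun (P.map (L 1)) ((θ * s) • a₀))
    (h : StepLim P L α Q a b κ X) :
    (∫ ω, Complex.exp (((1 : ℝ) * X ω : ℝ) * Complex.I) ∂P) ≠ 0 ∧
    0 ≤ (Real.log ‖∫ ω, Complex.exp (((1 : ℝ) * X ω : ℝ) * Complex.I) ∂P‖ /
        Real.log ‖charFun (P.map (L 1)) a₀‖) ^ (1 / α) ∧
    P.map X = P.map fun ω =>
      (Real.log ‖∫ ω, Complex.exp (((1 : ℝ) * X ω : ℝ) * Complex.I) ∂P‖ /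
        Real.log ‖charFun (P.map (L 1)) a₀‖) ^ (1 / α) * inner ℝ a₀ (L 1 ω) := by
  obtain ⟨s, hs0, hs, hθ⟩ := h.exists_scale hL ha hQ
  have hm := hL.measurable_at zero_le_one
  have hprob := Measure.isProbabilityMeasure_map (μ := P) h.1
  have hm' : Measurable fun ω => s * inner ℝ a₀ (L 1 ω) := by fun_prop
  have hprob' := Measure.isProbabilityMeasure_map (μ := P) hm'.aemeasurable
  refine ⟨?_, ?_, ?_⟩
  · rw [hθ]; exact hL.charFun_ne_zero _
  · rw [← hs]; exact hs0
  · rw [← hs]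
    refine Measure.ext_of_charFun (funext fun θ => ?_)
    rw [charFun_map_real h.1, charFun_map_smul_inner hL, hθ]

/-- If the modulus were `1`, then `φ` would be `1` on the whole line through `a`, so the projection
would be zero. -/
lemma IsStableLevy.norm_charFun_lt_one (hL : IsStableLevy P 𝓕 α L)
    (hnd : ∀ a : EuclideanSpace ℝ (Fin d), a ≠ 0 → ¬ ∀ᵐ ω ∂P, inner ℝ a (L 1 ω) = 0)
    {a : EuclideanSpace ℝ (Fin d)} (ha : a ≠ 0) : ‖charFun (P.map (L 1)) a‖ < 1 := by
  have hprob := hL.isProbabilityMeasure_map zero_le_one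
  refine lt_of_le_of_ne (norm_charFun_le_one _) fun h => hnd a ha ?_
  have hm := hL.measurable_at zero_le_one
  have hm' : Measurable fun ω => (1 : ℝ) * inner ℝ a (L 1 ω) := by fun_prop
  have hprob' := Measure.isProbabilityMeasure_map (μ := P) hm'.aemeasurable
  have h1 : (P.map fun ω => (1 : ℝ) * inner ℝ a (L 1 ω)) = Measure.dirac 0 := by
    refine Measure.ext_of_charFun (funext fun θ => ?_)
    rw [charFun_map_smul_inner hL, hL.charFun_eq_one_of_norm_eq_one h, charFun_dirac]
    simp
  have h2 : ∀ᵐ x ∂(P.map fun ω => (1 : ℝ) * inner ℝ a (L 1 ω)), x = 0 := by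
    rw [h1, ae_dirac_eq]; rfl
  filter_upwards [ae_of_ae_map hm'.aemeasurable h2] with ω hω
  simpa using hω

end laws

namespace MeanRiskProblem.IsRegular

variable {Ω : Type*} {mΩ : MeasurableSpace Ω} {P : Measure Ω} [IsProbabilityMeasure P] {d N : ℕ}
  {D : MeanRiskProblem P d N} {α M : ℝ}

lemma vecMul_ne_zero (hσpos : ∀ t ∈ Icc 0 D.horizon, (D.σ t).PosDef)
    {e : EuclideanSpace ℝ (Fin d)} (he : e ≠ 0) {s : ℝ} (hs : s ∈ Icc 0 D.horizon) :
    (WithLp.toLp 2 (e.ofLp ᵥ* D.σ s) : EuclideanSpace ℝ (Fin d)) ≠ 0 := by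
  intro h
  have h1 : e.ofLp ᵥ* D.σ s = 0 := by
    have := congrArg WithLp.ofLp h
    simpa using this
  have h2 : IsUnit (D.σ s) := (hσpos s hs).isUnit
  have h3 := Matrix.vecMul_injective_of_isUnit h2 (h1.trans (Matrix.zero_vecMul _).symm)
  exact he (by ext i; simp [h3])

/-- The coefficients contributed by the period form a compact set avoiding the origin, so `‖φ‖` has
a maximum `q < 1` there. The projection then has a characteristic function of modulus at most `q ^
(t_{n+1} - t_n) < 1` at `1`, whereas that of a constant has modulus `1`. -/
lemma not_ae_inner_eq (hD : D.IsRegular α)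
    (hσpos : ∀ t ∈ Icc 0 D.horizon, (D.σ t).PosDef)
    (hnd : ∀ a : EuclideanSpace ℝ (Fin d), a ≠ 0 → ¬ ∀ᵐ ω ∂P, inner ℝ a (D.L 1 ω) = 0)
    {n : Fin N} {Y : Ω → EuclideanSpace ℝ (Fin d)} {μ₁ : EuclideanSpace ℝ (Fin d)}
    (hY : ∀ (c : EuclideanSpace ℝ (Fin d)) (Q : Set (EuclideanSpace ℝ (Fin d))),
        (∀ s' ∈ Icc 0 D.horizon, ∀ s ∈ Icc (D.grid n.castSucc) (D.grid n.succ),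
          Real.exp (D.r * (D.horizon - s')) •
            (WithLp.toLp 2 (c.ofLp ᵥ* D.σ s) : EuclideanSpace ℝ (Fin d)) ∈ Q) →
        StepLim P D.L α Q (D.grid n.castSucc) (D.grid n.succ) ⊤
          (fun ω => inner ℝ c (Y ω - μ₁)))
    {e : EuclideanSpace ℝ (Fin d)} (he : e ≠ 0) (y : ℝ) : ¬ ∀ᵐ ω ∂P, inner ℝ e (Y ω) = y := by
  intro hae
  have hprob := hD.stable.isProbabilityMeasure_map zero_le_one
  set S : Set (ℝ × ℝ) := Icc 0 D.horizon ×ˢ Icc (D.grid n.castSucc) (D.grid n.succ) with hS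
  set g : ℝ × ℝ → EuclideanSpace ℝ (Fin d) := fun p => Real.exp (D.r * (D.horizon - p.1)) •
    WithLp.toLp 2 (e.ofLp ᵥ* D.σ p.2) with hg
  have hsub : ∀ p ∈ S, p.2 ∈ Icc 0 D.horizon := fun p hp =>
    ⟨(hD.grid_nonneg _).trans hp.2.1, hp.2.2.trans (hD.grid_le _)⟩
  have hσc : ContinuousOn (fun p : ℝ × ℝ => D.σ p.2) S :=
    hD.cont_σ.comp continuous_snd.continuousOn hsub
  have hgc : ContinuousOn g S := by
    have h1 : Continuous fun p : ℝ × ℝ => Real.exp (D.r * (D.horizon - p.1)) := by fun_prop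
    refine h1.continuousOn.smul ?_
    refine (PiLp.continuous_toLp 2 _).comp_continuousOn ?_
    exact (Continuous.matrix_vecMul continuous_const continuous_id).comp_continuousOn hσc
  have hφc : ContinuousOn (fun p => ‖charFun (P.map (D.L 1)) (g p)‖) S :=
    (hD.stable.continuous_charFun.comp_continuousOn hgc).norm
  obtain ⟨p, hp, hmax⟩ := (isCompact_Icc.prod isCompact_Icc).exists_isMaxOn
    (s := S) ⟨(0, D.grid n.castSucc), ⟨left_mem_Icc.2 hD.horizon_nonneg,
      left_mem_Icc.2 (hD.grid_lt n).le⟩⟩ hφc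
  have hg0 : g p ≠ 0 := smul_ne_zero (Real.exp_pos _).ne' (vecMul_ne_zero hσpos he (hsub p hp))
  have h1 := hD.stable.norm_charFun_lt_one hnd hg0
  have hq : 0 < ‖charFun (P.map (D.L 1)) (g p)‖ := norm_pos_iff.2 (hD.stable.charFun_ne_zero _)
  have h2 := hY e (g '' S) fun s' hs' s hs => ⟨(s', s), ⟨hs', hs⟩, rfl⟩
  have h3 := h2.norm_integral_exp_le hD.stable (hD.grid_nonneg _) hq (by
    rintro _ ⟨x, hx, rfl⟩
    exact hmax hx)
  have h4 := Real.rpow_lt_one hq.le h1 (sub_pos.2 (hD.grid_lt n))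
  have h5 : ∫ ω, Complex.exp (((1 : ℝ) * inner ℝ e (Y ω - μ₁) : ℝ) * Complex.I) ∂P =
      Complex.exp (((1 : ℝ) * (y - inner ℝ e μ₁) : ℝ) * Complex.I) := by
    rw [integral_congr_ae (g := fun _ =>
      Complex.exp (((1 : ℝ) * (y - inner ℝ e μ₁) : ℝ) * Complex.I))]
    · simp
    · filter_upwards [hae] with ω hω
      rw [inner_sub_right, hω]
  rw [h5, Complex.norm_exp_ofReal_mul_I] at h3
  linarith

/-- The gain as an affine function of the current position: its law is that of a fixed projection
of the noise up to a scale and a shift which are continuous functions of the position. -/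
theorem exists_scaled (hD : D.IsRegular α)
    (hσpos : ∀ t ∈ Icc 0 D.horizon, (D.σ t).PosDef) (hM : 0 < M)
    (hK : (P.map (fun ω => -D.L 1 ω) = P.map (D.L 1) ∧ D.K = {v | ∀ i, |v i| ≤ M}) ∨
      (d = 1 ∧ D.K = {v | ∀ i, 0 ≤ v i ∧ v i ≤ M})) :
    ∃ a₀ ∈ D.K, ∀ (n : Fin N) (v : Fin N → EuclideanSpace ℝ (Fin d)), (∀ k, v k ∈ D.K) →
    ∃ (Z : Ω → EuclideanSpace ℝ (Fin d) × ℝ) (s : EuclideanSpace ℝ (Fin d) → ℝ)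
      (μ₁ : EuclideanSpace ℝ (Fin d)) (μ₂ : ℝ),
      AEMeasurable Z P ∧
      (∀ A, MeasurableSet[D.𝓕 (D.start n)] A → ∀ B, MeasurableSet B →
        P (A ∩ Z ⁻¹' B) = P A * P (Z ⁻¹' B)) ∧
      (∀ (x : ℝ) (u : Fin N → Ω → EuclideanSpace ℝ (Fin d)), (∀ k, Measurable (u k)) →
        (∀ k, n < k → u k =ᵐ[P] fun _ => v k) →
        (∃ X, D.IsWealth n x u X) ∧
        D.gain n x u =ᵐ[P] fun ω => inner ℝ (u n ω) (Z ω).1 + (Z ω).2) ∧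
      ContinuousOn s D.K ∧ (∀ c ∈ D.K, 0 ≤ s c) ∧
      (∀ c ∈ D.K, P.map (fun ω => inner ℝ c (Z ω).1 + (Z ω).2) =
        P.map fun ω => s c * inner ℝ a₀ (D.L 1 ω) + (inner ℝ c μ₁ + μ₂)) ∧
      ((∀ a : EuclideanSpace ℝ (Fin d), a ≠ 0 → ¬ ∀ᵐ ω ∂P, inner ℝ a (D.L 1 ω) = 0) →
        ∀ e : EuclideanSpace ℝ (Fin d), e ≠ 0 → ∀ y : ℝ, ¬ ∀ᵐ ω ∂P, inner ℝ e (Z ω).1 = y) := by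
  obtain ⟨a₀, ha₀, Q, hQ, hKQ⟩ := hD.exists_cone hσpos hM hK
  refine ⟨a₀, ha₀, fun n v hv => ?_⟩
  obtain ⟨Z, μ₁, μ₂, hZ, hind, hgain, hstep, hsum⟩ := hD.exists_affine n v
  set W : EuclideanSpace ℝ (Fin d) → Ω → ℝ := fun c ω =>
    inner ℝ c ((Z ω).1 - μ₁) + ((Z ω).2 - μ₂) with hW
  have hWstep : ∀ c ∈ D.K, StepLim P D.L α Q (D.start n) D.horizon ⊤ (W c) := fun c hc =>
    hsum c Q fun k _ s' hs' s hs => hKQ _ (by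
      rcases eq_or_ne k n with rfl | hkn
      · simpa using hc
      · simpa [Function.update_of_ne hkn] using hv k) _ _ hs
  have hWm : ∀ c, AEMeasurable (W c) P := fun c => by
    have : Measurable fun p : EuclideanSpace ℝ (Fin d) × ℝ =>
        inner ℝ c (p.1 - μ₁) + (p.2 - μ₂) := by
      fun_prop
    exact this.comp_aemeasurable hZ
  have hmap := fun c hc => (hWstep c hc).map_eq hD.stable (hD.start_nonneg n) hQ
  -- The scale is an explicit function of this integral, so its continuity on `K` reduces to
  -- dominated convergence.
  have hcont : Continuous fun c => ∫ ω, Complex.exp (((1 : ℝ) * W c ω : ℝ) * Complex.I) ∂P := by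
    refine continuous_of_dominated (bound := fun _ => 1) (fun c => ?_)
      (fun c => ae_of_all _ fun ω => ?_)
      (integrable_const _) (ae_of_all _ fun ω => ?_)
    · have h1 : Measurable fun y : ℝ => Complex.exp (((1 : ℝ) * y : ℝ) * Complex.I) := by fun_prop
      exact (h1.comp_aemeasurable (hWm c)).aestronglyMeasurable
    · rw [Complex.norm_exp_ofReal_mul_I]
    · simp only [hW]
      fun_prop
  have hm := hD.stable.measurable_at zero_le_one
  refine ⟨Z, fun c => (Real.log ‖∫ ω, Complex.exp (((1 : ℝ) * W c ω : ℝ) * Complex.I) ∂P‖ /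
        Real.log ‖charFun (P.map (D.L 1)) a₀‖) ^ (1 / α), μ₁, μ₂, hZ, hind, hgain, ?_,
    fun c hc => (hmap c hc).2.1, fun c hc => ?_, fun hnd e he y =>
      hD.not_ae_inner_eq hσpos hnd hstep he y⟩
  · refine ContinuousOn.rpow_const ?_ fun c _ => Or.inr (one_div_nonneg.2 hD.stable.alpha_pos.le)
    refine ContinuousOn.div_const (ContinuousOn.log hcont.norm.continuousOn fun c hc => ?_) _
    exact norm_ne_zero_iff.2 (hmap c hc).1
  · have h1 := (hmap c hc).2.2
    have hadd : Measurable fun y : ℝ => y + (inner ℝ c μ₁ + μ₂) := by fun_prop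
    have h2 := congrArg (Measure.map fun y : ℝ => y + (inner ℝ c μ₁ + μ₂)) h1
    rw [AEMeasurable.map_map_of_aemeasurable hadd.aemeasurable (hWm c),
      AEMeasurable.map_map_of_aemeasurable hadd.aemeasurable (by fun_prop)] at h2
    refine Eq.trans ?_ h2
    congr 1
    ext ω
    simp only [hW, Function.comp_apply, inner_sub_right]
    ring

end MeanRiskProblem.IsRegular

end

section

/-! ### Integrability, mean and support of the projections of the noise -/

namespace IsStableLevy

variable {Ω : Type*} {mΩ : MeasurableSpace Ω} {P : Measure Ω} [IsProbabilityMeasure P] {d : ℕ}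
  {𝓕 : Filtration ℝ mΩ} {α : ℝ} {L : ℝ → Ω → EuclideanSpace ℝ (Fin d)}
  {a : EuclideanSpace ℝ (Fin d)}

lemma measurable_inner (hL : IsStableLevy P 𝓕 α L) (a : EuclideanSpace ℝ (Fin d)) {t : ℝ}
    (ht : 0 ≤ t) : Measurable fun ω => (inner ℝ a (L t ω) : ℝ) := by
  have := hL.measurable_at ht
  fun_prop

lemma map_inner (hL : IsStableLevy P 𝓕 α L) (a : EuclideanSpace ℝ (Fin d)) {t : ℝ} (ht : 0 < t) :
    P.map (fun ω => (inner ℝ a (L 1 ω) : ℝ)) =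
      P.map fun ω => t ^ (-(1 / α)) * (inner ℝ a (L t ω) : ℝ) := by
  have h1 := congrArg (Measure.map fun x : EuclideanSpace ℝ (Fin d) => (inner ℝ a x : ℝ))
    (hL.self_similar t ht)
  have hm := hL.measurable_at ht.le
  have hm1 := hL.measurable_at zero_le_one
  rw [Measure.map_map (by fun_prop) (by fun_prop), Measure.map_map (by fun_prop) hm1] at h1
  refine Eq.trans h1.symm ?_
  congr 1
  ext ω
  simp [real_inner_smul_right]

lemma map_inner_sub (hL : IsStableLevy P 𝓕 α L) (a : EuclideanSpace ℝ (Fin d)) {s t : ℝ}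
    (hs : 0 ≤ s) (hst : s ≤ t) :
    P.map (fun ω => (inner ℝ a (L t ω - L s ω) : ℝ)) =
      P.map fun ω => (inner ℝ a (L (t - s) ω) : ℝ) := by
  have h1 := congrArg (Measure.map fun x : EuclideanSpace ℝ (Fin d) => (inner ℝ a x : ℝ))
    (hL.stationary s t hs hst)
  have hm := hL.measurable_at hs
  have hm1 := hL.measurable_at (hs.trans hst)
  have hm2 := hL.measurable_at (sub_nonneg.2 hst)
  rw [Measure.map_map (by fun_prop) (by fun_prop), Measure.map_map (by fun_prop) hm2] at h1
  exact h1

lemma integrable_comp_inner (hL : IsStableLevy P 𝓕 α L) {T : ℝ} (hT : 0 < T) {f : ℝ → ℝ}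
    (hf : Continuous f)
    (hint : ∀ (y : ℝ) (b : EuclideanSpace ℝ (Fin d)),
      Integrable (fun ω => f (y + inner ℝ b (L T ω))) P) (a : EuclideanSpace ℝ (Fin d)) (y β : ℝ) :
    Integrable (fun ω => f (y + β * inner ℝ a (L 1 ω))) P := by
  have hg : Continuous fun x : ℝ => f (y + β * x) := by fun_prop
  have h2 := (hL.measurable_inner a hT.le).const_mul (T ^ (-(1 / α)))
  have h3 : Integrable (fun x : ℝ => f (y + β * x)) (P.map fun ω => (inner ℝ a (L 1 ω) : ℝ)) := by
    rw [hL.map_inner a hT, integrable_map_measure hg.aestronglyMeasurable h2.aemeasurable]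
    refine (hint y ((β * T ^ (-(1 / α))) • a)).congr (ae_of_all _ fun ω => ?_)
    simp only [Function.comp_apply, real_inner_smul_left, mul_assoc]
  rwa [integrable_map_measure hg.aestronglyMeasurable
    (hL.measurable_inner a zero_le_one).aemeasurable] at h3

/-- The mean at time `2` is twice the mean at time `1` by stationarity and `2^(1/α)` times it by
self-similarity; the factors differ because `α > 1`. -/
lemma integral_inner_eq_zero (hL : IsStableLevy P 𝓕 α L)
    (hint : Integrable (fun ω => (inner ℝ a (L 1 ω) : ℝ)) P) :
    ∫ ω, (inner ℝ a (L 1 ω) : ℝ) ∂P = 0 := by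
  have hα := hL.alpha_pos
  have m1 := hL.measurable_inner a zero_le_one
  have m2 := hL.measurable_inner a zero_le_two
  have m3 : Measurable fun ω => (inner ℝ a (L 2 ω - L 1 ω) : ℝ) := by
    simp_rw [inner_sub_right]; exact m2.sub m1
  set y : ℝ := (2 : ℝ) ^ (-(1 / α)) with hy
  have e1 : ∫ ω, (inner ℝ a (L 1 ω) : ℝ) ∂P = y * ∫ ω, (inner ℝ a (L 2 ω) : ℝ) ∂P := by
    have h := congrArg (fun ν : Measure ℝ => ∫ x, x ∂ν) (hL.map_inner a (t := 2) two_pos)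
    rwa [integral_map m1.aemeasurable (by fun_prop),
      integral_map (m2.const_mul y).aemeasurable (by fun_prop), integral_const_mul] at h
  have h12 := hL.map_inner_sub a (s := 1) (t := 2) zero_le_one one_le_two
  rw [show (2 : ℝ) - 1 = 1 by norm_num] at h12
  have e2 : ∫ ω, (inner ℝ a (L 2 ω - L 1 ω) : ℝ) ∂P = ∫ ω, (inner ℝ a (L 1 ω) : ℝ) ∂P := by
    have h := congrArg (fun ν : Measure ℝ => ∫ x, x ∂ν) h12
    rwa [integral_map m3.aemeasurable (by fun_prop),
      integral_map m1.aemeasurable (by fun_prop)] at h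
  have hint3 : Integrable (fun ω => (inner ℝ a (L 2 ω - L 1 ω) : ℝ)) P := by
    have h : Integrable (fun x : ℝ => x) (P.map fun ω => (inner ℝ a (L 2 ω - L 1 ω) : ℝ)) := by
      rw [h12, integrable_map_measure (by fun_prop) m1.aemeasurable]
      exact hint
    rwa [integrable_map_measure (by fun_prop) m3.aemeasurable] at h
  have e3 : ∫ ω, (inner ℝ a (L 2 ω) : ℝ) ∂P = 2 * ∫ ω, (inner ℝ a (L 1 ω) : ℝ) ∂P := by
    rw [two_mul]
    nth_rewrite 1 [← e2]
    rw [← integral_add hint3 hint]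
    refine integral_congr_ae (ae_of_all _ fun ω => ?_)
    simp only
    rw [← inner_add_right, sub_add_cancel]
  rw [e3] at e1
  have h1 : y * 2 ≠ 1 := by
    have h2 : (2 : ℝ) ^ (-(1 / α)) * 2 ^ (1 : ℝ) ≠ 1 := by
      rw [← Real.rpow_add two_pos]
      have h3 : 1 / α < 1 := by rw [div_lt_one hα]; exact hL.one_lt
      exact (Real.one_lt_rpow one_lt_two (by linarith)).ne'
    rwa [Real.rpow_one] at h2
  by_contra hne
  apply h1
  have : (y * 2 - 1) * ∫ ω, (inner ℝ a (L 1 ω) : ℝ) ∂P = 0 := by linarith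
  rcases mul_eq_zero.1 this with h | h
  · linarith
  · exact absurd h hne

/-- Supports add over independent increments. -/
lemma add_mem_support (hL : IsStableLevy P 𝓕 α L) {s t x y : ℝ} (hs : 0 ≤ s) (ht : 0 ≤ t)
    (hx : x ∈ (P.map fun ω => (inner ℝ a (L s ω) : ℝ)).support)
    (hy : y ∈ (P.map fun ω => (inner ℝ a (L t ω) : ℝ)).support) :
    x + y ∈ (P.map fun ω => (inner ℝ a (L (s + t) ω) : ℝ)).support := by
  have ms := hL.measurable_inner a hs
  have mst := hL.measurable_inner a (add_nonneg hs ht)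
  have hst : s ≤ s + t := le_add_of_nonneg_right ht
  have m3 : Measurable fun ω => (inner ℝ a (L (s + t) ω - L s ω) : ℝ) := by
    simp_rw [inner_sub_right]; exact mst.sub ms
  rw [Measure.mem_support_iff_forall] at hx hy ⊢
  intro U hU
  obtain ⟨ε, hε, hUε⟩ := Metric.mem_nhds_iff.1 hU
  have hV := hx (Metric.ball x (ε / 2)) (Metric.ball_mem_nhds _ (half_pos hε))
  have hW := hy (Metric.ball y (ε / 2)) (Metric.ball_mem_nhds _ (half_pos hε))
  have h4 := hL.map_inner_sub a hs hst
  rw [add_sub_cancel_left] at h4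
  rw [← h4] at hW
  refine lt_of_lt_of_le ?_ (measure_mono hUε)
  rw [Measure.map_apply ms measurableSet_ball] at hV
  rw [Measure.map_apply m3 measurableSet_ball] at hW
  rw [Measure.map_apply mst measurableSet_ball]
  have hind := (Indep_iff _ _ P).1 (hL.indep s (s + t) hs hst)
    ((fun ω => (inner ℝ a (L (s + t) ω - L s ω) : ℝ)) ⁻¹' Metric.ball y (ε / 2))
    ((fun ω => (inner ℝ a (L s ω) : ℝ)) ⁻¹' Metric.ball x (ε / 2)) ?_ ?_
  · refine lt_of_lt_of_le ?_ (measure_mono (s :=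
      ((fun ω => (inner ℝ a (L (s + t) ω - L s ω) : ℝ)) ⁻¹' Metric.ball y (ε / 2)) ∩
      ((fun ω => (inner ℝ a (L s ω) : ℝ)) ⁻¹' Metric.ball x (ε / 2))) ?_)
    · rw [hind]
      exact ENNReal.mul_pos hW.ne' hV.ne'
    · rintro ω ⟨h1, h2⟩
      simp only [mem_preimage, Metric.mem_ball, Real.dist_eq, inner_sub_right] at h1 h2 ⊢
      have h5 := abs_add_le (inner ℝ a (L (s + t) ω) - inner ℝ a (L s ω) - y)
        (inner ℝ a (L s ω) - x)
      have e : (inner ℝ a (L (s + t) ω) : ℝ) - (x + y) =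
        (inner ℝ a (L (s + t) ω) - inner ℝ a (L s ω) - y) + (inner ℝ a (L s ω) - x) := by ring
      rw [e]
      linarith
  · have h6 : Measurable fun x : EuclideanSpace ℝ (Fin d) => (inner ℝ a x : ℝ) := by fun_prop
    exact ⟨(fun x : EuclideanSpace ℝ (Fin d) => (inner ℝ a x : ℝ)) ⁻¹' Metric.ball y (ε / 2),
      h6 measurableSet_ball, rfl⟩
  · have h6 : Measurable fun x : EuclideanSpace ℝ (Fin d) => (inner ℝ a x : ℝ) := by fun_prop
    exact (h6.comp (hL.adapted s hs)) measurableSet_ball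

lemma zero_mem_support (hL : IsStableLevy P 𝓕 α L) :
    (0 : ℝ) ∈ (P.map fun ω => (inner ℝ a (L 0 ω) : ℝ)).support := by
  rw [Measure.mem_support_iff_forall]
  intro U hU
  have h1 : (P.map fun ω => (inner ℝ a (L 0 ω) : ℝ)) = P.map fun _ => (0 : ℝ) :=
    Measure.map_congr (by filter_upwards [hL.zero] with ω hω; simp [hω])
  rw [h1]
  simp [mem_of_mem_nhds hU]

lemma nsmul_mem_support (hL : IsStableLevy P 𝓕 α L) {x : ℝ}
    (hx : x ∈ (P.map fun ω => (inner ℝ a (L 1 ω) : ℝ)).support) (n : ℕ) :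
    (n : ℝ) * x ∈ (P.map fun ω => (inner ℝ a (L n ω) : ℝ)).support := by
  induction n with
  | zero => simpa using hL.zero_mem_support
  | succ n ih =>
    have := hL.add_mem_support (Nat.cast_nonneg n) zero_le_one ih hx
    rw [Nat.cast_succ, add_mul, one_mul]
    exact this

/-- By stability `n^(-1/α) (j x + (n - j) y)` lies in the support for all `j ≤ n`. As `n` grows the
spacing `n^(-1/α) (y - x)` tends to `0`, while the range `n^(1 - 1/α) [x, y]` exhausts the line
because `α > 1`. -/
lemma support_eq_univ (hL : IsStableLevy P 𝓕 α L) {x y : ℝ} (hx0 : x < 0) (hy0 : 0 < y)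
    (hx : x ∈ (P.map fun ω => (inner ℝ a (L 1 ω) : ℝ)).support)
    (hy : y ∈ (P.map fun ω => (inner ℝ a (L 1 ω) : ℝ)).support) (z : ℝ) :
    z ∈ (P.map fun ω => (inner ℝ a (L 1 ω) : ℝ)).support := by
  have hα := hL.alpha_pos
  have hyx : 0 < y - x := by linarith
  have hmem : ∀ j n : ℕ, j ≤ n → 0 < n → (n : ℝ) ^ (-(1 / α)) * (n * y - j * (y - x)) ∈
      (P.map fun ω => (inner ℝ a (L 1 ω) : ℝ)).support := by
    intro j n hjn hn
    obtain ⟨k, rfl⟩ := Nat.exists_eq_add_of_le hjn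
    have h1 := hL.add_mem_support (Nat.cast_nonneg j) (Nat.cast_nonneg k)
      (hL.nsmul_mem_support hx j) (hL.nsmul_mem_support hy k)
    have hn' : (0 : ℝ) < (j + k : ℕ) := by exact_mod_cast hn
    rw [hL.map_inner a hn', Measure.mem_support_iff_forall]
    intro U hU
    have hc : Continuous fun w : ℝ => ((j + k : ℕ) : ℝ) ^ (-(1 / α)) * w := by fun_prop
    rw [Measure.mem_support_iff_forall] at h1
    have e : (j : ℝ) * x + k * y = (j + k : ℕ) * y - j * (y - x) := by push_cast; ring
    rw [e] at h1
    have h2 := h1 _ (hc.continuousAt.preimage_mem_nhds hU)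
    have m1 := hL.measurable_inner a (add_nonneg (Nat.cast_nonneg j) (Nat.cast_nonneg k) :
      (0 : ℝ) ≤ j + k)
    have h3 := Measure.map_map (μ := P) hc.measurable m1
    push_cast at h3 h2 ⊢
    have h4 := Measure.le_map_apply (μ := P.map fun ω => (inner ℝ a (L (j + k) ω) : ℝ))
      hc.measurable.aemeasurable U
    push_cast at h4
    rw [h3] at h4
    exact h2.trans_le h4
  have hclosed := Measure.isClosed_support (μ := P.map fun ω => (inner ℝ a (L 1 ω) : ℝ))
  set w : ℕ → ℝ := fun n => (n : ℝ) ^ (1 / α) with hw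
  have hwt : Tendsto (fun n : ℕ => (y - x) * (n : ℝ) ^ (-(1 / α))) atTop (𝓝 0) := by
    have := ((tendsto_rpow_neg_atTop (one_div_pos.2 hα)).comp
      tendsto_natCast_atTop_atTop).const_mul (y - x)
    simpa using this
  have hgrow : Tendsto (fun n : ℕ => (n : ℝ) ^ (1 - 1 / α)) atTop atTop := by
    refine (tendsto_rpow_atTop ?_).comp tendsto_natCast_atTop_atTop
    have : 1 / α < 1 := by rw [div_lt_one hα]; exact hL.one_lt
    linarith
  -- The number of copies of `x` that brings the rescaled sum to `z`, up to one spacing.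
  set j : ℕ → ℕ := fun n => ⌊(n * y - z * w n) / (y - x)⌋₊ with hj
  have hbig : ∀ᶠ n : ℕ in atTop, 0 < n ∧ 0 ≤ n * y - z * w n ∧ n * y - z * w n ≤ n * (y - x) := by
    filter_upwards [eventually_gt_atTop 0, hgrow.eventually (eventually_ge_atTop (z / y)),
      hgrow.eventually (eventually_ge_atTop (-z / -x))] with n hn h1 h2
    have hn' : (0 : ℝ) < n := by exact_mod_cast hn
    have e : (n : ℝ) = w n * (n : ℝ) ^ (1 - 1 / α) := by
      simp only [hw]
      rw [← Real.rpow_add hn']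
      simp
    have hw0 : 0 < w n := Real.rpow_pos_of_pos hn' _
    rw [div_le_iff₀ hy0] at h1
    rw [div_le_iff₀ (by linarith)] at h2
    refine ⟨hn, ?_, ?_⟩
    · have : (n : ℝ) * y - z * w n = w n * ((n : ℝ) ^ (1 - 1 / α) * y - z) := by
        linear_combination y * e
      rw [this]
      exact mul_nonneg hw0.le (by linarith)
    · have : (n : ℝ) * (y - x) - (n * y - z * w n) = w n * (z - (n : ℝ) ^ (1 - 1 / α) * x) := by
        linear_combination (-x) * e
      have h3 := mul_nonneg hw0.le (show 0 ≤ z - (n : ℝ) ^ (1 - 1 / α) * x by linarith)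
      linarith
  refine hclosed.mem_of_tendsto (f := fun n : ℕ =>
    (n : ℝ) ^ (-(1 / α)) * (n * y - j n * (y - x))) (b := atTop) ?_ ?_
  · rw [tendsto_iff_dist_tendsto_zero]
    refine squeeze_zero' (Eventually.of_forall fun _ => dist_nonneg) ?_ hwt
    filter_upwards [hbig] with n ⟨hn, h1, h2⟩
    have hn' : (0 : ℝ) < n := by exact_mod_cast hn
    have h3 : (j n : ℝ) ≤ (n * y - z * w n) / (y - x) := Nat.floor_le (by positivity)
    have h4 : (n * y - z * w n) / (y - x) < j n + 1 := Nat.lt_floor_add_one _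
    rw [le_div_iff₀ hyx] at h3
    rw [div_lt_iff₀ hyx] at h4
    have hw1 : (n : ℝ) ^ (-(1 / α)) * w n = 1 := by
      simp only [hw]
      rw [← Real.rpow_add hn']
      simp
    have e : (n : ℝ) ^ (-(1 / α)) * (n * y - j n * (y - x)) - z =
        (n : ℝ) ^ (-(1 / α)) * (n * y - z * w n - j n * (y - x)) := by
      have : z = z * ((n : ℝ) ^ (-(1 / α)) * w n) := by rw [hw1, mul_one]
      nth_rewrite 1 [this]
      ring
    have hp : 0 < (n : ℝ) ^ (-(1 / α)) := Real.rpow_pos_of_pos hn' _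
    rw [Real.dist_eq, e, abs_mul, abs_of_pos hp, abs_of_nonneg (by linarith)]
    have := mul_le_mul_of_nonneg_left
      (show n * y - z * w n - j n * (y - x) ≤ y - x by linarith) hp.le
    linarith
  · filter_upwards [hbig] with n ⟨hn, h1, h2⟩
    refine hmem _ _ ?_ hn
    refine Nat.floor_le_of_le ?_
    rw [div_le_iff₀ hyx]
    exact h2

/-- A continuous function that vanishes almost surely at a nondegenerate centred projection of the
noise vanishes identically. -/
lemma eq_zero_of_ae_eq_zero (hL : IsStableLevy P 𝓕 α L)
    (hint : Integrable (fun ω => (inner ℝ a (L 1 ω) : ℝ)) P)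
    (hne : ¬ ∀ᵐ ω ∂P, inner ℝ a (L 1 ω) = 0) {g : ℝ → ℝ} (hg : Continuous g)
    (h0 : ∀ᵐ ω ∂P, g (inner ℝ a (L 1 ω)) = 0) (z : ℝ) : g z = 0 := by
  have m1 := hL.measurable_inner a zero_le_one
  have hmean := hL.integral_inner_eq_zero hint
  -- A centred variable that is not almost surely zero charges both half-lines.
  have hpos : ∃ y, 0 < y ∧ y ∈ (P.map fun ω => (inner ℝ a (L 1 ω) : ℝ)).support := by
    have : 0 < (P.map fun ω => (inner ℝ a (L 1 ω) : ℝ)) (Ioi 0) := by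
      rw [Measure.map_apply m1 measurableSet_Ioi]
      refine pos_iff_ne_zero.2 fun h => hne ?_
      have h1 : ∀ᵐ ω ∂P, 0 ≤ -(inner ℝ a (L 1 ω) : ℝ) := by
        refine (measure_mono_null (fun ω hω => ?_) h : P _ = 0)
        simp only [mem_compl_iff, mem_ofPred_eq, not_le] at hω
        simp only [mem_preimage, mem_Ioi]
        linarith
      have h2 := (integral_eq_zero_iff_of_nonneg_ae h1 hint.neg).1 (by
        rw [integral_neg, hmean, neg_zero])
      filter_upwards [h2] with ω hω
      simpa using hω
    obtain ⟨y, hy1, hy2⟩ := Measure.nonempty_inter_support_of_pos this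
    exact ⟨y, hy1, hy2⟩
  have hneg : ∃ x, x < 0 ∧ x ∈ (P.map fun ω => (inner ℝ a (L 1 ω) : ℝ)).support := by
    have : 0 < (P.map fun ω => (inner ℝ a (L 1 ω) : ℝ)) (Iio 0) := by
      rw [Measure.map_apply m1 measurableSet_Iio]
      refine pos_iff_ne_zero.2 fun h => hne ?_
      have h1 : ∀ᵐ ω ∂P, 0 ≤ (inner ℝ a (L 1 ω) : ℝ) := by
        refine (measure_mono_null (fun ω hω => ?_) h : P _ = 0)
        simpa using hω
      exact (integral_eq_zero_iff_of_nonneg_ae h1 hint).1 hmean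
    obtain ⟨y, hy1, hy2⟩ := Measure.nonempty_inter_support_of_pos this
    exact ⟨y, hy1, hy2⟩
  obtain ⟨y, hy0, hy⟩ := hpos
  obtain ⟨x, hx0, hx⟩ := hneg
  have hcl : IsClosed {z | g z = 0} := isClosed_eq hg continuous_const
  have hae : {z | g z = 0} ∈ ae (P.map fun ω => (inner ℝ a (L 1 ω) : ℝ)) :=
    (ae_map_iff m1.aemeasurable hcl.measurableSet).2 h0
  exact Measure.support_subset_of_isClosed hcl hae (hL.support_eq_univ hx0 hy0 hx hy z)

end IsStableLevy

end

section

/-! ### Concave rewards of scaled and shifted random variables -/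

section reward

variable {Ω : Type*} {mΩ : MeasurableSpace Ω} {P : Measure Ω} [IsProbabilityMeasure P]
  {T : ℝ → ℝ} {X : Ω → ℝ}

lemma abs_le_of_monotone_of_abs_le (hT : Monotone T) {w r : ℝ} (h : |w| ≤ r) :
    |T w| ≤ |T r| + |T (-r)| := by
  have h1 := hT (abs_le.1 h).1
  have h2 := hT (abs_le.1 h).2
  rw [abs_le]
  constructor
  · linarith [neg_abs_le (T (-r)), abs_nonneg (T r)]
  · linarith [le_abs_self (T r), abs_nonneg (T (-r))]

/-- An integrable bound for the rewards, locally uniform in the shift and the scale. -/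
lemma exists_reward_bound (hT : Monotone T)
    (hint : ∀ y β : ℝ, Integrable (fun ω => T (y + β * X ω)) P)
    (y₀ β₀ : ℝ) : ∃ g : Ω → ℝ, Integrable g P ∧
      ∀ y β ω, |y| ≤ y₀ → |β| ≤ β₀ → |T (y + β * X ω)| ≤ g ω := by
  refine ⟨fun ω => |T (y₀ + β₀ * X ω)| + |T (y₀ + (-β₀) * X ω)| +
    (|T (-y₀ + (-β₀) * X ω)| + |T (-y₀ + β₀ * X ω)|),
    ((hint _ _).abs.add (hint _ _).abs).add ((hint _ _).abs.add (hint _ _).abs),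
    fun y β ω hy hβ => ?_⟩
  have h1 : |y + β * X ω| ≤ y₀ + β₀ * |X ω| := by
    refine (abs_add_le _ _).trans ?_
    rw [abs_mul]
    have := abs_nonneg (X ω)
    gcongr
  refine (abs_le_of_monotone_of_abs_le hT h1).trans ?_
  rcases abs_choice (X ω) with h | h <;> rw [h]
  · rw [show -(y₀ + β₀ * X ω) = -y₀ + (-β₀) * X ω by ring]
    linarith [abs_nonneg (T (y₀ + (-β₀) * X ω)), abs_nonneg (T (-y₀ + β₀ * X ω))]
  · rw [show y₀ + β₀ * -X ω = y₀ + (-β₀) * X ω by ring,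
      show -(y₀ + -β₀ * X ω) = -y₀ + β₀ * X ω by ring]
    linarith [abs_nonneg (T (y₀ + β₀ * X ω)), abs_nonneg (T (-y₀ + (-β₀) * X ω))]

lemma continuousOn_integral_reward (hTc : Continuous T) (hT : Monotone T)
    (hint : ∀ y β : ℝ, Integrable (fun ω => T (y + β * X ω)) P) {S : Type*} [TopologicalSpace S]
    [FirstCountableTopology S] {K : Set S} (hK : IsCompact K) {m s : S → ℝ}
    (hm : ContinuousOn m K) (hs : ContinuousOn s K) :
    ContinuousOn (fun c => ∫ ω, T (m c + s c * X ω) ∂P) K := by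
  obtain ⟨y₀, hy⟩ := hK.exists_bound_of_continuousOn hm
  obtain ⟨β₀, hβ⟩ := hK.exists_bound_of_continuousOn hs
  obtain ⟨g, hg, hb⟩ := exists_reward_bound hT hint y₀ β₀
  refine continuousOn_of_dominated (bound := g) (fun c _ => (hint _ _).aestronglyMeasurable)
    (fun c hc => ae_of_all _ fun ω => hb _ _ ω (hy c hc) (hβ c hc)) hg (ae_of_all _ fun ω => ?_)
  exact hTc.comp_continuousOn (hm.add (hs.mul_const _))

/-- If a nonconstant concave monotone function of `±X` is integrable, then so is `X`. -/
lemma integrable_of_integrable_reward (hT : Monotone T) (hTconc : ConcaveOn ℝ univ T)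
    (hne : ∃ y z, T y ≠ T z) (hX : Measurable X)
    (hint : ∀ y β : ℝ, Integrable (fun ω => T (y + β * X ω)) P) : Integrable X P := by
  obtain ⟨y, z, hyz, hT'⟩ : ∃ y z, y < z ∧ T y < T z := by
    obtain ⟨y, z, h⟩ := hne
    rcases lt_trichotomy y z with h1 | rfl | h1
    · exact ⟨y, z, h1, lt_of_le_of_ne (hT h1.le) h⟩
    · exact absurd rfl h
    · exact ⟨z, y, h1, lt_of_le_of_ne (hT h1.le) h.symm⟩
  set p : ℝ := (T z - T y) / (z - y) with hp
  have hp0 : 0 < p := div_pos (by linarith) (by linarith)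
  have hlow : ∀ x ≤ y, p * (y - x) ≤ |T y| + |T x| := by
    intro x hx
    rcases hx.eq_or_lt with rfl | hx
    · simp only [sub_self, mul_zero]; positivity
    · have h1 := hTconc.slope_anti_adjacent (mem_univ x) (mem_univ z) hx hyz
      rw [← hp, le_div_iff₀ (by linarith)] at h1
      linarith [le_abs_self (T y), neg_abs_le (T x)]
  have h1 : Integrable (fun ω => T (0 + 1 * X ω)) P := hint 0 1
  have h2 : Integrable (fun ω => T (0 + (-1) * X ω)) P := hint 0 (-1)
  have hb : Integrable (fun ω =>
      |y| + (|T y| + (|T (0 + 1 * X ω)| + |T (0 + (-1) * X ω)|)) / p) P :=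
    (integrable_const _).add (((integrable_const _).add (h1.abs.add h2.abs)).div_const _)
  refine hb.mono hX.aestronglyMeasurable (ae_of_all _ fun ω => ?_)
  simp only [zero_add, one_mul, neg_mul]
  have e : 0 ≤ (|T y| + (|T (X ω)| + |T (-X ω)|)) / p := by positivity
  rw [Real.norm_eq_abs, Real.norm_eq_abs, abs_of_nonneg (a := |y| + _) (by positivity)]
  have h3 : |T (-|X ω|)| ≤ |T (X ω)| + |T (-X ω)| := by
    rcases abs_choice (X ω) with h | h <;> rw [h]
    · linarith [abs_nonneg (T (X ω))]
    · rw [neg_neg]; linarith [abs_nonneg (T (-X ω))]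
  by_cases hle : -|X ω| ≤ y
  · have h4 := hlow _ hle
    have h5 : y + |X ω| ≤ (|T y| + (|T (X ω)| + |T (-X ω)|)) / p := by
      rw [le_div_iff₀ hp0]
      linarith
    linarith [neg_abs_le y]
  · push Not at hle
    linarith [neg_abs_le y]

lemma ConcaveOn.le_tangent (hTconc : ConcaveOn ℝ univ T) (hTd : Differentiable ℝ T) (v w : ℝ) :
    T w ≤ T v + deriv T v * (w - v) := by
  rcases lt_trichotomy v w with h | rfl | h
  · have := hTconc.slope_le_deriv (mem_univ v) (mem_univ w) h (hTd v)
    rw [slope_def_field, div_le_iff₀ (by linarith)] at this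
    linarith
  · simp
  · have := hTconc.deriv_le_slope (mem_univ w) (mem_univ v) h (hTd v)
    rw [slope_def_field, le_div_iff₀ (by linarith)] at this
    linarith

/-- The gap between the tangent line and the function is nonnegative and zero at `w`, so its
derivative vanishes there. -/
lemma ConcaveOn.deriv_eq_of_tangent_eq (hTconc : ConcaveOn ℝ univ T) (hTd : Differentiable ℝ T)
    {v w : ℝ} (h : T w = T v + deriv T v * (w - v)) : deriv T w = deriv T v := by
  have h1 : IsLocalMin (fun x => T v + deriv T v * (x - v) - T x) w :=
    Eventually.of_forall fun x => by
      simp only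
      rw [h]
      linarith [hTconc.le_tangent hTd v x]
  have h2 : HasDerivAt (fun x => T v + deriv T v * (x - v) - T x) (deriv T v * 1 - deriv T w) w :=
    ((((hasDerivAt_id w).sub_const v).const_mul _).const_add _).sub (hTd w).hasDerivAt
  have := h1.hasDerivAt_eq_zero h2
  linarith

/-- A `C¹` concave function that is affine between the points `s₀ y - q` and `s₁ y - q` for every
`y` is affine. -/
lemma ConcaveOn.affine_of_midpoint (hTconc : ConcaveOn ℝ univ T) (hT : ContDiff ℝ 1 T)
    {s₀ s₁ q : ℝ} (h0 : 0 ≤ s₀) (h01 : s₀ < s₁)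
    (h : ∀ y, T ((s₀ + s₁) / 2 * y - q) = (T (s₀ * y - q) + T (s₁ * y - q)) / 2) (x : ℝ) :
    T x = T 0 + deriv T (-q) * x := by
  have hTd : Differentiable ℝ T := hT.differentiable one_ne_zero
  have hTc : Continuous (deriv T) := hT.continuous_deriv le_rfl
  have hs1 : 0 < s₁ := h0.trans_lt h01
  -- Equality at the midpoint puts both endpoints on the tangent at the midpoint, so the slopes
  -- there coincide.
  have key : ∀ y, deriv T (s₀ * y - q) = deriv T (s₁ * y - q) := by
    intro y
    have e0 := hTconc.le_tangent hTd ((s₀ + s₁) / 2 * y - q) (s₀ * y - q)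
    have e1 := hTconc.le_tangent hTd ((s₀ + s₁) / 2 * y - q) (s₁ * y - q)
    have e2 := h y
    set p := deriv T ((s₀ + s₁) / 2 * y - q)
    have e3 : p * (s₀ * y - q - ((s₀ + s₁) / 2 * y - q)) +
      p * (s₁ * y - q - ((s₀ + s₁) / 2 * y - q)) = 0 := by ring
    rw [hTconc.deriv_eq_of_tangent_eq hTd (v := (s₀ + s₁) / 2 * y - q) (w := s₀ * y - q)
      (by linarith), hTconc.deriv_eq_of_tangent_eq hTd (v := (s₀ + s₁) / 2 * y - q)
      (w := s₁ * y - q) (by linarith)]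
  -- Each step contracts the distance to `-q` by `s₀ / s₁ < 1`; by continuity the slope everywhere
  -- equals the slope at `-q`.
  have hiter : ∀ (n : ℕ) (z : ℝ), deriv T ((s₀ / s₁) ^ n * z - q) = deriv T (z - q) := by
    intro n
    induction n with
    | zero => simp
    | succ n ih =>
      intro z
      have h1 := key ((s₀ / s₁) ^ n * (z / s₁))
      have h2 := ih z
      rw [show s₁ * ((s₀ / s₁) ^ n * (z / s₁)) = (s₀ / s₁) ^ n * z by field_simp] at h1
      rw [← h2, ← h1]
      congr 1
      rw [pow_succ]
      ring
  have hconst : ∀ z, deriv T z = deriv T (-q) := by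
    intro z
    have h1 : Tendsto (fun n : ℕ => deriv T ((s₀ / s₁) ^ n * (z + q) - q)) atTop
        (𝓝 (deriv T (0 * (z + q) - q))) := by
      refine (hTc.tendsto _).comp ?_
      exact ((tendsto_pow_atTop_nhds_zero_of_lt_one (by positivity)
        ((div_lt_one hs1).2 h01)).mul_const _).sub_const _
    simp only [hiter, zero_mul, zero_sub, add_sub_cancel_right] at h1
    exact tendsto_nhds_unique tendsto_const_nhds h1
  have hd : ∀ z, HasDerivAt (fun z => T z - deriv T (-q) * z) 0 z := fun z => by
    have := (hTd z).hasDerivAt.sub ((hasDerivAt_id z).const_mul (deriv T (-q)))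
    rw [hconst z] at this
    exact this.congr_deriv (by ring)
  have := is_const_of_deriv_eq_zero (f := fun z => T z - deriv T (-q) * z)
    (fun z => (hd z).differentiableAt) (fun z => (hd z).deriv) x 0
  simp only [mul_zero, sub_zero] at this
  linarith

/-- A strictly convex test function of linear growth, usable when only first moments exist. -/
lemma sqrt_one_add_sq_midpoint_le (x y : ℝ) :
    Real.sqrt (1 + ((x + y) / 2) ^ 2) ≤ (Real.sqrt (1 + x ^ 2) + Real.sqrt (1 + y ^ 2)) / 2 ∧
    (Real.sqrt (1 + ((x + y) / 2) ^ 2) = (Real.sqrt (1 + x ^ 2) + Real.sqrt (1 + y ^ 2)) / 2 →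
      x = y) := by
  set p := Real.sqrt (1 + x ^ 2)
  set q := Real.sqrt (1 + y ^ 2)
  have hp : p ^ 2 = 1 + x ^ 2 := Real.sq_sqrt (by positivity)
  have hq : q ^ 2 = 1 + y ^ 2 := Real.sq_sqrt (by positivity)
  have hp0 : 0 ≤ p := Real.sqrt_nonneg _
  have hq0 : 0 ≤ q := Real.sqrt_nonneg _
  have hpq : 0 ≤ p * q := mul_nonneg hp0 hq0
  have hsq : (p * q) ^ 2 = (1 + x * y) ^ 2 + (x - y) ^ 2 := by
    rw [mul_pow, hp, hq]; ring
  have hle : 1 + x * y ≤ p * q := by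
    refine le_of_sq_le_sq ?_ hpq
    rw [hsq]; nlinarith [sq_nonneg (x - y)]
  constructor
  · refine Real.sqrt_le_iff.2 ⟨by positivity, ?_⟩
    nlinarith
  · intro h
    have h1 : 1 + ((x + y) / 2) ^ 2 = ((p + q) / 2) ^ 2 := by
      rw [← h, Real.sq_sqrt (by positivity)]
    have h2 : p * q = 1 + x * y := by nlinarith
    rw [h2] at hsq
    have : (x - y) ^ 2 = 0 := by linarith
    have := pow_eq_zero_iff (two_ne_zero) |>.1 this
    linarith

lemma ae_eq_of_integral_midpoint_le {f g : Ω → ℝ} (hf : Integrable f P) (hg : Integrable g P)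
    (hle : f ≤ᵐ[P] g) (h : ∫ ω, g ω ∂P ≤ ∫ ω, f ω ∂P) : f =ᵐ[P] g := by
  have h1 : 0 ≤ᵐ[P] fun ω => g ω - f ω := by
    filter_upwards [hle] with ω hω
    simpa using hω
  have h2 : ∫ ω, (g ω - f ω) ∂P = 0 := by
    refine le_antisymm ?_ (integral_nonneg_of_ae h1)
    rw [integral_sub hg hf]
    linarith
  have h3 := (integral_eq_zero_iff_of_nonneg_ae h1 (hg.sub hf)).1 h2
  filter_upwards [h3] with ω hω
  have : g ω - f ω = 0 := hω
  linarith

end reward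

end

section

/-! ### Uniqueness in the one-period problem -/

section onePeriod

variable {Ω : Type*} {mΩ : MeasurableSpace Ω} {P : Measure Ω} [IsProbabilityMeasure P] {d : ℕ}

/-- The one-period mean-risk functional of a gain that is distributed as `m + s X`. -/
noncomputable def meanRisk (P : Measure Ω) (T F : ℝ → ℝ) (lam ρ₀ δ : ℝ) (X : Ω → ℝ) (s m : ℝ) : ℝ :=
  ∫ ω, T (m + s * X ω) ∂P - lam * F (s * ρ₀ - δ * m)

variable {T F : ℝ → ℝ} {lam ρ₀ δ : ℝ} {X : Ω → ℝ}
  {K : Set (EuclideanSpace ℝ (Fin d))} {Z : Ω → EuclideanSpace ℝ (Fin d) × ℝ}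
  {s : EuclideanSpace ℝ (Fin d) → ℝ} {μ₁ : EuclideanSpace ℝ (Fin d)} {μ₂ : ℝ}

lemma ConvexOn.midpoint_le (h : ConvexOn ℝ univ F) (x y : ℝ) :
    F ((x + y) / 2) ≤ (F x + F y) / 2 := by
  have h1 := h.2 (mem_univ x) (mem_univ y) one_half_pos.le one_half_pos.le (add_halves 1)
  simp only [smul_eq_mul] at h1
  rw [show (x + y) / 2 = 1 / 2 * x + 1 / 2 * y by ring]
  linarith

lemma StrictConvexOn.midpoint_lt (h : StrictConvexOn ℝ univ F) {x y : ℝ} (hxy : x ≠ y) :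
    F ((x + y) / 2) < (F x + F y) / 2 := by
  have h1 := h.2 (mem_univ x) (mem_univ y) hxy one_half_pos one_half_pos (add_halves 1)
  simp only [smul_eq_mul] at h1
  rw [show (x + y) / 2 = 1 / 2 * x + 1 / 2 * y by ring]
  linarith

lemma ConcaveOn.le_midpoint (h : ConcaveOn ℝ univ T) (x y : ℝ) :
    (T x + T y) / 2 ≤ T ((x + y) / 2) := by
  have h1 := h.neg.midpoint_le x y
  simp only [Pi.neg_apply] at h1
  linarith

lemma StrictConcaveOn.lt_midpoint (h : StrictConcaveOn ℝ univ T) {x y : ℝ} (hxy : x ≠ y) :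
    (T x + T y) / 2 < T ((x + y) / 2) := by
  have h1 := h.neg.midpoint_lt hxy
  simp only [Pi.neg_apply] at h1
  linarith

lemma strictMono_of_strictConvexOn (hF : Monotone F) (hFs : StrictConvexOn ℝ univ F) :
    StrictMono F := by
  intro x y hxy
  refine lt_of_le_of_ne (hF hxy.le) fun h => ?_
  have h1 := hFs.midpoint_lt hxy.ne
  have h2 := hF (show x ≤ (x + y) / 2 by linarith)
  linarith

/-- At the midpoint of two maximisers the expected reward is at least the average and the penalty at
most the average. Maximality makes both into equalities, and the strictness assumptions then
contradict the non-degeneracy `hnd`. -/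
theorem maximiser_unique (hKc : Convex ℝ K) (hT : ContDiff ℝ 1 T) (hTmono : Monotone T)
    (hTconc : ConcaveOn ℝ univ T) (hFmono : Monotone F) (hFconv : ConvexOn ℝ univ F)
    (hlam : 0 < lam) (hδ : δ = 0 ∨ δ = 1) (hX : Measurable X)
    (hint : ∀ y β : ℝ, Integrable (fun ω => T (y + β * X ω)) P)
    (hX0 : Integrable X P → ∫ ω, X ω ∂P = 0)
    (hXs : Integrable X P → (¬ ∀ᵐ ω ∂P, X ω = 0) → ∀ g : ℝ → ℝ, Continuous g →
      (∀ᵐ ω ∂P, g (X ω) = 0) → ∀ z, g z = 0)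
    (hZ : AEMeasurable Z P) (hs0 : ∀ c ∈ K, 0 ≤ s c)
    (hlaw : ∀ c ∈ K, P.map (fun ω => inner ℝ c (Z ω).1 + (Z ω).2) =
        P.map fun ω => s c * X ω + (inner ℝ c μ₁ + μ₂))
    (hnd : ∀ e : EuclideanSpace ℝ (Fin d), e ≠ 0 → ∀ y : ℝ, ¬ ∀ᵐ ω ∂P, inner ℝ e (Z ω).1 = y)
    (halt : (StrictConcaveOn ℝ univ T ∧ 0 ≤ ρ₀) ∨
      (StrictConvexOn ℝ univ F ∧ (∃ y z, T y ≠ T z) ∧ ((¬ ∀ᵐ ω ∂P, X ω = 0) → 0 < ρ₀)))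
    {a b : EuclideanSpace ℝ (Fin d)} (ha : a ∈ K) (hb : b ∈ K)
    (hamax : ∀ c ∈ K, meanRisk P T F lam ρ₀ δ X (s c) (inner ℝ c μ₁ + μ₂) ≤
      meanRisk P T F lam ρ₀ δ X (s a) (inner ℝ a μ₁ + μ₂))
    (hbmax : ∀ c ∈ K, meanRisk P T F lam ρ₀ δ X (s c) (inner ℝ c μ₁ + μ₂) ≤
      meanRisk P T F lam ρ₀ δ X (s b) (inner ℝ b μ₁ + μ₂)) : a = b := by
  by_contra hab
  set m : EuclideanSpace ℝ (Fin d) → ℝ := fun c => inner ℝ c μ₁ + μ₂ with hm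
  set Y : EuclideanSpace ℝ (Fin d) → Ω → ℝ := fun c ω => inner ℝ c (Z ω).1 + (Z ω).2 with hY
  set mid : EuclideanSpace ℝ (Fin d) := (1 / 2 : ℝ) • a + (1 / 2 : ℝ) • b with hmid
  have hmidK : mid ∈ K := hKc ha hb (by norm_num) (by norm_num) (by norm_num)
  have hTc : Continuous T := hT.continuous
  have hYm : ∀ c, AEMeasurable (Y c) P := fun c => by
    have : Measurable fun p : EuclideanSpace ℝ (Fin d) × ℝ => inner ℝ c p.1 + p.2 := by fun_prop
    exact this.comp_aemeasurable hZ
  have hYmid : ∀ ω, Y mid ω = (Y a ω + Y b ω) / 2 := fun ω => by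
    simp only [hY, hmid, inner_add_left, real_inner_smul_left]; ring
  have hmmid : m mid = (m a + m b) / 2 := by
    simp only [hm, hmid, inner_add_left, real_inner_smul_left]; ring
  have hYsub : ∀ ω, Y a ω - Y b ω = inner ℝ (a - b) (Z ω).1 := fun ω => by
    simp only [hY, inner_sub_left]; ring
  have hnd' : ∀ y : ℝ, ¬ ∀ᵐ ω ∂P, Y a ω - Y b ω = y := fun y => by
    simp_rw [hYsub]
    exact hnd _ (sub_ne_zero.2 hab) y
  have hsXm : ∀ c, AEMeasurable (fun ω => s c * X ω + m c) P := fun c => by fun_prop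
  have tr : ∀ c ∈ K, ∀ g : ℝ → ℝ, Continuous g →
      ∫ ω, g (Y c ω) ∂P = ∫ ω, g (m c + s c * X ω) ∂P := fun c hc g hg => by
    have h1 := congrArg (fun ν : Measure ℝ => ∫ x, g x ∂ν) (hlaw c hc)
    rw [integral_map (hYm c) hg.aestronglyMeasurable,
      integral_map (hsXm c) hg.aestronglyMeasurable] at h1
    simpa only [add_comm] using h1
  have tri : ∀ c ∈ K, ∀ g : ℝ → ℝ, Continuous g → Integrable (fun ω => g (m c + s c * X ω)) P →
      Integrable (fun ω => g (Y c ω)) P := fun c hc g hg hi => by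
    have h1 : Integrable g (P.map (Y c)) := by
      rw [hlaw c hc, integrable_map_measure hg.aestronglyMeasurable (hsXm c)]
      refine hi.congr (ae_of_all _ fun ω => ?_)
      simp only [Function.comp_apply, add_comm]
    rwa [integrable_map_measure hg.aestronglyMeasurable (hYm c)] at h1
  have hTY : ∀ c ∈ K, Integrable (fun ω => T (Y c ω)) P := fun c hc =>
    tri c hc T hTc (hint _ _)
  have hconst : ∃ y z, T y ≠ T z := by
    rcases halt with h | h
    · by_contra! hc
      have := h.1.lt_midpoint (x := 0) (y := 1) zero_ne_one
      rw [hc 0 ((0 + 1) / 2), hc 1 ((0 + 1) / 2)] at this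
      linarith
    · exact h.2.1
  have hXi : Integrable X P := integrable_of_integrable_reward hTmono hTconc hconst hX hint
  -- Otherwise both gains would be constant, and so would their difference.
  have hXne : ¬ ∀ᵐ ω ∂P, X ω = 0 := fun h => by
    have h1 : ∀ c ∈ K, ∀ᵐ ω ∂P, Y c ω = m c := fun c hc => by
      have h2 : P.map (Y c) = P.map fun _ => m c := by
        rw [hlaw c hc]
        refine Measure.map_congr ?_
        filter_upwards [h] with ω hω
        simp [hω, hm]
      have h3 : ∀ᵐ x ∂(P.map fun _ : Ω => m c), x = m c := by
        refine (ae_map_iff aemeasurable_const (measurableSet_singleton (m c))).2 ?_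
        exact ae_of_all _ fun _ => rfl
      rw [← h2] at h3
      exact ae_of_ae_map (hYm c) h3
    refine hnd' (m a - m b) ?_
    filter_upwards [h1 a ha, h1 b hb] with ω h2 h3
    rw [h2, h3]
  have hXabs : 0 < ∫ ω, |X ω| ∂P := by
    refine lt_of_le_of_ne (integral_nonneg fun _ => abs_nonneg _) fun h => hXne ?_
    have := (integral_eq_zero_iff_of_nonneg (fun ω => abs_nonneg (X ω)) hXi.abs).1 h.symm
    filter_upwards [this] with ω hω
    exact abs_eq_zero.1 hω
  -- the scale is a convex function of the position
  have habs : ∀ c ∈ K, Integrable (fun ω => |Y c ω - m c|) P ∧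
      ∫ ω, |Y c ω - m c| ∂P = s c * ∫ ω, |X ω| ∂P := fun c hc => by
    have hg : Continuous fun x : ℝ => |x - m c| := by fun_prop
    have e : ∀ ω, |m c + s c * X ω - m c| = s c * |X ω| := fun ω => by
      rw [add_sub_cancel_left, abs_mul, abs_of_nonneg (hs0 c hc)]
    refine ⟨tri c hc _ hg ?_, ?_⟩
    · simp_rw [e]; exact hXi.abs.const_mul _
    · rw [tr c hc _ hg]
      simp_rw [e]
      rw [integral_const_mul]
  have hsmid : s mid ≤ (s a + s b) / 2 := by
    have h1 : ∫ ω, |Y mid ω - m mid| ∂P ≤ ∫ ω, (|Y a ω - m a| + |Y b ω - m b|) / 2 ∂P := by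
      refine integral_mono (habs _ hmidK).1 (((habs a ha).1.add (habs b hb).1).div_const 2)
        fun ω => ?_
      simp only
      rw [hYmid, hmmid, show (Y a ω + Y b ω) / 2 - (m a + m b) / 2 =
        ((Y a ω - m a) + (Y b ω - m b)) / 2 by ring, abs_div, abs_two]
      have := abs_add_le (Y a ω - m a) (Y b ω - m b)
      linarith
    rw [integral_div, integral_add (habs a ha).1 (habs b hb).1, (habs _ hmidK).2, (habs a ha).2,
      (habs b hb).2, ← add_mul, mul_div_right_comm] at h1
    exact le_of_mul_le_mul_right h1 hXabs
  have hρ0 : 0 ≤ ρ₀ := by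
    rcases halt with h | h
    · exact h.2
    · exact (h.2.2 hXne).le
  -- the two terms of the functional are concave along the segment
  have hTpt : ∀ ω, (T (Y a ω) + T (Y b ω)) / 2 ≤ T (Y mid ω) := fun ω => by
    rw [hYmid]
    exact hTconc.le_midpoint _ _
  set R : EuclideanSpace ℝ (Fin d) → ℝ := fun c => s c * ρ₀ - δ * m c with hR
  have hRmid : R mid ≤ (R a + R b) / 2 := by
    simp only [hR, hmmid]
    have := mul_le_mul_of_nonneg_right hsmid hρ0
    linarith
  have hFmid : F ((R a + R b) / 2) ≤ (F (R a) + F (R b)) / 2 := hFconv.midpoint_le _ _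
  have hTint : ∫ ω, (T (Y a ω) + T (Y b ω)) / 2 ∂P =
      (∫ ω, T (Y a ω) ∂P + ∫ ω, T (Y b ω) ∂P) / 2 := by
    rw [integral_div, integral_add (hTY a ha) (hTY b hb)]
  have hTavg : Integrable (fun ω => (T (Y a ω) + T (Y b ω)) / 2) P :=
    ((hTY a ha).add (hTY b hb)).div_const 2
  have hTle := integral_mono hTavg (hTY mid hmidK) hTpt
  rw [hTint] at hTle
  have hmr : ∀ c ∈ K, meanRisk P T F lam ρ₀ δ X (s c) (m c) =
      ∫ ω, T (Y c ω) ∂P - lam * F (R c) := fun c hc => by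
    rw [meanRisk, tr c hc T hTc]
  have e1 := hamax mid hmidK
  have e2 := hamax b hb
  have e3 := hbmax a ha
  rw [hmr a ha, hmr mid hmidK] at e1
  rw [hmr a ha, hmr b hb] at e2 e3
  have hF1 : F (R mid) ≤ F ((R a + R b) / 2) := hFmono hRmid
  have hFl1 := mul_le_mul_of_nonneg_left hF1 hlam.le
  have hFl2 := mul_le_mul_of_nonneg_left hFmid hlam.le
  have hTeq : ∫ ω, T (Y mid ω) ∂P ≤ (∫ ω, T (Y a ω) ∂P + ∫ ω, T (Y b ω) ∂P) / 2 := by linarith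
  have hTae : ∀ᵐ ω ∂P, (T (Y a ω) + T (Y b ω)) / 2 = T (Y mid ω) :=
    ae_eq_of_integral_midpoint_le hTavg (hTY mid hmidK) (ae_of_all _ hTpt) (by rwa [hTint])
  -- Strict concavity of the reward turns the almost sure equality into `Y a = Y b`. Under strict
  -- convexity of `F` the equality of the penalties gives equal risks and a scale that is affine at
  -- the midpoint.
  rcases halt with ⟨hTs, -⟩ | ⟨hFs, -, hρ⟩
  · refine hnd' 0 ?_
    filter_upwards [hTae] with ω hω
    by_contra hne
    have := hTs.lt_midpoint (sub_ne_zero.1 hne)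
    rw [hYmid] at hω
    linarith
  · have hρ0' := hρ hXne
    have hge1 : (F (R a) + F (R b)) / 2 ≤ F (R mid) := by
      refine le_of_mul_le_mul_left ?_ hlam
      linarith
    have hRab : R a = R b := by
      by_contra hne
      have := hFs.midpoint_lt hne
      linarith
    have hRm : R mid = R a := by
      refine le_antisymm (by linarith) ((strictMono_of_strictConvexOn hFmono hFs).le_iff_le.1 ?_)
      rw [← hRab] at hge1
      linarith
    have hsm : s mid = (s a + s b) / 2 := by
      have h1 : (s mid - (s a + s b) / 2) * ρ₀ = 0 := by
        simp only [hR, hmmid] at hRm hRab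
        linarith
      rcases mul_eq_zero.1 h1 with h | h
      · linarith
      · exact absurd h hρ0'.ne'
    -- If the scales agree, the centred gains at `a`, `b` and the midpoint have the same law. The
    -- strictly convex test function then forces the centred gains at `a` and `b` to coincide, so `Y
    -- a - Y b` is constant.
    by_cases hsab : s a = s b
    · have hψ : Continuous fun x : ℝ => Real.sqrt (1 + x ^ 2) := by fun_prop
      have hψi : ∀ β : ℝ, Integrable (fun ω => Real.sqrt (1 + (β * X ω) ^ 2)) P := fun β => by
        refine ((integrable_const (1 : ℝ)).add ((hXi.const_mul β).abs)).mono
          (hψ.measurable.comp (hX.const_mul β)).aestronglyMeasurable (ae_of_all _ fun ω => ?_)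
        simp only [Pi.add_apply]
        rw [Real.norm_of_nonneg (Real.sqrt_nonneg _), Real.norm_of_nonneg (by positivity)]
        refine Real.sqrt_le_iff.2 ⟨by positivity, ?_⟩
        nlinarith [sq_abs (β * X ω), abs_nonneg (β * X ω)]
      have hψY : ∀ c ∈ K, Integrable (fun ω => Real.sqrt (1 + (Y c ω - m c) ^ 2)) P ∧
          ∫ ω, Real.sqrt (1 + (Y c ω - m c) ^ 2) ∂P =
            ∫ ω, Real.sqrt (1 + (s c * X ω) ^ 2) ∂P := fun c hc => by
        have hg : Continuous fun x : ℝ => Real.sqrt (1 + (x - m c) ^ 2) := by fun_prop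
        constructor
        · refine tri c hc _ hg ?_
          simp only [add_sub_cancel_left]
          exact hψi _
        · rw [tr c hc _ hg]
          simp only [add_sub_cancel_left]
      have hsma : s mid = s a := by rw [hsm, ← hsab]; ring
      have havg : ∀ ω, Y mid ω - m mid = ((Y a ω - m a) + (Y b ω - m b)) / 2 := fun ω => by
        rw [hYmid, hmmid]; ring
      have hae : ∀ᵐ ω ∂P, Real.sqrt (1 + (Y mid ω - m mid) ^ 2) =
          (Real.sqrt (1 + (Y a ω - m a) ^ 2) + Real.sqrt (1 + (Y b ω - m b) ^ 2)) / 2 := by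
        refine ae_eq_of_integral_midpoint_le (hψY mid hmidK).1
          (((hψY a ha).1.add (hψY b hb).1).div_const 2) (ae_of_all _ fun ω => ?_) ?_
        · simp only [havg]
          exact (sqrt_one_add_sq_midpoint_le _ _).1
        · rw [integral_div]
          rw [integral_add (hψY a ha).1 (hψY b hb).1, (hψY a ha).2, (hψY b hb).2,
            (hψY mid hmidK).2, hsma, ← hsab]
          linarith
      refine hnd' (m a - m b) ?_
      filter_upwards [hae] with ω hω
      rw [havg] at hω
      have := (sqrt_one_add_sq_midpoint_le _ _).2 hω
      linarith
    -- Under shift-invariance the risk is the scale times `ρ₀ > 0`, so equal risks already mean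
    -- equal scales.
    · rcases hδ with rfl | rfl
      · simp only [hR, zero_mul, sub_zero] at hRab
        exact hsab (mul_right_cancel₀ hρ0'.ne' hRab)
      · have hmc : ∀ c, m c = s c * ρ₀ - R c := fun c => by simp only [hR]; ring
        -- Equality holds almost surely at `X` and both sides are continuous, so it extends to the
        -- whole line because `X` has full support.
        have hTeqX : ∀ z, T (m mid + s mid * z) = (T (m a + s a * z) + T (m b + s b * z)) / 2 := by
          intro z
          have hpt : ∀ z, (T (m a + s a * z) + T (m b + s b * z)) / 2 ≤ T (m mid + s mid * z) := by
            intro z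
            rw [hmmid, hsm, show (m a + m b) / 2 + (s a + s b) / 2 * z =
              ((m a + s a * z) + (m b + s b * z)) / 2 by ring]
            exact hTconc.le_midpoint _ _
          have h1 := ae_eq_of_integral_midpoint_le (P := P)
            (((hint (m a) (s a)).add (hint (m b) (s b))).div_const 2) (hint (m mid) (s mid))
            (ae_of_all _ fun ω => hpt (X ω)) (by
              rw [integral_div]
              have := integral_add (hint (m a) (s a)) (hint (m b) (s b))
              simp only [Pi.add_apply] at this ⊢
              rw [this, ← tr a ha T hTc, ← tr b hb T hTc, ← tr mid hmidK T hTc]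
              exact hTeq)
          have h2 := hXs hXi hXne (fun z => T (m mid + s mid * z) -
            (T (m a + s a * z) + T (m b + s b * z)) / 2) (by fun_prop) (by
              filter_upwards [h1] with ω hω
              simp only [Pi.add_apply] at hω
              rw [hω, sub_self]) z
          exact sub_eq_zero.1 h2
        have hTy : ∀ y, T ((s a + s b) / 2 * y - R a) =
            (T (s a * y - R a) + T (s b * y - R a)) / 2 := by
          intro y
          -- Cash-invariance gives `m = s ρ₀ - R` with a common risk `R`, so the substitution `z = y
          -- - ρ₀` turns `m + s z` into `s y - R`.
          have := hTeqX (y - ρ₀)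
          rw [hmc mid, hmc a, hmc b, hRm, ← hRab, hsm] at this
          convert this using 2
          · ring
          · congr 2 <;> ring
        obtain ⟨p, hp⟩ : ∃ p, ∀ x, T x = T 0 + p * x := by
          rcases lt_or_gt_of_ne hsab with hlt | hlt
          · exact ⟨_, hTconc.affine_of_midpoint (q := R a) hT (hs0 a ha) hlt hTy⟩
          · refine ⟨_, hTconc.affine_of_midpoint (q := R a) hT (hs0 b hb) hlt fun y => ?_⟩
            rw [add_comm (s b), add_comm (T (s b * y - R a))]
            exact hTy y
        have hp0 : p ≠ 0 := by
          rintro rfl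
          obtain ⟨y, z, hyz⟩ := hconst
          exact hyz (by rw [hp y, hp z]; ring)
        -- For an affine reward and centred noise the expected reward sees only the mean. Equal
        -- values of the functional then give equal means, and equal risks turn these into equal
        -- scales.
        have hTlin : ∀ c ∈ K, ∫ ω, T (Y c ω) ∂P = T 0 + p * m c := fun c hc => by
          rw [tr c hc T hTc]
          have : ∀ ω, T (m c + s c * X ω) = (T 0 + p * m c) + (p * s c) * X ω := fun ω => by
            rw [hp]; ring
          simp_rw [this]
          rw [integral_add (integrable_const _) (hXi.const_mul _), integral_const_mul, hX0 hXi]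
          simp
        rw [hTlin a ha, hTlin b hb, hRab] at e2 e3
        have hmab : m a = m b := mul_left_cancel₀ hp0 (by linarith)
        rw [hmc a, hmc b, hRab] at hmab
        exact hsab (mul_right_cancel₀ hρ0'.ne' (by linarith))

end onePeriod

end

section

/-! ### The mean-risk functional as a function of the current position -/

namespace RiskMeasure

variable {Ω : Type*} [MeasurableSpace Ω] {P : Measure Ω} (ρ : RiskMeasure P) {X : Ω → ℝ}

lemma ofLaw_map {Y : Ω → ℝ} (hY : Y ∈ ρ.domain) : ρ.ofLaw (P.map Y) = ρ.toFun Y := by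
  have h : ∃ Y' ∈ ρ.domain, P.map Y' = P.map Y := ⟨Y, hY, rfl⟩
  rw [ofLaw, dif_pos h]
  exact ρ.law_invariant _ h.choose_spec.1 _ hY h.choose_spec.2

/-- The risk of a scaled and shifted random variable. -/
lemma exists_toFun_scaled {ρ₀ : ℝ} (hX : X ∈ ρ.domain) (hρ : ρ.toFun X = (ρ₀ : EReal)) :
    ∃ δ : ℝ, (δ = 0 ∨ δ = 1) ∧ ∀ s m : ℝ, 0 ≤ s → (fun ω => s * X ω + m) ∈ ρ.domain ∧
      ρ.toFun (fun ω => s * X ω + m) = ((s * ρ₀ - δ * m : ℝ) : EReal) := by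
  have h1 : ∀ s : ℝ, 0 ≤ s → ρ.toFun (fun ω => s * X ω) = ((s * ρ₀ : ℝ) : EReal) := fun s hs => by
    rw [ρ.pos_homogeneous X hX s hs, hρ, EReal.coe_mul]
  rcases ρ.cash_or_shift with h | h
  · refine ⟨1, Or.inr rfl, fun s m hs => ⟨ρ.shift_mem _ (ρ.smul_mem X hX s hs) m, ?_⟩⟩
    rw [h _ (ρ.smul_mem X hX s hs) m, h1 s hs, one_mul, EReal.coe_sub]
  · refine ⟨0, Or.inl rfl, fun s m hs => ⟨ρ.shift_mem _ (ρ.smul_mem X hX s hs) m, ?_⟩⟩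
    rw [h _ (ρ.smul_mem X hX s hs) m, h1 s hs, zero_mul, sub_zero]

end RiskMeasure

lemma isCompact_convex_box {d : ℕ} (l M : ℝ) :
    IsCompact {v : EuclideanSpace ℝ (Fin d) | ∀ i, l ≤ v i ∧ v i ≤ M} ∧
    Convex ℝ {v : EuclideanSpace ℝ (Fin d) | ∀ i, l ≤ v i ∧ v i ≤ M} := by
  constructor
  · have h : {v : EuclideanSpace ℝ (Fin d) | ∀ i, l ≤ v i ∧ v i ≤ M} =
        WithLp.toLp 2 '' (univ.pi fun _ : Fin d => Icc l M) := by
      ext v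
      constructor
      · intro hv
        exact ⟨v.ofLp, fun i _ => hv i, rfl⟩
      · rintro ⟨w, hw, rfl⟩ i
        exact hw i (mem_univ i)
    rw [h]
    exact (isCompact_univ_pi fun _ => isCompact_Icc).image (PiLp.continuous_toLp 2 _)
  · intro v hv w hw a b ha hb hab i
    have h1 := hv i
    have h2 := hw i
    simp only [PiLp.add_apply, PiLp.smul_apply, smul_eq_mul]
    have hl : ∀ y : ℝ, a * y + b * y = y := fun y => by rw [← add_mul, hab, one_mul]
    have h3 := mul_le_mul_of_nonneg_left h1.1 ha
    have h4 := mul_le_mul_of_nonneg_left h2.1 hb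
    have h5 := mul_le_mul_of_nonneg_left h1.2 ha
    have h6 := mul_le_mul_of_nonneg_left h2.2 hb
    constructor
    · linarith [hl l]
    · linarith [hl M]

namespace MeanRiskProblem

variable {Ω : Type*} {mΩ : MeasurableSpace Ω} {P : Measure Ω} [IsProbabilityMeasure P] {d N : ℕ}
  {D : MeanRiskProblem P d N} {α M : ℝ}

lemma compact_convex_nonempty_K (hM : 0 < M)
    (hK : (P.map (fun ω => -D.L 1 ω) = P.map (D.L 1) ∧ D.K = {v | ∀ i, |v i| ≤ M}) ∨
      (d = 1 ∧ D.K = {v | ∀ i, 0 ≤ v i ∧ v i ≤ M})) :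
    IsCompact D.K ∧ Convex ℝ D.K ∧ (0 : EuclideanSpace ℝ (Fin d)) ∈ D.K := by
  rcases hK with ⟨-, hK⟩ | ⟨-, hK⟩
  · simp_rw [abs_le] at hK
    have := isCompact_convex_box (d := d) (-M) M
    rw [hK]
    exact ⟨this.1, this.2, fun i => by simp [hM.le]⟩
  · have := isCompact_convex_box (d := d) 0 M
    rw [hK]
    exact ⟨this.1, this.2, fun i => by simp [hM.le]⟩

/-- Given deterministic positions after the `n`-th period, the mean-risk functional is a continuous
deterministic function of the current position, with at most one maximiser under the
assumptions for uniqueness. -/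
theorem exists_objective (hD : D.IsRegular α)
    (hσpos : ∀ t ∈ Icc 0 D.horizon, (D.σ t).PosDef) (hM : 0 < M)
    (hK : (P.map (fun ω => -D.L 1 ω) = P.map (D.L 1) ∧ D.K = {v | ∀ i, |v i| ≤ M}) ∨
      (d = 1 ∧ D.K = {v | ∀ i, 0 ≤ v i ∧ v i ≤ M}))
    (hT : ContDiff ℝ 1 D.reward) (hTmono : Monotone D.reward)
    (hTconc : ConcaveOn ℝ univ D.reward)
    (hF : ContDiff ℝ 1 D.F) (hFmono : Monotone D.F) (hFconv : ConvexOn ℝ univ D.F)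
    (hlampos : ∀ t ∈ Icc 0 D.horizon, 0 < D.lam t)
    (hTint : ∀ (a : ℝ) (b : EuclideanSpace ℝ (Fin d)), ∀ t ∈ Ioc 0 D.horizon,
      Integrable (fun ω => D.reward (a + inner ℝ b (D.L t ω))) P)
    (hρ : ∀ a ∈ D.K, (fun ω => inner ℝ a (D.L 1 ω)) ∈ D.ρ.domain ∧
      D.ρ.toFun (fun ω => inner ℝ a (D.L 1 ω)) < ⊤)
    (n : Fin N) (v : Fin N → EuclideanSpace ℝ (Fin d)) (hv : ∀ k, v k ∈ D.K) :
    ∃ j : EuclideanSpace ℝ (Fin d) → ℝ, ContinuousOn j D.K ∧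
      (∀ (x : ℝ) (u : Fin N → Ω → EuclideanSpace ℝ (Fin d)),
        (∀ k, D.AdmissiblePosition k (u k)) → (∀ k, n < k → u k =ᵐ[P] fun _ => v k) →
        D.WellPosed n x u ∧ ∀ᵐ ω ∂P, D.J n x u ω = j (u n ω)) ∧
      ((∀ a : EuclideanSpace ℝ (Fin d), a ≠ 0 → ¬ ∀ᵐ ω ∂P, inner ℝ a (D.L 1 ω) = 0) →
      ((StrictConcaveOn ℝ univ D.reward ∧
          ∀ a ∈ D.K, 0 ≤ D.ρ.toFun (fun ω => inner ℝ a (D.L 1 ω))) ∨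
        (StrictConvexOn ℝ univ D.F ∧ (∃ y z, D.reward y ≠ D.reward z) ∧
          ∀ a ∈ D.K, a ≠ 0 → 0 < D.ρ.toFun (fun ω => inner ℝ a (D.L 1 ω)))) →
        ∀ a ∈ D.K, ∀ b ∈ D.K, (∀ c ∈ D.K, j c ≤ j a) → (∀ c ∈ D.K, j c ≤ j b) → a = b) := by
  obtain ⟨hKcomp, hKconv, hK0⟩ := D.compact_convex_nonempty_K hM hK
  obtain ⟨a₀, ha₀, hscaled⟩ := hD.exists_scaled hσpos hM hK
  obtain ⟨Z, s, μ₁, μ₂, hZ, hind, hgain, hsc, hs0, hlaw, hnd⟩ := hscaled n v hv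
  set X : Ω → ℝ := fun ω => inner ℝ a₀ (D.L 1 ω) with hX
  have hXm : Measurable X := hD.stable.measurable_inner a₀ zero_le_one
  obtain ⟨hXdom, hXtop⟩ := hρ a₀ ha₀
  obtain ⟨ρ₀, hρ₀⟩ : ∃ ρ₀ : ℝ, D.ρ.toFun X = (ρ₀ : EReal) :=
    ⟨_, (EReal.coe_toReal hXtop.ne (D.ρ.ne_bot X hXdom)).symm⟩
  obtain ⟨δ, hδ, hrisk⟩ := D.ρ.exists_toFun_scaled hXdom hρ₀
  set m : EuclideanSpace ℝ (Fin d) → ℝ := fun c => inner ℝ c μ₁ + μ₂ with hm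
  have hmc : Continuous m := by fun_prop
  have hTc : Continuous D.reward := hT.continuous
  have hFc : Continuous D.F := hF.continuous
  have hint : ∀ y β : ℝ, Integrable (fun ω => D.reward (y + β * X ω)) P :=
    hD.stable.integrable_comp_inner (hD.horizon_pos n) hTc
      (fun y b => hTint y b _ ⟨hD.horizon_pos n, le_rfl⟩) a₀
  set h : EuclideanSpace ℝ (Fin d) × (EuclideanSpace ℝ (Fin d) × ℝ) → ℝ :=
    fun p => inner ℝ p.1 p.2.1 + p.2.2 with hh
  have hhm : Measurable h := by
    have : Continuous h := by fun_prop
    exact this.measurable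
  have hYm : ∀ c, AEMeasurable (fun ω => h (c, Z ω)) P := fun c =>
    (hhm.comp measurable_prodMk_left).comp_aemeasurable hZ
  have hsXm : ∀ c, AEMeasurable (fun ω => s c * X ω + m c) P := fun c => by fun_prop
  obtain ⟨y₀, hy₀⟩ := hKcomp.exists_bound_of_continuousOn hmc.continuousOn
  obtain ⟨β₀, hβ₀⟩ := hKcomp.exists_bound_of_continuousOn hsc
  obtain ⟨g, hg, hgb⟩ := exists_reward_bound hTmono hint y₀ β₀
  refine ⟨fun c => meanRisk P D.reward D.F (D.lam (D.start n)) ρ₀ δ X (s c) (m c), ?_, ?_, ?_⟩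
  · refine ContinuousOn.sub (continuousOn_integral_reward hTc hTmono hint hKcomp
      hmc.continuousOn hsc) (continuousOn_const.mul (hFc.comp_continuousOn ?_))
    exact (hsc.mul continuousOn_const).sub (continuousOn_const.mul hmc.continuousOn)
  · intro x u hu huv
    have hum : ∀ k, Measurable (u k) := fun k => (hu k).1.mono (D.𝓕.le _) le_rfl
    obtain ⟨hex, hgae⟩ := hgain x u hum huv
    have hY : D.gain n x u =ᵐ[P] fun ω => h (u n ω, Z ω) := hgae
    have hle := D.𝓕.le (D.start n)
    have hrint : Integrable (fun ω => D.reward (D.gain n x u ω)) P := by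
      -- The compactness of `K` bounds shift and scale, so a single integrable function dominates
      -- the frozen rewards of all positions.
      refine integrable_comp_of_measure_inter hle hZ hind hhm (hu n).1 hY hTc
        (C := ∫⁻ ω, ‖g ω‖ₑ ∂P) hg.2.ne fun ω => ?_
      have h1 : ∫⁻ ω', ‖D.reward (h (u n ω, Z ω'))‖ₑ ∂P =
          ∫⁻ ω', ‖D.reward (s (u n ω) * X ω' + m (u n ω))‖ₑ ∂P := by
        have h2 := congrArg (fun ν : Measure ℝ => ∫⁻ x, ‖D.reward x‖ₑ ∂ν)
          (hlaw (u n ω) ((hu n).2 ω))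
        have h3 : Measurable fun x => ‖D.reward x‖ₑ := hTc.measurable.enorm
        rwa [lintegral_map' h3.aemeasurable (hYm (u n ω)),
          lintegral_map' h3.aemeasurable (hsXm (u n ω))] at h2
      rw [h1]
      refine lintegral_mono fun ω' => ?_
      have h4 := hgb (m (u n ω)) (s (u n ω)) ω' (hy₀ _ ((hu n).2 ω)) (hβ₀ _ ((hu n).2 ω))
      rw [add_comm (m _)] at h4
      rw [Real.enorm_eq_ofReal_abs, Real.enorm_eq_ofReal_abs]
      exact ENNReal.ofReal_le_ofReal (h4.trans (le_abs_self _))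
    have hcl := condLaw_ae_eq hle hZ hind hhm (hu n).1 hY
    refine ⟨⟨hex, hrint, ?_⟩, ?_⟩
    · filter_upwards [hcl] with ω hω
      have h1 := hrisk (s (u n ω)) (m (u n ω)) (hs0 _ ((hu n).2 ω))
      refine ⟨_, h1.1, ?_, ?_⟩
      · rw [hω]
        exact (hlaw (u n ω) ((hu n).2 ω)).symm
      · rw [h1.2]
        exact EReal.coe_lt_top _
    · filter_upwards [hcl, condExp_comp_ae_eq hle hZ hind hhm (hu n).1 hY hTc hrint] with ω h1 h2
      have h3 := hrisk (s (u n ω)) (m (u n ω)) (hs0 _ ((hu n).2 ω))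
      have h4 : P.map (fun ω' => h (u n ω, Z ω')) =
        P.map fun ω' => s (u n ω) * X ω' + m (u n ω) := hlaw (u n ω) ((hu n).2 ω)
      have h5 : ∫ ω', D.reward (h (u n ω, Z ω')) ∂P =
          ∫ ω', D.reward (m (u n ω) + s (u n ω) * X ω') ∂P := by
        have h6 := congrArg (fun ν : Measure ℝ => ∫ x, D.reward x ∂ν) h4
        rw [integral_map (hYm (u n ω)) hTc.aestronglyMeasurable,
          integral_map (hsXm (u n ω)) hTc.aestronglyMeasurable] at h6
        simpa only [add_comm] using h6
      rw [J, h2, h5, RiskMeasure.cond, h1, h4, D.ρ.ofLaw_map h3.1, h3.2, EReal.toReal_coe, meanRisk]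
  · intro hnondeg halt a ha b hb hamax hbmax
    refine maximiser_unique hKconv hT hTmono hTconc hFmono hFconv
      (hlampos _ ⟨hD.start_nonneg n, (hD.start_lt n).le⟩) hδ hXm hint
      (fun hi => hD.stable.integral_inner_eq_zero hi)
      (fun hi hne g hg h0 z => hD.stable.eq_zero_of_ae_eq_zero hi hne hg h0 z) hZ hs0 hlaw
      (hnd hnondeg) ?_ ha hb hamax hbmax
    rcases halt with ⟨h1, h2⟩ | ⟨h1, h2, h3⟩
    · refine Or.inl ⟨h1, ?_⟩
      have h4 := h2 a₀ ha₀
      change 0 ≤ D.ρ.toFun X at h4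
      rw [hρ₀] at h4
      exact_mod_cast h4
    · refine Or.inr ⟨h1, h2, fun hne => ?_⟩
      -- Strict positivity of the risk is wanted only for a nonzero `X`, and then `a₀` is not zero.
      have h4 := h3 a₀ ha₀ (by
        rintro rfl
        exact hne (ae_of_all _ fun ω => by simp [hX]))
      change 0 < D.ρ.toFun X at h4
      rw [hρ₀] at h4
      exact_mod_cast h4

end MeanRiskProblem

end

section

/-! ### Backward recursion -/

namespace MeanRiskProblem

variable {Ω : Type*} {mΩ : MeasurableSpace Ω} {P : Measure Ω} [IsProbabilityMeasure P] {d N : ℕ}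
  {D : MeanRiskProblem P d N}

lemma admissiblePosition_const (n : Fin N) {c : EuclideanSpace ℝ (Fin d)} (hc : c ∈ D.K) :
    D.AdmissiblePosition n (fun _ => c) :=
  ⟨measurable_const, fun _ => hc⟩

lemma admissiblePosition_update {u : Fin N → Ω → EuclideanSpace ℝ (Fin d)} {n : Fin N}
    {ξ : Ω → EuclideanSpace ℝ (Fin d)} (hu : ∀ k, D.AdmissiblePosition k (u k))
    (hξ : D.AdmissiblePosition n ξ) (k : Fin N) :
    D.AdmissiblePosition k (Function.update u n ξ k) := by
  rcases eq_or_ne k n with rfl | h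
  · rwa [Function.update_self]
  · rw [Function.update_of_ne h]
    exact hu k

lemma det_update (v : Fin N → EuclideanSpace ℝ (Fin d)) (n : Fin N)
    (c : EuclideanSpace ℝ (Fin d)) :
    (det (Function.update v n c) : Fin N → Ω → EuclideanSpace ℝ (Fin d)) =
      Function.update (det v) n fun _ => c := by
  funext k ω
  rcases eq_or_ne k n with rfl | h
  · simp [det]
  · simp [det, Function.update_of_ne h]

variable (D) in
/-- `j n v` represents the functional at the beginning of the `n`-th period as a continuous
deterministic function of the current position, given the positions `v` in later periods. -/
structure IsObjective
    (j : Fin N → (Fin N → EuclideanSpace ℝ (Fin d)) → EuclideanSpace ℝ (Fin d) → ℝ) : Prop where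
  continuousOn : ∀ (n : Fin N) (v : Fin N → EuclideanSpace ℝ (Fin d)), (∀ k, v k ∈ D.K) →
    ContinuousOn (j n v) D.K
  wellPosed : ∀ (n : Fin N) (v : Fin N → EuclideanSpace ℝ (Fin d)), (∀ k, v k ∈ D.K) →
    ∀ (x : ℝ) (u : Fin N → Ω → EuclideanSpace ℝ (Fin d)),
      (∀ k, D.AdmissiblePosition k (u k)) → (∀ k, n < k → u k =ᵐ[P] fun _ => v k) →
      D.WellPosed n x u
  ae_eq : ∀ (n : Fin N) (v : Fin N → EuclideanSpace ℝ (Fin d)), (∀ k, v k ∈ D.K) →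
    ∀ (x : ℝ) (u : Fin N → Ω → EuclideanSpace ℝ (Fin d)),
      (∀ k, D.AdmissiblePosition k (u k)) → (∀ k, n < k → u k =ᵐ[P] fun _ => v k) →
      ∀ᵐ ω ∂P, D.J n x u ω = j n v (u n ω)

namespace IsObjective

variable {j : Fin N → (Fin N → EuclideanSpace ℝ (Fin d)) → EuclideanSpace ℝ (Fin d) → ℝ}

lemma eq_update (hj : D.IsObjective j) {v : Fin N → EuclideanSpace ℝ (Fin d)} (hv : ∀ k, v k ∈ D.K)
    (n : Fin N) (x : ℝ) {ξ : Ω → EuclideanSpace ℝ (Fin d)} (hξ : D.AdmissiblePosition n ξ) :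
    ∀ᵐ ω ∂P, D.J n x (Function.update (det v) n ξ) ω = j n v (ξ ω) := by
  have h := hj.ae_eq n v hv x (Function.update (det v) n ξ)
    (admissiblePosition_update (fun k => admissiblePosition_const k (hv k)) hξ)
    (fun k hk => by rw [Function.update_of_ne hk.ne']; exact ae_eq_rfl)
  simpa only [Function.update_self] using h

lemma eq_det (hj : D.IsObjective j) {v : Fin N → EuclideanSpace ℝ (Fin d)}
    (hv : ∀ k, v k ∈ D.K) (n : Fin N) (x : ℝ) :
    ∀ᵐ ω ∂P, D.J n x (det v) ω = j n v (v n) :=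
  hj.ae_eq n v hv x (det v) (fun k => admissiblePosition_const k (hv k)) fun _ _ => ae_eq_rfl

/-- The objective depends only on the positions in later periods. -/
lemma congr (hj : D.IsObjective j) {v w : Fin N → EuclideanSpace ℝ (Fin d)} (hv : ∀ k, v k ∈ D.K)
    (hw : ∀ k, w k ∈ D.K) {n : Fin N} (h : ∀ k, n < k → v k = w k) {c : EuclideanSpace ℝ (Fin d)}
    (hc : c ∈ D.K) : j n v c = j n w c := by
  have h1 := hj.eq_update hv n 0 (admissiblePosition_const n hc)
  have h2 := hj.ae_eq n w hw 0 (Function.update (det v) n fun _ => c)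
    (admissiblePosition_update (fun k => admissiblePosition_const k (hv k))
      (admissiblePosition_const n hc))
    (fun k hk => by
      rw [Function.update_of_ne hk.ne']
      exact ae_of_all _ fun ω => h k hk)
  simp only [Function.update_self] at h2
  obtain ⟨ω, h3, h4⟩ := (h1.and h2).exists
  exact h3.symm.trans h4

/-- Backward induction on the number `i` of final periods that are already optimal. Changing the
position in an earlier period leaves the objectives of these periods untouched. -/
lemma exists_maximal (hj : D.IsObjective j) (hK : IsCompact D.K) (hne : D.K.Nonempty) :
    ∃ v : Fin N → EuclideanSpace ℝ (Fin d), (∀ k, v k ∈ D.K) ∧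
      ∀ n, ∀ c ∈ D.K, j n v c ≤ j n v (v n) := by
  have key : ∀ i : ℕ, ∃ v : Fin N → EuclideanSpace ℝ (Fin d), (∀ k, v k ∈ D.K) ∧
      ∀ n : Fin N, N ≤ n + i → ∀ c ∈ D.K, j n v c ≤ j n v (v n) := by
    intro i
    induction i with
    | zero =>
      obtain ⟨a, ha⟩ := hne
      exact ⟨fun _ => a, fun _ => ha, fun n hn => by omega⟩
    | succ i ih =>
      obtain ⟨v, hv, hmax⟩ := ih
      by_cases hi : i + 1 ≤ N
      -- The last period not yet treated; its objective is continuous on a compact set and attains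
      -- its maximum.
      · set m : Fin N := ⟨N - (i + 1), by omega⟩ with hm
        obtain ⟨a, ha, hamax⟩ := hK.exists_isMaxOn hne (hj.continuousOn m v hv)
        have hv' : ∀ k, Function.update v m a k ∈ D.K := fun k => by
          rcases eq_or_ne k m with rfl | h
          · rwa [Function.update_self]
          · rw [Function.update_of_ne h]
            exact hv k
        refine ⟨Function.update v m a, hv', fun n hn c hc => ?_⟩
        have hmn : m ≤ n := by
          rw [Fin.le_def]
          simp only [hm]
          omega
        have hlater : ∀ k, n < k → Function.update v m a k = v k := fun k hk =>
          Function.update_of_ne (hmn.trans_lt hk).ne' _ _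
        rw [hj.congr hv' hv hlater hc, hj.congr hv' hv hlater (hv' n)]
        rcases eq_or_lt_of_le hmn with rfl | h
        · rw [Function.update_self]
          exact hamax hc
        · rw [Function.update_of_ne h.ne']
          refine hmax n ?_ c hc
          rw [Fin.lt_def] at h
          simp only [hm] at h
          omega
      · exact ⟨v, hv, fun n _ => hmax n (by omega)⟩
  obtain ⟨v, hv, hmax⟩ := key N
  exact ⟨v, hv, fun n => hmax n (by omega)⟩

lemma isEquilibrium_det (hj : D.IsObjective j) {v : Fin N → EuclideanSpace ℝ (Fin d)}
    (hv : ∀ k, v k ∈ D.K) (hmax : ∀ n, ∀ c ∈ D.K, j n v c ≤ j n v (v n)) :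
    D.IsEquilibrium (det v) := by
  refine ⟨fun n => admissiblePosition_const n (hv n), fun n x ξ hξ => ?_⟩
  filter_upwards [hj.eq_update hv n x hξ, hj.eq_det hv n x] with ω h1 h2
  rw [h1, h2]
  exact hmax n _ (hξ.2 ω)

/-- An almost sure inequality between constants holds at some, hence every, scenario. -/
lemma maximal_of_isDetEquilibrium (hj : D.IsObjective j) {v : Fin N → EuclideanSpace ℝ (Fin d)}
    (hv : D.IsDetEquilibrium v) (n : Fin N) {c : EuclideanSpace ℝ (Fin d)} (hc : c ∈ D.K) :
    j n v c ≤ j n v (v n) := by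
  have h := hv.2 n 0 c hc
  rw [det_update] at h
  obtain ⟨ω, h1, h2, h3⟩ := (h.and ((hj.eq_update hv.1 n 0 (admissiblePosition_const n hc)).and
    (hj.eq_det hv.1 n 0))).exists
  rwa [h2, h3] at h1

/-- If the maximisers are unique, every equilibrium is the deterministic one. -/
lemma ae_eq_of_isEquilibrium (hj : D.IsObjective j) {v : Fin N → EuclideanSpace ℝ (Fin d)}
    (hv : ∀ k, v k ∈ D.K) (hmax : ∀ n, ∀ c ∈ D.K, j n v c ≤ j n v (v n))
    (huniq : ∀ n, ∀ a ∈ D.K, ∀ b ∈ D.K, (∀ c ∈ D.K, j n v c ≤ j n v a) →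
      (∀ c ∈ D.K, j n v c ≤ j n v b) → a = b)
    {u : Fin N → Ω → EuclideanSpace ℝ (Fin d)} (hu : D.IsEquilibrium u) (n : Fin N) :
    u n =ᵐ[P] fun _ => v n := by
  have key : ∀ i : ℕ, ∀ n : Fin N, N ≤ n + i → u n =ᵐ[P] fun _ => v n := by
    intro i
    induction i with
    | zero => exact fun n hn => by omega
    | succ i ih =>
      intro n hn
      have hlater : ∀ k, n < k → u k =ᵐ[P] fun _ => v k := fun k hk =>
        ih k (by rw [Fin.lt_def] at hk; omega)
      have hadm := admissiblePosition_const n (hv n)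
      have h1 := hj.ae_eq n v hv 0 (Function.update u n fun _ => v n)
        (admissiblePosition_update hu.1 hadm)
        (fun k hk => by rw [Function.update_of_ne hk.ne']; exact hlater k hk)
      filter_upwards [h1, hj.ae_eq n v hv 0 u hu.1 hlater, hu.2 n 0 _ hadm] with ω h2 h3 h4
      rw [h2, h3, Function.update_self] at h4
      -- For almost every scenario the value of `u n` is itself a maximiser, since `u` does at least
      -- as well as the deterministic position.
      exact huniq n _ ((hu.1 n).2 ω) _ (hv n) (fun c hc => (hmax n c hc).trans h4) (hmax n)
  exact key N n (by omega)

end IsObjective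

end MeanRiskProblem

end

/-! ### The main theorem. -/

theorem theorem4p1 {Ω : Type*} [MeasurableSpace Ω] (P : Measure Ω) [IsProbabilityMeasure P]
    {d N : ℕ} (D : MeanRiskProblem P d N) (α M : ℝ)
    (hL : IsStableLevy P D.𝓕 α D.L)
    (hgrid0 : D.grid 0 = 0) (hgrid : StrictMono D.grid)
    (hμ : ContinuousOn D.μ (Icc 0 D.horizon))
    (hσ : ContinuousOn D.σ (Icc 0 D.horizon))
    (hσpos : ∀ t ∈ Icc 0 D.horizon, (D.σ t).PosDef)
    (hM : 0 < M)
    (hK : (P.map (fun ω => -D.L 1 ω) = P.map (D.L 1) ∧ D.K = {v | ∀ i, |v i| ≤ M}) ∨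
      (d = 1 ∧ D.K = {v | ∀ i, 0 ≤ v i ∧ v i ≤ M}))
    (hT : ContDiff ℝ 1 D.reward) (hTmono : Monotone D.reward)
    (hTconc : ConcaveOn ℝ univ D.reward)
    (hF : ContDiff ℝ 1 D.F) (hFmono : Monotone D.F) (hFconv : ConvexOn ℝ univ D.F)
    (hlam : ContinuousOn D.lam (Icc 0 D.horizon))
    (hlampos : ∀ t ∈ Icc 0 D.horizon, 0 < D.lam t)
    (hTint : ∀ (a : ℝ) (b : EuclideanSpace ℝ (Fin d)), ∀ t ∈ Ioc 0 D.horizon,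
      Integrable (fun ω => D.reward (a + inner ℝ b (D.L t ω))) P)
    (hρ : ∀ a ∈ D.K, (fun ω => inner ℝ a (D.L 1 ω)) ∈ D.ρ.domain ∧
      D.ρ.toFun (fun ω => inner ℝ a (D.L 1 ω)) < ⊤) :
    -- a deterministic strategy attains the supremum, with a deterministic optimal value
    (∃ (v : Fin N → EuclideanSpace ℝ (Fin d)) (V : Fin N → ℝ),
      D.IsEquilibrium (MeanRiskProblem.det v) ∧
      ∀ (n : Fin N) (x : ℝ), ∀ᵐ ω ∂P, D.J n x (MeanRiskProblem.det v) ω = V n) ∧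
    -- the supremum may be taken over deterministic strategies only
    (∀ v : Fin N → EuclideanSpace ℝ (Fin d), D.IsDetEquilibrium v →
      D.IsEquilibrium (MeanRiskProblem.det v)) ∧
    -- every functional that is compared in the two previous claims is well defined
    (∀ v : Fin N → EuclideanSpace ℝ (Fin d), (∀ k, v k ∈ D.K) →
      ∀ (n : Fin N) (x : ℝ) (ξ : Ω → EuclideanSpace ℝ (Fin d)), D.AdmissiblePosition n ξ →
        D.WellPosed n x (Function.update (MeanRiskProblem.det v) n ξ)) ∧
    -- uniqueness
    ((∀ a : EuclideanSpace ℝ (Fin d), a ≠ 0 → ¬ ∀ᵐ ω ∂P, inner ℝ a (D.L 1 ω) = 0) →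
      ((StrictConcaveOn ℝ univ D.reward ∧
          ∀ a ∈ D.K, 0 ≤ D.ρ.toFun (fun ω => inner ℝ a (D.L 1 ω))) ∨
        (StrictConvexOn ℝ univ D.F ∧ (∃ y z, D.reward y ≠ D.reward z) ∧
          ∀ a ∈ D.K, a ≠ 0 → 0 < D.ρ.toFun (fun ω => inner ℝ a (D.L 1 ω)))) →
      ∀ u w : Fin N → Ω → EuclideanSpace ℝ (Fin d), D.IsEquilibrium u → D.IsEquilibrium w →
        ∀ k, u k =ᵐ[P] w k) := by
  have hD : D.IsRegular α := ⟨hL, hgrid0, hgrid, hμ, hσ⟩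
  obtain ⟨hKcomp, -, hK0⟩ := D.compact_convex_nonempty_K hM hK
  have hex := fun (n : Fin N) (v : Fin N → EuclideanSpace ℝ (Fin d)) (hv : ∀ k, v k ∈ D.K) =>
    D.exists_objective hD hσpos hM hK hT hTmono hTconc hF hFmono hFconv hlampos hTint hρ n v hv
  -- The objective is chosen separately for every `v`; that it depends only on later positions is
  -- recovered in `IsObjective.congr` from the functional `J` it represents.
  choose! j hjc hjw hju using hex
  have hj : D.IsObjective j := ⟨hjc, fun n v hv x u hu huv => (hjw n v hv x u hu huv).1,
    fun n v hv x u hu huv => (hjw n v hv x u hu huv).2⟩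
  obtain ⟨v, hv, hmax⟩ := hj.exists_maximal hKcomp ⟨0, hK0⟩
  refine ⟨⟨v, fun n => j n v (v n), hj.isEquilibrium_det hv hmax, hj.eq_det hv⟩,
    fun w hw => hj.isEquilibrium_det hw.1 fun n c hc => hj.maximal_of_isDetEquilibrium hw n hc,
    fun w hw n x ξ hξ => ?_, fun hnondeg halt u w hu hw k => ?_⟩
  · exact hj.wellPosed n w hw x _ (MeanRiskProblem.admissiblePosition_update
      (fun k => MeanRiskProblem.admissiblePosition_const k (hw k)) hξ)
      fun k hk => by rw [Function.update_of_ne hk.ne']; exact ae_eq_rfl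
  · have huniq := fun n => hju n v hv hnondeg halt
    exact (hj.ae_eq_of_isEquilibrium hv hmax huniq hu k).trans
      (hj.ae_eq_of_isEquilibrium hv hmax huniq hw k).symm
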